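/- **Setting.** Let $X$ be a Polish space with a $\sigma$-finite Borel measure $m$ of full topological support, $\mathcal H=L^2(X,m)$, and let $\mathcal E$ be a strongly local Dirichlet form on $\mathcal H$ with domain $\mathcal F$ and square field operator $\Gamma$, $\mathcal E(u,v)=\int_X\Gamma(u,v)\,dm$. $\mathcal F$ is a Hilbert space with scalar product $\mathcal E(u,v)+\int uv\,dm$, and $\mathcal F\subset\mathcal H\subset\mathcal F^*$. Let $T,L\in\mathbb R$. For $t\in(0,T)$ let $m_t=e^{-f_t}m$, where $f:(0,T)\times X\to\mathbb R$ is bounded and measurable, $f_t\in\mathcal F$, and $\Gamma(f_t)\le C$ $m$-a.e. with $C$ independent of $t$. For $t\in(0,T)$ let $\Gamma_t:\mathcal F\times\mathcal F\to L^1(X,m)$ be symmetric, positive semidefinite and bilinear with the diffusion property $\Gamma_t(\Psi(u_1,\dots,u_k),v)=\sum_i\Psi_i(u_1,\dots,u_k)\Gamma_t(u_i,v)$ (for $u_i,v\in\mathcal F\cap L^\infty$ and $\Psi\in C^1(\mathbb R^k)$ with $\Psi(0)=0$), and uniformly elliptic: $\frac1C\Gamma(u)\le\Gamma_t(u)\le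 C\,\Gamma(u)$ for all $t$ and $u$, with some $C>0$. Here $\Gamma(u)=\Gamma(u,u)$, etc. Assume the log-Lipschitz conditions $$|f_t(x)-f_s(x)|\le L|t-s|,\qquad |\Gamma_t(u)-\Gamma_s(u)|\le 2L\int_s^t\Gamma_r(u)\,dr\quad(s<t,\ u\in\mathcal F).$$ Put $\mathcal E_t(u,v)=\int_X\Gamma_t(u,v)\,dm_t$ and $\mathcal E_t(u)=\mathcal E_t(u,u)$ for $u,v\in\mathcal F$, and $\mathcal E_t(u)=\infty$ for $u\in\mathcal H\setminus\mathcal F$. Let $A_t$ be the self-adjoint operator on $L^2(X,m_t)$ with $\mathcal E_t(u,v)=-\int_X A_tu\,v\,dm_t$ for $u\in\mathrm{Dom}(A_t)$, $v\in\mathcal F$; thus $\mathrm{Dom}(A_t)$ is the set of $u\in\mathcal F$ for which such an $A_tu\in L^2(X,m_t)$ exists. Let $\mathcal F_{(s,\tau)}=L^2((s,\tau)\to\mathcal F)\cap H^1((s,\tau)\to\mathcal F^*)\subset C([s,\tau]\to\mathcal H)$, where functions are identified with their continuous $\mathcal H$-valued representatives. A solution of the heat equation $\partial_tu=A_tu$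 on $(s,\tau)\times X$ is a $u\in\mathcal F_{(s,\tau)}$ with $-\int_s^\tau\mathcal E_t(u_t,w_t)\,dt=\int_s^\tau\langle\partial_tu_t,w_te^{-f_t}\rangle_{\mathcal F^*,\mathcal F}\,dt$ for all $w\in\mathcal F_{(s,\tau)}$. A solution of the adjoint heat equation $\partial_sv=-A_sv+\partial_sf\cdot v$ on $(\sigma,t)\times X$ is a $v\in\mathcal F_{(\sigma,t)}$ with $\int_\sigma^t\mathcal E_s(v_s,w_s)\,ds+\int_\sigma^t\int_Xv_sw_s\,\partial_sf_s\,dm_s\,ds=\int_\sigma^t\langle\partial_sv_s,w_se^{-f_s}\rangle_{\mathcal F^*,\mathcal F}\,ds$ for all $w\in\mathcal F_{(\sigma,t)}$. **Theorem.** Let $0<s<\tau<T$ and let $u\in\mathcal F_{(s,T)}$ be a solution of the heat equation on $(s,T)\times X$. (i) $u_t\in\mathrm{Dom}(A_t)$ for a.e. $t\in(s,\tau)$. (ii) If $u_s\in\mathcal F$, then $u\in L^2((s,\tau)\to\mathrm{Dom}(A_\cdot))\cap H^1((s,\tau)\to\mathcal H)$, that is, $t\mapsto u_t$ and $t\mapsto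 A_tu_t$ are in $L^2((s,\tau)\to\mathcal H)$ and $u$ has a weak derivative in $L^2((s,\tau)\to\mathcal H)$. Moreover $u_\tau\in\mathcal F$ and $$e^{-3L\tau}\mathcal E_\tau(u_\tau)+2\int_s^\tau e^{-3Lt}\int_X|A_tu_t|^2\,dm_t\,dt\le e^{-3Ls}\,\mathcal E_s(u_s).$$ (iii) Let $0\le\sigma<t\le T$ and let $v\in\mathcal F_{(\sigma,t)}$ be a solution of the adjoint heat equation on $(\sigma,t)\times X$. Then $v_s\in\mathrm{Dom}(A_s)$ for a.e. $s\in(\sigma,t)$. If moreover $t<T$, then for all $s\in(\sigma,t)$ $$\mathcal E_s(v_s)+\|v_s\|^2_{L^2(m_s)}\le e^{K(t-s)}\Big[\mathcal E_t(v_t)+\|v_t\|^2_{L^2(m_t)}\Big],\qquad K=\max\{3L,\;L+\tfrac12L^2\}$$ (so $K=3L$ whenever $L\le4$). -/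

import Mathlib

open MeasureTheory Set Filter Topology
open scoped ContDiff

noncomputable section

namespace HeatFlow

/-- A strongly local (symmetric) Dirichlet form on `L²(X, m)`: a densely defined, closed,
nonnegative symmetric bilinear form with the Markov property for 1-Lipschitz maps fixing `0`. -/
structure DirichletForm {X : Type*} [MeasurableSpace X] (m : Measure X) where
  domain : Submodule ℝ (Lp ℝ 2 m)
  form : domain →ₗ[ℝ] domain →ₗ[ℝ] ℝ
  dense : Dense (domain : Set (Lp ℝ 2 m))
  symm : ∀ u v : domain, form u v = form v u
  nonneg : ∀ u : domain, 0 ≤ form u u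
  closed : ∀ u : ℕ → domain,
    (∀ ε : ℝ, 0 < ε → ∃ N : ℕ, ∀ i ≥ N, ∀ j ≥ N,
      form (u i - u j) (u i - u j) + ‖(u i - u j : Lp ℝ 2 m)‖ ^ 2 < ε) →
    ∃ v : domain, Tendsto
      (fun n => form (u n - v) (u n - v) + ‖(u n - v : Lp ℝ 2 m)‖ ^ 2) atTop (𝓝 0)
  markov : ∀ ξ : ℝ → ℝ, LipschitzWith 1 ξ → ξ 0 = 0 → ∀ u : domain,
    ∃ w : domain, ((w : Lp ℝ 2 m) : X → ℝ) =ᵐ[m] (fun x => ξ ((u : Lp ℝ 2 m) x)) ∧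
      form w w ≤ form u u
  stronglyLocal : ∀ (u v : domain) (c : ℝ),
    (∀ᵐ x ∂m, ((u : Lp ℝ 2 m) x + c) * (v : Lp ℝ 2 m) x = 0) → form u v = 0

namespace DirichletForm

variable {X : Type*} [MeasurableSpace X] {m : Measure X} (E : DirichletForm m)

/-- The form domain `F`, carrying below the Hilbert space structure given by the scalar product
`E(u, v) + ∫ u v dm` (a copy of `E.domain`, whose own norm is that of `L²`). -/
def Dom : Type _ := E.domain

instance : AddCommGroup E.Dom := inferInstanceAs (AddCommGroup E.domain)

instance : Module ℝ E.Dom := inferInstanceAs (Module ℝ E.domain)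

/-- The form, as a bilinear form on `F`. -/
def bilin : E.Dom →ₗ[ℝ] E.Dom →ₗ[ℝ] ℝ := E.form

/-- The inclusion of `F` into `L²(X, m)` as a linear map. -/
def incl : E.Dom →ₗ[ℝ] Lp ℝ 2 m := E.domain.subtype

/-- The scalar product `E(u, v) + ∫ u v dm` on `F`. -/
@[reducible] def core : InnerProductSpace.Core ℝ E.Dom where
  inner u v := E.bilin u v + inner ℝ (E.incl u) (E.incl v)
  conj_inner_symm u v := by
    have h : E.bilin v u = E.bilin u v := E.symm v u
    simp [h, real_inner_comm]
  re_inner_nonneg u := by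
    have h : 0 ≤ E.bilin u u := E.nonneg u
    have h2 : 0 ≤ inner ℝ (E.incl u) (E.incl u) := real_inner_self_nonneg
    simpa using add_nonneg h h2
  add_left u v w := by
    simp [inner_add_left]; ring
  smul_left u v r := by
    simp [real_inner_smul_left]; ring
  definite u h := by
    have h1 : 0 ≤ E.bilin u u := E.nonneg u
    have h2 : 0 ≤ inner ℝ (E.incl u) (E.incl u) := real_inner_self_nonneg
    have h3 : inner ℝ (E.incl u) (E.incl u) = 0 := by linarith
    exact Subtype.ext (inner_self_eq_zero.mp h3)

instance : NormedAddCommGroup E.Dom :=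
  @InnerProductSpace.Core.toNormedAddCommGroup ℝ E.Dom _ _ _ E.core

instance : InnerProductSpace ℝ E.Dom := InnerProductSpace.ofCore E.core.toCore

theorem inner_def (u v : E.Dom) :
    inner ℝ u v = E.bilin u v + inner ℝ (E.incl u) (E.incl v) := rfl

theorem norm_incl_le (u : E.Dom) : ‖E.incl u‖ ≤ ‖u‖ := by
  have h1 : 0 ≤ E.bilin u u := E.nonneg u
  have h2 := E.inner_def u u
  rw [real_inner_self_eq_norm_sq, real_inner_self_eq_norm_sq] at h2
  exact le_of_sq_le_sq (by linarith) (norm_nonneg u)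

/-- The continuous embedding of `F` into `H = L²(X, m)`. -/
def toL2 : E.Dom →L[ℝ] Lp ℝ 2 m :=
  E.incl.mkContinuous 1 (fun u => by simpa using E.norm_incl_le u)

/-- The embedding of `H` into the dual `F*`, `h ↦ (v ↦ ∫ h v dm)`. -/
def toDual : Lp ℝ 2 m →L[ℝ] StrongDual ℝ E.Dom :=
  (ContinuousLinearMap.compL ℝ E.Dom (Lp ℝ 2 m) ℝ).flip E.toL2 ∘L innerSL ℝ

theorem toDual_apply (h : Lp ℝ 2 m) (v : E.Dom) : E.toDual h v = inner ℝ h (E.toL2 v) := rfl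

/-- Membership in `F ∩ L^∞`. -/
def IsBdd (u : E.Dom) : Prop := ∃ c : ℝ, ∀ᵐ x ∂m, |E.toL2 u x| ≤ c

/-- `Γ` is the square field operator (carré du champ) of the form, normalised so that
`E(u, v) = ∫ Γ(u, v) dm`. -/
structure IsSquareField (Γ : E.Dom →ₗ[ℝ] E.Dom →ₗ[ℝ] Lp ℝ 1 m) : Prop where
  symm : ∀ u v, Γ u v = Γ v u
  nonneg : ∀ u, ∀ᵐ x ∂m, 0 ≤ Γ u u x
  form_eq : ∀ u v, E.bilin u v = ∫ x, Γ u v x ∂m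
  leibniz : ∀ u v h uh vh uv : E.Dom, E.IsBdd u → E.IsBdd v → E.IsBdd h →
    (∀ᵐ x ∂m, E.toL2 uh x = E.toL2 u x * E.toL2 h x) →
    (∀ᵐ x ∂m, E.toL2 vh x = E.toL2 v x * E.toL2 h x) →
    (∀ᵐ x ∂m, E.toL2 uv x = E.toL2 u x * E.toL2 v x) →
    E.bilin uh v + E.bilin vh u - E.bilin uv h = 2 * ∫ x, E.toL2 h x * Γ u v x ∂m

/-- The diffusion property
`Γ(Ψ(u₁,…,u_k), v) = ∑ i, Ψ_i(u₁,…,u_k) Γ(u_i, v)` for `u_i, v ∈ F ∩ L^∞` and `Ψ ∈ C¹(ℝᵏ)` with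
`Ψ(0) = 0`; here `z` is the element `Ψ(u₁,…,u_k)` of `F`. -/
def IsDiffusion (Γ : E.Dom →ₗ[ℝ] E.Dom →ₗ[ℝ] Lp ℝ 1 m) : Prop :=
  ∀ (k : ℕ) (Ψ : (Fin k → ℝ) → ℝ), ContDiff ℝ 1 Ψ → Ψ 0 = 0 →
    ∀ (u : Fin k → E.Dom) (v z : E.Dom), (∀ i, E.IsBdd (u i)) → E.IsBdd v →
      (∀ᵐ x ∂m, E.toL2 z x = Ψ (fun j => E.toL2 (u j) x)) →
      ∀ᵐ x ∂m, Γ z v x =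
        ∑ i, fderiv ℝ Ψ (fun j => E.toL2 (u j) x) (Pi.single i 1) * Γ (u i) v x

end DirichletForm

/-- `du` is the weak derivative of `u` on the interval `(s, τ)`. -/
def HasWeakDerivOn {V : Type*} [NormedAddCommGroup V] [NormedSpace ℝ V] (s τ : ℝ)
    (u du : ℝ → V) : Prop :=
  ∀ φ : ℝ → ℝ, ContDiff ℝ ∞ φ → HasCompactSupport φ → tsupport φ ⊆ Ioo s τ →
    ∫ t in Ioo s τ, deriv φ t • u t = -∫ t in Ioo s τ, φ t • du t

/-- `u` belongs to `F_{(s,τ)} = L²((s,τ) → F) ∩ H¹((s,τ) → F*)`. Here `u` is the representative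
which is continuous from `[s, τ]` to `H`, `U` is `u` regarded as an `F`-valued function
(defined for a.e. `t`), and `dU` is its weak time derivative in `F*`. -/
structure MemParabolic {X : Type*} [MeasurableSpace X] {m : Measure X} (E : DirichletForm m)
    (s τ : ℝ) (u : ℝ → Lp ℝ 2 m) (U : ℝ → E.Dom) (dU : ℝ → StrongDual ℝ E.Dom) : Prop where
  continuousOn : ContinuousOn u (Icc s τ)
  ae_eq : ∀ᵐ t ∂volume.restrict (Ioo s τ), E.toL2 (U t) = u t
  memLp : MemLp U 2 (volume.restrict (Ioo s τ))
  memLp_deriv : MemLp dU 2 (volume.restrict (Ioo s τ))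
  weakDeriv : HasWeakDerivOn s τ (fun t => E.toDual (u t)) dU

/-- A uniformly elliptic family of square field operators `Γ_t` on `F` and of measures
`m_t = e^{-f_t} m`, with parameter `t ∈ (0, T)`, over a reference Dirichlet form with square field
operator `Γ₀`. Values of the fields at times outside `(0, T)` carry no meaning. -/
structure TimeDependentForm {X : Type*} [MeasurableSpace X] {m : Measure X}
    (E : DirichletForm m) (Γ₀ : E.Dom →ₗ[ℝ] E.Dom →ₗ[ℝ] Lp ℝ 1 m) (T : ℝ) where
  f : ℝ → X → ℝ
  Γ : ℝ → E.Dom →ₗ[ℝ] E.Dom →ₗ[ℝ] Lp ℝ 1 m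
  f_measurable : Measurable (fun p : Ioo (0 : ℝ) T × X => f p.1 p.2)
  f_bounded : ∃ c : ℝ, ∀ t ∈ Ioo 0 T, ∀ x, |f t x| ≤ c
  f_mem : ∃ c : ℝ, ∀ t ∈ Ioo 0 T, ∃ φ : E.Dom,
    (∀ᵐ x ∂m, E.toL2 φ x = f t x) ∧ ∀ᵐ x ∂m, Γ₀ φ φ x ≤ c
  Γ_symm : ∀ t ∈ Ioo 0 T, ∀ u v, Γ t u v = Γ t v u
  Γ_nonneg : ∀ t ∈ Ioo 0 T, ∀ u, ∀ᵐ x ∂m, 0 ≤ Γ t u u x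
  Γ_diffusion : ∀ t ∈ Ioo 0 T, E.IsDiffusion (Γ t)
  Γ_elliptic : ∃ c : ℝ, 0 < c ∧ ∀ t ∈ Ioo 0 T, ∀ u, ∀ᵐ x ∂m,
    1 / c * Γ₀ u u x ≤ Γ t u u x ∧ Γ t u u x ≤ c * Γ₀ u u x

namespace TimeDependentForm

variable {X : Type*} [MeasurableSpace X] {m : Measure X} {E : DirichletForm m}
  {Γ₀ : E.Dom →ₗ[ℝ] E.Dom →ₗ[ℝ] Lp ℝ 1 m} {T : ℝ} (D : TimeDependentForm E Γ₀ T)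

/-- The measure `m_t = e^{-f_t} m`. -/
def meas (t : ℝ) : Measure X := m.withDensity (fun x => ENNReal.ofReal (Real.exp (-D.f t x)))

/-- The form `E_t(u, v) = ∫ Γ_t(u, v) dm_t` with domain `F`. -/
def form (t : ℝ) (u v : E.Dom) : ℝ := ∫ x, D.Γ t u v x ∂D.meas t

/-- `u ∈ F` and `g ∈ L²(m_t)` satisfy `E_t(u, v) = -∫ g v dm_t` for all `v ∈ F`, that is,
`u ∈ Dom(A_t)` and `A_t u = g`. As `f_t` is bounded, `L²(m_t)` is `L²(m)` as a set. -/
def IsGenerator (t : ℝ) (u g : Lp ℝ 2 m) : Prop :=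
  ∃ u' : E.Dom, E.toL2 u' = u ∧ ∀ v : E.Dom, D.form t u' v = -∫ x, g x * E.toL2 v x ∂D.meas t

/-- The domain of the generator `A_t`. -/
def domA (t : ℝ) : Set (Lp ℝ 2 m) := {u | ∃ g, D.IsGenerator t u g}

open Classical in
/-- The generator `A_t` on its domain `domA t` (and `0` off the domain). -/
def A (t : ℝ) (u : Lp ℝ 2 m) : Lp ℝ 2 m :=
  if h : ∃ g, D.IsGenerator t u g then h.choose else 0

theorem isGenerator_A {t : ℝ} {u : Lp ℝ 2 m} (h : u ∈ D.domA t) : D.IsGenerator t u (D.A t u) := by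
  have h' : ∃ g, D.IsGenerator t u g := h
  rw [A, dif_pos h']
  exact h'.choose_spec

open Classical in
/-- The product `w e^{-f_t}` as an element of `F` (for `w ∈ F` it belongs to `F`, as `f_t` and
`Γ₀(f_t)` are bounded). -/
def mulDensity (t : ℝ) (w : E.Dom) : E.Dom :=
  if h : ∃ z : E.Dom, ∀ᵐ x ∂m, E.toL2 z x = E.toL2 w x * Real.exp (-D.f t x) then h.choose else 0

/-- `u` is a solution of the heat equation `A_t u = ∂_t u` on `(s, τ) × X`. -/
def IsHeatSolution (s τ : ℝ) (u : ℝ → Lp ℝ 2 m) : Prop :=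
  ∃ U dU, MemParabolic E s τ u U dU ∧
    ∀ w W dW, MemParabolic E s τ w W dW →
      -∫ t in Ioo s τ, D.form t (U t) (W t) = ∫ t in Ioo s τ, dU t (D.mulDensity t (W t))

/-- `v` is a solution of the adjoint heat equation `-A_s v + ∂_s f · v = ∂_s v` on
`(σ, t) × X`; the pairing `∫ ∂_s v · w dm_s` is the dual pairing of `∂_s v ∈ F*` with
`w e^{-f_s} ∈ F`. -/
def IsAdjointHeatSolution (σ t : ℝ) (v : ℝ → Lp ℝ 2 m) : Prop :=
  ∃ V dV, MemParabolic E σ t v V dV ∧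
    ∀ w W dW, MemParabolic E σ t w W dW →
      (∫ s in Ioo σ t, D.form s (V s) (W s)) +
          (∫ s in Ioo σ t, ∫ x, v s x * w s x * deriv (fun r => D.f r x) s ∂D.meas s) =
        ∫ s in Ioo σ t, dV s (D.mulDensity s (W s))

/-- The log-Lipschitz conditions in time: `|f_t - f_s| ≤ L |t - s|` and
`|Γ_t(u) - Γ_s(u)| ≤ 2 L ∫_s^t Γ_r(u) dr`, the last integral being taken in `L¹(X, m)`. -/
structure IsLogLipschitz (L : ℝ) : Prop where
  density : ∀ s ∈ Ioo 0 T, ∀ t ∈ Ioo 0 T, ∀ x, |D.f t x - D.f s x| ≤ L * |t - s|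
  squareField : ∀ s ∈ Ioo 0 T, ∀ t ∈ Ioo 0 T, s < t → ∀ u : E.Dom, ∀ᵐ x ∂m,
    |D.Γ t u u x - D.Γ s u u x| ≤ 2 * L * (∫ r in s..t, D.Γ r u u : Lp ℝ 1 m) x

end TimeDependentForm

end HeatFlow

end

/-! Formally, d/dt E_t(u_t) = (∂_t E_t)(u_t) - 2∫|A_t u_t|² dm_t along the heat flow. The
log-Lipschitz conditions give E_t ≤ e^{3L|t-s|} E_s on F, with 2L coming from Γ and L from the
density (`IsLogLipschitz.form_le`). Hence e^{-3Lt} E_t is nonincreasing in t on each fixed function,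
and the energy estimate follows by integration. The difficulty is that the forms are not assumed
differentiable in time, and ∂_t u is a priori only in F*.

Monotonicity replaces differentiability of the forms: if β ≥ 0 is symmetric and β(y,y) ≤ γ(y,y),
then β(x,x) - γ(y,y) ≤ 2β(x,x-y) (`sub_le_two_mul_of_anti`). Such bounds on increments are averaged
over a small delay k, divided by k, and passed to the limit by continuity of translations in L²
(`exists_le_add_integral`). This is a one-sided chain rule for quantities known only at almost every
time.

Regularity comes from an exponential time average. If u_a lies in F, solve y + h y' = U with y_a =
u_a. Then z = y' is F-valued and may be tested against the equation. The one-sided chain rules for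
E_t(y) and for the weighted norm of z bound z in L²(H) uniformly in h (`exists_bounded_filter`). A
weak limit of z as h → 0 is the derivative of u (`exists_deriv`), so ∂_t u is in L²(H) and the
equation itself says that u_t ∈ Dom(A_t). Since u_t ∈ F for almost every t, the argument can be
started arbitrarily close to the initial time, which gives the domain statement without assumption
on u_s.

For the energy estimate, E_t(u_t, w) = -∫ A_t u_t w dm_t expresses increments of the energy through
increments of u in H (`exists_energy_le`). The value at the right end point is reached along a
sequence of good times, by weak compactness in F and lower semicontinuity.

The adjoint equation becomes, under t ↦ -t, a forward equation with source ∂_t f · v, bounded in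
L²(H). The quantity E + ‖·‖² is treated with the rate K: the entry 3L makes the forms monotone, and
L + L²/2 is what completing the square requires to absorb the source and the derivative of the
weight (`quadratic_nonneg`). -/

set_option linter.unusedSectionVars false

noncomputable section

namespace HeatFlow

/-! ### Weak compactness and lower semicontinuity in Hilbert spaces. -/

section WeakLimit

variable {K : Type*} [NormedAddCommGroup K] [InnerProductSpace ℝ K] [CompleteSpace K]

/-- Weak compactness of balls in a Hilbert space, along a fixed ultrafilter on `ℕ`. -/
theorem exists_weak_limit {g : ℕ → K} {C : ℝ} (hg : ∀ n, ‖g n‖ ≤ C) :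
    ∃ x : K, ‖x‖ ≤ C ∧
      ∀ ψ, Tendsto (fun n => inner ℝ (g n) ψ) (hyperfilter ℕ : Filter ℕ) (𝓝 (inner ℝ x ψ)) := by
  have hC : 0 ≤ C := (norm_nonneg _).trans (hg 0)
  have hb : ∀ ψ n, |inner ℝ (g n) ψ| ≤ C * ‖ψ‖ := fun ψ n =>
    (abs_real_inner_le_norm _ _).trans (mul_le_mul_of_nonneg_right (hg n) (norm_nonneg _))
  have hex : ∀ ψ, ∃ c, |c| ≤ C * ‖ψ‖ ∧
      Tendsto (fun n => inner ℝ (g n) ψ) (hyperfilter ℕ : Filter ℕ) (𝓝 c) := fun ψ => by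
    -- An ultrafilter on a compact interval converges, so the limits exist for all ψ at once without
    -- extracting subsequences. Uniqueness of limits then makes `l` linear.
    have hK : IsCompact (Icc (-(C * ‖ψ‖)) (C * ‖ψ‖)) := isCompact_Icc
    obtain ⟨c, hc, hlim⟩ := hK.ultrafilter_le_nhds
      ((hyperfilter ℕ).map fun n => inner ℝ (g n) ψ)
      (by
        rw [le_principal_iff, Ultrafilter.coe_map, Filter.mem_map]
        exact Filter.mem_of_superset Filter.univ_mem fun n _ => abs_le.1 (hb ψ n))
    exact ⟨c, abs_le.2 hc, hlim⟩
  choose l hlC hl using hex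
  let ℓ : K →ₗ[ℝ] ℝ :=
    { toFun := l
      map_add' := fun x y => tendsto_nhds_unique (hl (x + y)) (by
        simpa only [inner_add_right] using (hl x).add (hl y))
      map_smul' := fun c x => tendsto_nhds_unique (hl (c • x)) (by
        simpa only [real_inner_smul_right, RingHom.id_apply, smul_eq_mul] using
          (hl x).const_mul c) }
  let ℓ' : StrongDual ℝ K := ℓ.mkContinuous C hlC
  refine ⟨(InnerProductSpace.toDual ℝ K).symm ℓ', ?_, fun ψ => ?_⟩
  · rw [LinearIsometryEquiv.norm_map]
    exact ℓ.mkContinuous_norm_le hC _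
  · rw [InnerProductSpace.toDual_symm_apply]
    exact hl ψ

variable {H : Type*} [NormedAddCommGroup H] [InnerProductSpace ℝ H] [CompleteSpace H]

/-- A bounded sequence whose image under a continuous linear map converges has a weak limit
mapped to the limit of the images. -/
theorem exists_weak_limit_map (j : K →L[ℝ] H) {g : ℕ → K} {C : ℝ} (hg : ∀ n, ‖g n‖ ≤ C) {h : H}
    (hj : Tendsto (fun n => j (g n)) atTop (𝓝 h)) :
    ∃ x : K, j x = h ∧ ‖x‖ ≤ C ∧
      ∀ ψ, Tendsto (fun n => inner ℝ (g n) ψ) (hyperfilter ℕ : Filter ℕ) (𝓝 (inner ℝ x ψ)) := by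
  obtain ⟨x, hx, hlim⟩ := exists_weak_limit hg
  refine ⟨x, ext_inner_right ℝ fun ψ => ?_, hx, hlim⟩
  have h1 : Tendsto (fun n => inner ℝ (j (g n)) ψ) (hyperfilter ℕ : Filter ℕ)
      (𝓝 (inner ℝ (j x) ψ)) := by
    have := hlim (j.adjoint ψ)
    simpa only [ContinuousLinearMap.adjoint_inner_right] using this
  have h2 : Tendsto (fun n => inner ℝ (j (g n)) ψ) (hyperfilter ℕ : Filter ℕ)
      (𝓝 (inner ℝ h ψ)) :=
    (hj.mono_left Nat.hyperfilter_le_atTop).inner tendsto_const_nhds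
  exact tendsto_nhds_unique h1 h2

/-- Lower semicontinuity of a nonnegative form along bounded sequences converging in a
larger space. -/
theorem exists_form_le_of_tendsto (j : K →L[ℝ] H) (α : K →L[ℝ] K →L[ℝ] ℝ)
    (hsymm : ∀ u v, α u v = α v u) (hnn : ∀ u, 0 ≤ α u u) {g : ℕ → K} {C : ℝ}
    (hg : ∀ n, ‖g n‖ ≤ C) {h : H} (hj : Tendsto (fun n => j (g n)) atTop (𝓝 h)) {e : ℕ → ℝ}
    {c : ℝ} (he : Tendsto e atTop (𝓝 c)) (hle : ∀ n, α (g n) (g n) ≤ e n) :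
    ∃ x : K, j x = h ∧ α x x ≤ c := by
  obtain ⟨x, hx, -, hlim⟩ := exists_weak_limit_map j hg hj
  refine ⟨x, hx, ?_⟩
  have h1 : Tendsto (fun n => α x (g n)) (hyperfilter ℕ : Filter ℕ) (𝓝 (α x x)) := by
    have := hlim ((InnerProductSpace.toDual ℝ K).symm (α x))
    simp only [real_inner_comm ((InnerProductSpace.toDual ℝ K).symm (α x)),
      InnerProductSpace.toDual_symm_apply] at this
    exact this
  -- Nonnegativity of α at g n - x bounds α(g n, g n) below by an affine function of g n, and that
  -- function passes to the weak limit.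
  have h2 : Tendsto (fun n => 2 * α x (g n) - α x x) (hyperfilter ℕ : Filter ℕ)
      (𝓝 (2 * α x x - α x x)) := (h1.const_mul 2).sub_const _
  have h3 := le_of_tendsto_of_tendsto h2 (he.mono_left Nat.hyperfilter_le_atTop)
    (Eventually.of_forall fun n => (show 2 * α x (g n) - α x x ≤ e n by
      have h4 := hnn (g n - x)
      simp only [map_sub, _root_.sub_apply] at h4
      have := hle n
      rw [hsymm (g n) x] at h4
      linarith))
  linarith

end WeakLimit

/-! ### Weak derivatives and primitives of vector-valued functions. -/

section Primitive

variable {V : Type*} [NormedAddCommGroup V] [NormedSpace ℝ V] [CompleteSpace V]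

/-- Continuous functionals separate points, which reduces the identity to integration by parts for
absolutely continuous scalar functions. -/
theorem integral_deriv_smul_primitive {a b : ℝ} {d : ℝ → V}
    (hd : IntervalIntegrable d volume a b) {φ : ℝ → ℝ} (hφ : ContDiff ℝ 1 φ) (ha : φ a = 0)
    (hb : φ b = 0) :
    ∫ t in a..b, deriv φ t • (∫ r in a..t, d r) = -∫ t in a..b, φ t • d t := by
  have hφ' : Continuous (deriv φ) := hφ.continuous_deriv le_rfl
  have hprim : ContinuousOn (fun t => ∫ r in a..t, d r) (uIcc a b) :=
    intervalIntegral.continuousOn_primitive_interval' hd left_mem_uIcc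
  have hi1 : IntervalIntegrable (fun t => deriv φ t • (∫ r in a..t, d r)) volume a b :=
    (hφ'.continuousOn.smul hprim).intervalIntegrable
  have hi2 : IntervalIntegrable (fun t => φ t • d t) volume a b :=
    hd.continuousOn_smul hφ.continuous.continuousOn
  refine (SeparatingDual.eq_iff_forall_dual_eq (R := ℝ)).2 fun ℓ => ?_
  rw [map_neg, ← ℓ.intervalIntegral_comp_comm hi1, ← ℓ.intervalIntegral_comp_comm hi2]
  have hdl : IntervalIntegrable (fun t => ℓ (d t)) volume a b :=
    ⟨ℓ.integrable_comp hd.1, ℓ.integrable_comp hd.2⟩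
  have hac : AbsolutelyContinuousOnInterval (fun t => ∫ r in a..t, ℓ (d r)) a b :=
    hdl.absolutelyContinuousOnInterval_intervalIntegral left_mem_uIcc
  have hφac : AbsolutelyContinuousOnInterval φ a b := by
    have h1 : φ = fun x => ∫ t in a..x, deriv φ t := by
      funext x
      rw [intervalIntegral.integral_deriv_eq_sub
        (fun y _ => (hφ.differentiable one_ne_zero).differentiableAt)
        (hφ'.intervalIntegrable _ _), ha, sub_zero]
    rw [h1]
    exact (hφ'.intervalIntegrable a b).absolutelyContinuousOnInterval_intervalIntegral
      left_mem_uIcc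
  have key := hφac.integral_mul_deriv_eq_deriv_mul hac
  rw [ha, hb, zero_mul, zero_mul, sub_zero, zero_sub] at key
  have e1 : ∫ t in a..b, φ t * deriv (fun t => ∫ r in a..t, ℓ (d r)) t =
      ∫ t in a..b, ℓ (φ t • d t) := by
    refine intervalIntegral.integral_congr_ae ?_
    filter_upwards [hdl.ae_hasDerivAt_integral] with t ht hmem
    rw [(ht (uIoc_subset_uIcc hmem) a left_mem_uIcc).deriv, map_smul, smul_eq_mul]
  have e2 : ∫ t in a..b, deriv φ t * ∫ r in a..t, ℓ (d r) =
      ∫ t in a..b, ℓ (deriv φ t • ∫ r in a..t, d r) := by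
    refine intervalIntegral.integral_congr fun t ht => ?_
    have : IntervalIntegrable d volume a t := hd.mono_set (uIcc_subset_uIcc_left ht)
    simp only [map_smul, smul_eq_mul, ← ℓ.intervalIntegral_comp_comm this]
  rw [← e2, ← e1, key, neg_neg]

/-- A function with compact support in an interval and zero mean has a primitive with compact
support in the interval. -/
theorem exists_primitive_test {a b : ℝ} {θ : ℝ → ℝ} (hθ : ContDiff ℝ ∞ θ)
    (hc : HasCompactSupport θ) (hs : tsupport θ ⊆ Ioo a b) (h0 : ∫ t, θ t = 0) :
    ∃ φ : ℝ → ℝ, ContDiff ℝ ∞ φ ∧ HasCompactSupport φ ∧ tsupport φ ⊆ Ioo a b ∧ deriv φ = θ := by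
  rcases (tsupport θ).eq_empty_or_nonempty with he | hne
  · refine ⟨0, contDiff_const, HasCompactSupport.zero, by simp [tsupport], ?_⟩
    rw [tsupport_eq_empty_iff] at he
    rw [he]
    funext x
    exact deriv_const x (0 : ℝ)
  have hK : IsCompact (tsupport θ) := hc
  obtain ⟨a', ha', hmin⟩ := hK.exists_isLeast hne
  obtain ⟨b', hb', hmax⟩ := hK.exists_isGreatest hne
  have hz : ∀ t, t < a' ∨ b' < t → θ t = 0 := fun t ht => by
    by_contra h
    have := subset_tsupport θ (Function.mem_support.2 h)
    rcases ht with ht | ht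
    · exact absurd (hmin this) (not_le.2 ht)
    · exact absurd (hmax this) (not_le.2 ht)
  have hint : Integrable θ := hθ.continuous.integrable_of_hasCompactSupport hc
  have hder : ∀ t, HasDerivAt (fun x => ∫ r in a..x, θ r) (θ t) t := fun t =>
    (hθ.continuous.integral_hasStrictDerivAt a t).hasDerivAt
  have hderiv : deriv (fun x => ∫ r in a..x, θ r) = θ := funext fun t => (hder t).deriv
  -- Before the support of θ the primitive is zero; beyond it, it equals the total integral, which
  -- vanishes.
  have hsub : tsupport (fun x => ∫ r in a..x, θ r) ⊆ Icc a' b' := by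
    refine closure_minimal (fun t ht => ?_) isClosed_Icc
    by_contra hmem
    refine ht ?_
    have haa : a < a' := (hs ha').1
    rw [mem_Icc, not_and_or, not_le, not_le] at hmem
    rcases hmem with h | h
    · refine (intervalIntegral.integral_congr fun r hr => ?_).trans intervalIntegral.integral_zero
      refine hz r (Or.inl (lt_of_le_of_lt hr.2 (max_lt haa h)))
    · have h1 := intervalIntegral.integral_eq_integral_of_support_subset (f := θ) (a := a) (b := t)
        (μ := volume) (fun x hx => ?_)
      · show ∫ r in a..t, θ r = 0
        rw [h1, h0]
      · have := subset_tsupport θ hx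
        exact ⟨(hs this).1, (hmax this).trans h.le⟩
  refine ⟨fun x => ∫ r in a..x, θ r, ?_, ?_, ?_, hderiv⟩
  · rw [contDiff_infty_iff_deriv, hderiv]
    exact ⟨fun t => (hder t).differentiableAt, hθ⟩
  · exact isCompact_Icc.of_isClosed_subset (isClosed_tsupport _) hsub
  · exact hsub.trans (Icc_subset_Ioo (hs ha').1 (hs hb').2)

theorem exists_test_integral_eq_one {a b : ℝ} (hab : a < b) :
    ∃ ψ : ℝ → ℝ, ContDiff ℝ ∞ ψ ∧ HasCompactSupport ψ ∧ tsupport ψ ⊆ Ioo a b ∧ ∫ t, ψ t = 1 := by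
  let f : ContDiffBump ((a + b) / 2) :=
    { rIn := (b - a) / 8, rOut := (b - a) / 4, rIn_pos := by linarith, rIn_lt_rOut := by linarith }
  refine ⟨f.normed volume, f.contDiff_normed, f.hasCompactSupport_normed, ?_, f.integral_normed⟩
  rw [f.tsupport_normed_eq]
  intro x hx
  rw [Metric.mem_closedBall, Real.dist_eq, abs_le] at hx
  have : f.rOut = (b - a) / 4 := rfl
  constructor <;> linarith [hx.1, hx.2]

/-- A continuous function with an integrable weak derivative is the primitive of it. -/
theorem HasWeakDerivOn.sub_eq_integral {a b : ℝ} (hab : a < b) {u du : ℝ → V}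
    (hu : ContinuousOn u (Icc a b)) (hdu : IntegrableOn du (Ioo a b))
    (h : HasWeakDerivOn a b u du) {t : ℝ} (ht : t ∈ Icc a b) :
    u t - u a = ∫ r in a..t, du r := by
  have hii : IntervalIntegrable du volume a b :=
    (intervalIntegrable_iff_integrableOn_Ioo_of_le hab.le).2 hdu
  have hprim : ContinuousOn (fun t => ∫ r in a..t, du r) (Icc a b) := by
    rw [← uIcc_of_le hab.le]
    exact intervalIntegral.continuousOn_primitive_interval' hii left_mem_uIcc
  set g : ℝ → V := fun t => u t - ∫ r in a..t, du r with hg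
  have hgc : ContinuousOn g (Icc a b) := hu.sub hprim
  have hsm : ∀ {φ : ℝ → ℝ} {f : ℝ → V}, Continuous φ → ContinuousOn f (Icc a b) →
      IntegrableOn (fun t => φ t • f t) (Ioo a b) := fun hφ hf =>
    ((hφ.continuousOn.smul hf).integrableOn_Icc).mono_set Ioo_subset_Icc_self
  have h0 : ∀ φ : ℝ → ℝ, ContDiff ℝ ∞ φ → HasCompactSupport φ → tsupport φ ⊆ Ioo a b →
      ∫ t in Ioo a b, deriv φ t • g t = 0 := fun φ hφ hc hs => by
    have hφ' : Continuous (deriv φ) := hφ.continuous_deriv (by simp)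
    have ha : φ a = 0 := by
      by_contra hne
      exact lt_irrefl _ (hs (subset_tsupport φ hne)).1
    have hb : φ b = 0 := by
      by_contra hne
      exact lt_irrefl _ (hs (subset_tsupport φ hne)).2
    have h1 := integral_deriv_smul_primitive hii (hφ.of_le (by simp)) ha hb
    rw [intervalIntegral.integral_of_le hab.le, intervalIntegral.integral_of_le hab.le,
      integral_Ioc_eq_integral_Ioo, integral_Ioc_eq_integral_Ioo] at h1
    simp only [hg, smul_sub]
    rw [integral_sub (hsm hφ' hu) (hsm hφ' hprim), h1, h φ hφ hc hs, sub_self]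
  -- The du Bois-Reymond argument: ψ - (∫ψ)ψ₀ has mean zero, hence is the derivative of a test
  -- function, on which `h0` applies. So g is almost everywhere its mean c against ψ₀.
  obtain ⟨ψ₀, hψ₀, hψ₀c, hψ₀s, hψ₀1⟩ := exists_test_integral_eq_one hab
  set c : V := ∫ t in Ioo a b, ψ₀ t • g t with hcdef
  have hae : ∀ᵐ t, t ∈ Ioo a b → g t - c = 0 := by
    refine isOpen_Ioo.ae_eq_zero_of_integral_contDiff_smul_eq_zero ?_ fun ψ hψ hψc hψs => ?_
    · exact ((hgc.sub continuousOn_const).integrableOn_Icc.mono_set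
        Ioo_subset_Icc_self).locallyIntegrableOn
    · have hiψ : Integrable ψ := hψ.continuous.integrable_of_hasCompactSupport hψc
      have hiψ₀ : Integrable ψ₀ := hψ₀.continuous.integrable_of_hasCompactSupport hψ₀c
      set θ : ℝ → ℝ := fun t => ψ t - (∫ r, ψ r) * ψ₀ t with hθ
      have hθ1 : ContDiff ℝ ∞ θ := hψ.sub (contDiff_const.mul hψ₀)
      have hc2 : HasCompactSupport (fun t => (∫ r, ψ r) * ψ₀ t) :=
        HasCompactSupport.mul_left (f := fun _ : ℝ => ∫ r, ψ r) hψ₀c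
      have hθ2 : HasCompactSupport θ := hψc.sub hc2
      have hθ3 : tsupport θ ⊆ Ioo a b := by
        refine (tsupport_sub ψ fun t => (∫ r, ψ r) * ψ₀ t).trans (union_subset hψs ?_)
        exact (tsupport_mul_subset_right (f := fun _ : ℝ => ∫ r, ψ r)).trans hψ₀s
      have hθ4 : ∫ t, θ t = 0 := by
        rw [hθ, integral_sub hiψ (hiψ₀.const_mul _), integral_const_mul, hψ₀1, mul_one, sub_self]
      obtain ⟨φ, hφ1, hφ2, hφ3, hφ4⟩ := exists_primitive_test hθ1 hθ2 hθ3 hθ4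
      have h1 := h0 φ hφ1 hφ2 hφ3
      rw [hφ4] at h1
      have h2 : ∫ t in Ioo a b, θ t • g t =
          (∫ t in Ioo a b, ψ t • g t) - (∫ r, ψ r) • c := by
        rw [hcdef, ← integral_smul, ← integral_sub (hsm hψ.continuous hgc)
          (g := fun t => (∫ r, ψ r) • ψ₀ t • g t)
          (Integrable.smul (∫ r, ψ r) (hsm hψ₀.continuous hgc))]
        refine integral_congr_ae (Eventually.of_forall fun t => ?_)
        simp only [hθ, sub_smul, mul_smul]
      have h3 : ∫ t, ψ t • (g t - c) = ∫ t in Ioo a b, ψ t • (g t - c) := by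
        refine (setIntegral_eq_integral_of_forall_compl_eq_zero fun t ht => ?_).symm
        have : ψ t = 0 := by
          by_contra hne
          exact ht (hψs (subset_tsupport ψ hne))
        rw [this, zero_smul]
      have h4 : ∫ t in Ioo a b, ψ t = ∫ t, ψ t := by
        refine setIntegral_eq_integral_of_forall_compl_eq_zero fun t ht => ?_
        by_contra hne
        exact ht (hψs (subset_tsupport ψ hne))
      rw [h3]
      simp only [smul_sub]
      rw [integral_sub (hsm hψ.continuous hgc) (hiψ.integrableOn.smul_const c),
        integral_smul_const, h4, ← h2, h1]
  have hev : EqOn g (fun _ => c) (Icc a b) := by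
    have h5 : g =ᵐ[volume.restrict (Ioo a b)] fun _ => c := by
      rw [EventuallyEq, ae_restrict_iff' measurableSet_Ioo]
      filter_upwards [hae] with t ht hmem
      exact sub_eq_zero.1 (ht hmem)
    have h6 := Measure.eqOn_Ioo_of_ae_eq (μ := volume) h5 (hgc.mono Ioo_subset_Icc_self)
      continuousOn_const
    refine h6.of_subset_closure hgc continuousOn_const Ioo_subset_Icc_self ?_
    rw [closure_Ioo hab.ne]
  have h7 := hev ht
  have h8 := hev (left_mem_Icc.2 hab.le)
  simp only [hg, intervalIntegral.integral_same, sub_zero] at h7 h8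
  rw [h8, ← h7]
  abel

end Primitive

/-! ### One-sided chain rule by averaging increments over a delay. -/

section DiscreteChain

variable {V W : Type*} [NormedAddCommGroup V] [NormedSpace ℝ V]
  [NormedAddCommGroup W] [NormedSpace ℝ W]

/-- Translations act continuously on `L²`, tested against an `L²` function. -/
theorem continuous_integral_translate (B : V →L[ℝ] W →L[ℝ] ℝ) {d : ℝ → V} {l : ℝ → W}
    (hd : MemLp d 2 volume) (hl : MemLp l 2 volume) :
    Continuous fun σ : ℝ => ∫ t, B (d (t - σ)) (l t) := by
  let g : ℝ → C(ℝ, ℝ) := fun σ => ⟨fun t => t - σ, by fun_prop⟩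
  have hg : Continuous g :=
    ContinuousMap.continuous_of_continuous_uncurry _
      (show Continuous fun p : ℝ × ℝ => p.2 - p.1 by fun_prop)
  have hgm : ∀ σ, MeasurePreserving (g σ) volume volume := fun σ =>
    measurePreserving_sub_right volume σ
  have hc : Continuous fun σ => Lp.compMeasurePreserving (g σ) (hgm σ) (hd.toLp d) :=
    Continuous.compMeasurePreservingLp continuous_const hg hgm (by simp)
  have hc2 : Continuous fun σ => B.lpPairing volume 2 2
      (Lp.compMeasurePreserving (g σ) (hgm σ) (hd.toLp d)) (hl.toLp l) :=
    (ContinuousLinearMap.apply ℝ ℝ (hl.toLp l)).continuous.comp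
      ((B.lpPairing volume 2 2).continuous.comp hc)
  refine hc2.congr fun σ => ?_
  rw [ContinuousLinearMap.lpPairing_eq_integral]
  refine integral_congr_ae ?_
  filter_upwards [Lp.coeFn_compMeasurePreserving (hd.toLp d) (hgm σ), hl.coeFn_toLp,
    (hgm σ).quasiMeasurePreserving.ae_eq_comp hd.coeFn_toLp] with t h1 h2 h3
  rw [h1, h2, h3]
  rfl

theorem integrable_translate (B : V →L[ℝ] W →L[ℝ] ℝ) {d : ℝ → V} {l : ℝ → W}
    (hd : Integrable d) (hl : Integrable l) :
    Integrable (fun p : ℝ × ℝ => B (d (p.2 - p.1)) (l p.2)) (volume.prod volume) := by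
  have h := hl.convolution_integrand B.flip hd.comp_neg
  simpa using h

theorem tendsto_inv_mul_integral {G : ℝ → ℝ} (hG : Continuous G) :
    Tendsto (fun k => k⁻¹ * ∫ σ in (0 : ℝ)..k, G σ) (𝓝[>] 0) (𝓝 (G 0)) := by
  have h := (hG.integral_hasStrictDerivAt 0 0).hasDerivAt.tendsto_slope_zero_right
  simpa using h

/-- The delayed time is frozen at a as long as t - k < a. After a shift the two integrals cancel in
the interior, and only the layer of width k at each end survives. -/
theorem integral_sub_delay {q : ℝ → ℝ} {a b k : ℝ} (hk : 0 < k) (hkb : k < b - a)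
    (hq : IntegrableOn q (Ioo a b)) :
    IntegrableOn (fun t => q (max a (t - k))) (Ioo a b) ∧
    ∫ t in Ioo a b, (q t - q (max a (t - k))) = (∫ t in Ioo (b - k) b, q t) - k * q a := by
  have hab : a ≤ b := by linarith
  have hii : IntervalIntegrable q volume a b :=
    (intervalIntegrable_iff_integrableOn_Ioo_of_le hab).2 hq
  have e1 : EqOn (fun t => q (max a t)) (fun _ => q a) (uIcc (a - k) a) := fun t ht => by
    rw [uIcc_of_le (by linarith)] at ht
    simp only [max_eq_left ht.2]
  have e2 : EqOn (fun t => q (max a t)) q (uIcc a (b - k)) := fun t ht => by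
    rw [uIcc_of_le (by linarith)] at ht
    simp only [max_eq_right ht.1]
  have hiq : IntervalIntegrable q volume a (b - k) :=
    hii.mono_set (by rw [uIcc_of_le hab, uIcc_of_le (by linarith)]
                     exact Icc_subset_Icc le_rfl (by linarith))
  have hiq' : IntervalIntegrable q volume (b - k) b :=
    hii.mono_set (by rw [uIcc_of_le hab, uIcc_of_le (by linarith)]
                     exact Icc_subset_Icc (by linarith) le_rfl)
  have i1 : IntervalIntegrable (fun t => q (max a t)) volume (a - k) a :=
    IntervalIntegrable.congr (f := fun _ => q a) (fun t ht => (e1 (uIoc_subset_uIcc ht)).symm)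
      intervalIntegrable_const
  have i2 : IntervalIntegrable (fun t => q (max a t)) volume a (b - k) :=
    hiq.congr fun t ht => (e2 (uIoc_subset_uIcc ht)).symm
  have i3 : IntervalIntegrable (fun t => q (max a (t - k))) volume a b := by
    have := (i1.trans i2).comp_sub_right k
    simpa using this
  refine ⟨(intervalIntegrable_iff_integrableOn_Ioo_of_le hab).1 i3, ?_⟩
  rw [← integral_Ioc_eq_integral_Ioo, ← intervalIntegral.integral_of_le hab,
    ← integral_Ioc_eq_integral_Ioo, ← intervalIntegral.integral_of_le (by linarith),
    intervalIntegral.integral_sub hii i3,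
    intervalIntegral.integral_comp_sub_right (fun t => q (max a t)) k,
    ← intervalIntegral.integral_add_adjacent_intervals i1 i2,
    intervalIntegral.integral_congr e1, intervalIntegral.integral_congr e2,
    ← intervalIntegral.integral_add_adjacent_intervals hiq hiq']
  simp only [intervalIntegral.integral_const, smul_eq_mul]
  ring

/-- A discrete form of the chain rule: increments of `q` bounded by increments of a primitive
of `d` tested against `l`, up to an error `C`, bound `q` near the right end point. -/
theorem exists_le_add_integral (B : V →L[ℝ] W →L[ℝ] ℝ) {a b : ℝ} (hab : a < b) {q : ℝ → ℝ}
    {S : Set ℝ} (hS : ∀ᵐ t ∂volume.restrict (Ioo a b), t ∈ S) (hq : IntegrableOn q (Ioo a b))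
    {d : ℝ → V} {l : ℝ → W} (hd : MemLp d 2 (volume.restrict (Ioo a b)))
    (hl : MemLp l 2 (volume.restrict (Ioo a b))) {C : ℝ → ℝ → ℝ} {c : ℝ}
    (hCi : ∀ k > 0, IntegrableOn (fun t => C t (max a (t - k))) (Ioo a b))
    (hC : Tendsto (fun k => k⁻¹ * ∫ t in Ioo a b, C t (max a (t - k))) (𝓝[>] 0) (𝓝 c))
    (h : ∀ t ∈ S, t ∈ Ioo a b → ∀ s, (s = a ∨ (s ∈ S ∧ a < s)) → s < t →
      q t - q s ≤ (∫ r in s..t, B (d r) (l t)) + C t s)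
    {ε δ : ℝ} (hε : 0 < ε) (hδ : 0 < δ) :
    ∃ t ∈ S, t ∈ Ioo a b ∧ b - δ < t ∧
      q t ≤ q a + (∫ t in Ioo a b, B (d t) (l t)) + c + ε := by
  set d' : ℝ → V := (Ioo a b).indicator d with hd'
  set l' : ℝ → W := (Ioo a b).indicator l with hl'
  have hd2 : MemLp d' 2 volume := (memLp_indicator_iff_restrict measurableSet_Ioo).2 hd
  have hl2 : MemLp l' 2 volume := (memLp_indicator_iff_restrict measurableSet_Ioo).2 hl
  have hd1 : Integrable d' :=
    (integrable_indicator_iff measurableSet_Ioo).2 (hd.integrable (by norm_num))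
  have hl1 : Integrable l' :=
    (integrable_indicator_iff measurableSet_Ioo).2 (hl.integrable (by norm_num))
  -- G is the correlation of d and l at lag σ. By Fubini the bounds on the increments, integrated in
  -- t, become the integral of G over [0, k]. As G is continuous, division by k yields G 0 although
  -- d and l are only in L².
  set G : ℝ → ℝ := fun σ => ∫ t, B (d' (t - σ)) (l' t) with hG
  have hGc : Continuous G := continuous_integral_translate B hd2 hl2
  have hG0 : G 0 = ∫ t in Ioo a b, B (d t) (l t) := by
    rw [hG, ← integral_indicator measurableSet_Ioo]
    refine integral_congr_ae (Eventually.of_forall fun t => ?_)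
    by_cases ht : t ∈ Ioo a b <;> simp [hd', hl', ht]
  have hlim : Tendsto (fun k => k⁻¹ * (∫ σ in (0 : ℝ)..k, G σ) +
      k⁻¹ * ∫ t in Ioo a b, C t (max a (t - k))) (𝓝[>] 0) (𝓝 (G 0 + c)) :=
    (tendsto_inv_mul_integral hGc).add hC
  have hev := hlim.eventually (gt_mem_nhds (show G 0 + c < G 0 + c + ε by linarith))
  have hev2 : ∀ᶠ k in 𝓝[>] (0 : ℝ), k ∈ Ioo 0 (min δ (b - a)) :=
    Ioo_mem_nhdsGT (lt_min hδ (by linarith))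
  obtain ⟨k, hkG, hk0, hkm⟩ := (hev.and hev2).exists
  have hkδ : k < δ := hkm.trans_le (min_le_left _ _)
  have hkb : k < b - a := hkm.trans_le (min_le_right _ _)
  obtain ⟨hqd, hqe⟩ := integral_sub_delay hk0 hkb hq
  have hii : ∀ x y : ℝ, IntervalIntegrable d' volume x y := fun x y => hd1.intervalIntegrable
  -- Fubini
  have hprod : Integrable (fun p : ℝ × ℝ => B (d' (p.2 - p.1)) (l' p.2))
      ((volume.restrict (Ioc 0 k)).prod volume) := by
    have := (integrable_translate B hd1 hl1)
    refine this.mono_measure ?_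
    calc (volume.restrict (Ioc 0 k)).prod (volume : Measure ℝ)
        = (volume.restrict (Ioc 0 k)).prod (volume.restrict univ) := by
          rw [Measure.restrict_univ]
      _ = (volume.prod volume).restrict (Ioc 0 k ×ˢ univ) := by rw [Measure.prod_restrict]
      _ ≤ volume.prod volume := Measure.restrict_le_self
  have hfub : ∫ t, (∫ σ in (0 : ℝ)..k, B (d' (t - σ)) (l' t)) = ∫ σ in (0 : ℝ)..k, G σ := by
    simp only [intervalIntegral.integral_of_le hk0.le, hG]
    exact (integral_integral_swap (f := fun σ t => B (d' (t - σ)) (l' t)) hprod).symm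
  have hinner : Integrable fun t => ∫ σ in (0 : ℝ)..k, B (d' (t - σ)) (l' t) := by
    simp only [intervalIntegral.integral_of_le hk0.le]
    exact hprod.integral_prod_right
  have hfub2 : ∫ t in Ioo a b, (∫ σ in (0 : ℝ)..k, B (d' (t - σ)) (l' t)) =
      ∫ σ in (0 : ℝ)..k, G σ := by
    rw [← hfub]
    refine setIntegral_eq_integral_of_forall_compl_eq_zero fun t ht => ?_
    simp [hl', ht]
  -- the increments
  have hshift : ∀ᵐ t, t - k ∈ Ioo a b → t - k ∈ S := by
    rw [ae_restrict_iff' measurableSet_Ioo] at hS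
    exact (measurePreserving_sub_right volume k).quasiMeasurePreserving.ae hS
  have hle : ∫ t in Ioo a b, (q t - q (max a (t - k))) ≤
      ∫ t in Ioo a b, ((∫ σ in (0 : ℝ)..k, B (d' (t - σ)) (l' t)) + C t (max a (t - k))) := by
    refine integral_mono_ae (hq.sub hqd) (hinner.integrableOn.add (hCi k hk0)) ?_
    filter_upwards [hS, ae_restrict_mem measurableSet_Ioo, ae_restrict_of_ae hshift]
      with t htS ht hts
    have hst : max a (t - k) < t := max_lt ht.1 (by linarith)
    have hs : max a (t - k) = a ∨ (max a (t - k) ∈ S ∧ a < max a (t - k)) := by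
      rcases le_or_gt (t - k) a with h1 | h1
      · exact Or.inl (max_eq_left h1)
      · right
        rw [max_eq_right h1.le]
        exact ⟨hts ⟨h1, by linarith [ht.2]⟩, h1⟩
    refine (h t htS ht _ hs hst).trans (add_le_add_left (le_of_eq ?_) _)
    have e1 : ∫ σ in (0 : ℝ)..k, B (d' (t - σ)) (l' t) = ∫ r in (t - k)..t, B (d' r) (l t) := by
      have := intervalIntegral.integral_comp_sub_left (a := 0) (b := k)
        (fun r => B (d' r) (l t)) t
      rw [sub_zero] at this
      rw [← this]
      simp only [hl', indicator_of_mem ht]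
    have hBi : ∀ x y : ℝ, IntervalIntegrable (fun r => B (d' r) (l t)) volume x y := fun x y =>
      ⟨(B.flip (l t)).integrable_comp (hii x y).1, (B.flip (l t)).integrable_comp (hii x y).2⟩
    rw [e1, ← intervalIntegral.integral_add_adjacent_intervals (hBi (t - k) (max a (t - k)))
      (hBi _ t)]
    -- When t - k < a, the part of the window before a contributes nothing because d' is extended by
    -- zero.
    have z1 : ∫ r in (t - k)..(max a (t - k)), B (d' r) (l t) = 0 := by
      refine (intervalIntegral.integral_congr_ae (g := fun _ => (0 : ℝ))
        (Eventually.of_forall fun r hr => ?_)).trans intervalIntegral.integral_zero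
      rw [uIoc_of_le (le_max_right _ _)] at hr
      have : r ∉ Ioo a b := fun hmem => by
        rcases le_max_iff.1 hr.2 with h2 | h2
        · exact absurd hmem.1 (not_lt.2 h2)
        · exact absurd hr.1 (not_lt.2 h2)
      simp [hd', this]
    have z2 : ∫ r in (max a (t - k))..t, B (d' r) (l t) =
        ∫ r in (max a (t - k))..t, B (d r) (l t) := by
      refine intervalIntegral.integral_congr_ae (Eventually.of_forall fun r hr => ?_)
      rw [uIoc_of_le hst.le] at hr
      have : r ∈ Ioo a b := ⟨(le_max_left _ _).trans_lt hr.1, hr.2.trans_lt ht.2⟩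
      simp [hd', this]
    rw [z1, z2, zero_add]
  rw [hqe, integral_add hinner.integrableOn (hCi k hk0), hfub2] at hle
  -- a point below the average
  have hμ : volume.restrict (Ioo (b - k) b) ≠ 0 := by
    rw [Ne, Measure.restrict_eq_zero, Real.volume_Ioo, ENNReal.ofReal_eq_zero]
    linarith
  have hsub : Ioo (b - k) b ⊆ Ioo a b := Ioo_subset_Ioo (by linarith) le_rfl
  have hS' : ∀ᵐ t ∂volume.restrict (Ioo (b - k) b), t ∈ S ∩ Ioo (b - k) b := by
    filter_upwards [ae_restrict_of_ae_restrict_of_subset hsub hS,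
      ae_restrict_mem measurableSet_Ioo] with t h1 h2 using ⟨h1, h2⟩
  obtain ⟨t, htN, htle⟩ := exists_notMem_null_le_average hμ (hq.mono_set hsub)
    (N := (S ∩ Ioo (b - k) b)ᶜ) hS'
  rw [notMem_compl_iff] at htN
  refine ⟨t, htN.1, hsub htN.2, by linarith [htN.2.1], htle.trans ?_⟩
  rw [setAverage_eq, Real.volume_real_Ioo, smul_eq_mul, sub_sub_cancel,
    max_eq_left hk0.le, inv_mul_le_iff₀ hk0, ← hG0]
  have h1 : k * (k⁻¹ * (∫ σ in (0 : ℝ)..k, G σ) +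
      k⁻¹ * ∫ t in Ioo a b, C t (max a (t - k))) < k * (G 0 + c + ε) :=
    mul_lt_mul_of_pos_left hkG hk0
  rw [mul_add, mul_inv_cancel_left₀ hk0.ne', mul_inv_cancel_left₀ hk0.ne'] at h1
  nlinarith [h1, hle]

/-- The discrete chain rule for a nonnegative quantity without error term. -/
theorem nonneg_add_integral (B : V →L[ℝ] W →L[ℝ] ℝ) {a b : ℝ} (hab : a < b) {q : ℝ → ℝ}
    {S : Set ℝ} (hS : ∀ᵐ t ∂volume.restrict (Ioo a b), t ∈ S) (hq : IntegrableOn q (Ioo a b))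
    (hq0 : ∀ t ∈ Ioo a b, 0 ≤ q t)
    {d : ℝ → V} {l : ℝ → W} (hd : MemLp d 2 (volume.restrict (Ioo a b)))
    (hl : MemLp l 2 (volume.restrict (Ioo a b)))
    (h : ∀ t ∈ S, t ∈ Ioo a b → ∀ s, a ≤ s → s < t →
      q t - q s ≤ ∫ r in s..t, B (d r) (l t)) :
    0 ≤ q a + ∫ t in Ioo a b, B (d t) (l t) := by
  refine le_of_forall_pos_le_add fun ε hε => ?_
  obtain ⟨t, -, ht, -, hle⟩ := exists_le_add_integral B hab hS hq hd hl (C := fun _ _ => 0)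
    (c := 0) (by simp [IntegrableOn]) (by simp) (fun t htS ht s hs hst => by
      rw [add_zero]
      exact h t htS ht s (hs.elim (fun h => h.ge) fun h => h.2.le) hst) hε one_pos
  linarith [hq0 t ht]

end DiscreteChain

/-! ### Exponential time averages. -/

section ExponentialFilter

variable {V : Type*} [NormedAddCommGroup V] [NormedSpace ℝ V] [CompleteSpace V]

/-- The solution of `y + h y' = U`, `y a = x₀`. -/
theorem exists_filter {a b h : ℝ} (hab : a ≤ b) (hh : 0 < h) {U : ℝ → V}
    (hU : IntegrableOn U (Ioo a b)) (x₀ : V) :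
    ∃ y : ℝ → V, Continuous y ∧ y a = x₀ ∧
      ∀ t ∈ Icc a b, y t - x₀ = ∫ r in a..t, h⁻¹ • (U r - y r) := by
  -- The primitive Y of y satisfies Y + h Y' = I + h x₀, whose right-hand side is continuous.
  -- Duhamel's formula gives Y of class C¹, so y = Y' is continuous although U is merely integrable.
  set I : ℝ → V := fun t => ∫ r in a..t, (Ioo a b).indicator U r with hI
  have hUi : Integrable ((Ioo a b).indicator U) := (integrable_indicator_iff measurableSet_Ioo).2 hU
  have hIc : Continuous I := intervalIntegral.continuous_primitive
    (fun x y => hUi.intervalIntegrable) a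
  set P : ℝ → V := fun t => ∫ r in a..t, Real.exp (r / h) • (h⁻¹ • (I r + h • x₀)) with hP
  have hint : Continuous fun r => Real.exp (r / h) • (h⁻¹ • (I r + h • x₀)) := by fun_prop
  have hPd : ∀ t, HasDerivAt P (Real.exp (t / h) • (h⁻¹ • (I t + h • x₀))) t := fun t =>
    (hint.integral_hasStrictDerivAt a t).hasDerivAt
  set Y : ℝ → V := fun t => Real.exp (-t / h) • P t with hY
  have hPc : Continuous P := continuous_iff_continuousAt.2 fun t => (hPd t).continuousAt
  have hYc : Continuous Y := by fun_prop
  set y : ℝ → V := fun t => h⁻¹ • (I t + h • x₀ - Y t) with hy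
  have hyc : Continuous y := by fun_prop
  have hYd : ∀ t, HasDerivAt Y (y t) t := fun t => by
    have h1 : HasDerivAt (fun t => Real.exp (-t / h)) (Real.exp (-t / h) * (-1 / h)) t :=
      ((hasDerivAt_id t).neg.div_const h).exp
    convert! h1.smul (hPd t) using 1
    rw [smul_smul, ← Real.exp_add, show -t / h + t / h = 0 by ring, Real.exp_zero, one_smul, hy]
    simp only [hY, smul_sub]
    rw [show Real.exp (-t / h) * (-1 / h) = -(h⁻¹ * Real.exp (-t / h)) by ring, neg_smul, mul_smul,
      sub_eq_add_neg]
  have hYa : Y a = 0 := by simp [hY, hP]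
  have hYi : ∀ t, Y t = ∫ r in a..t, y r := fun t => by
    rw [intervalIntegral.integral_eq_sub_of_hasDerivAt (fun x _ => hYd x)
      (hyc.intervalIntegrable _ _), hYa, sub_zero]
  refine ⟨y, hyc, ?_, fun t ht => ?_⟩
  · simp [hy, hYa, hI, smul_smul, hh.ne']
  · have e1 : I t = ∫ r in a..t, U r := by
      refine intervalIntegral.integral_congr_ae ?_
      have : ∀ᵐ r : ℝ, r ≠ b := by simp [ae_iff, measure_singleton]
      filter_upwards [this] with r hrb hr
      rw [uIoc_of_le ht.1] at hr
      exact indicator_of_mem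
        (show r ∈ Ioo a b from ⟨hr.1, lt_of_le_of_ne (hr.2.trans ht.2) hrb⟩) U
    have hUii : IntervalIntegrable U volume a t :=
      ((intervalIntegrable_iff_integrableOn_Ioo_of_le hab).2 hU).mono_set
        (uIcc_subset_uIcc_left (by rwa [uIcc_of_le hab]))
    rw [intervalIntegral.integral_smul, intervalIntegral.integral_sub hUii
      (hyc.intervalIntegrable _ _), ← e1, ← hYi, hy]
    simp only [smul_sub, smul_add, smul_smul, inv_mul_cancel₀ hh.ne', one_smul]
    abel

end ExponentialFilter

/-! ### Integrability and measurability of curves. -/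

section Measurability

variable {E₁ E₂ E₃ : Type*} [NormedAddCommGroup E₁] [NormedSpace ℝ E₁]
  [NormedAddCommGroup E₂] [NormedSpace ℝ E₂] [NormedAddCommGroup E₃] [NormedSpace ℝ E₃]

theorem integrable_bilin {Ω : Type*} [MeasurableSpace Ω] {μ : Measure Ω}
    (B : E₁ →L[ℝ] E₂ →L[ℝ] E₃) {x : Ω → E₁} {y : Ω → E₂} (hx : MemLp x 2 μ) (hy : MemLp y 2 μ) :
    Integrable (fun t => B (x t) (y t)) μ :=
  memLp_one_iff_integrable.1 (B.memLp_of_bilin 1 hx hy)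

theorem memLp_clm_apply {a b : ℝ} {A : ℝ → E₁ →L[ℝ] E₂} (hA : ContinuousOn A (Icc a b))
    {x : ℝ → E₁} (hx : MemLp x 2 (volume.restrict (Ioo a b))) :
    MemLp (fun t => A t (x t)) 2 (volume.restrict (Ioo a b)) := by
  obtain ⟨C, hC⟩ := isCompact_Icc.exists_bound_of_continuousOn hA
  have hAm : AEStronglyMeasurable A (volume.restrict (Ioo a b)) :=
    (hA.mono Ioo_subset_Icc_self).aestronglyMeasurable measurableSet_Ioo
  refine hx.of_le_mul (c := C)
    ((ContinuousLinearMap.id ℝ (E₁ →L[ℝ] E₂)).aestronglyMeasurable_comp₂ hAm hx.1) ?_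
  filter_upwards [ae_restrict_mem measurableSet_Ioo] with t ht
  exact (A t).le_of_opNorm_le (hC t (Ioo_subset_Icc_self ht)) _

theorem memLp_of_continuousOn {a b : ℝ} {x : ℝ → E₁} (hx : ContinuousOn x (Icc a b)) :
    MemLp x 2 (volume.restrict (Ioo a b)) := by
  obtain ⟨C, hC⟩ := isCompact_Icc.exists_bound_of_continuousOn hx
  refine MemLp.of_bound ((hx.mono Ioo_subset_Icc_self).aestronglyMeasurable measurableSet_Ioo) C ?_
  filter_upwards [ae_restrict_mem measurableSet_Ioo] with t ht
  exact hC t (Ioo_subset_Icc_self ht)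

/-- By the Lusin–Souslin theorem, a continuous injection of a Polish space is a measurable
embedding. Measurability of the F-valued curves w e^{-f_t} can therefore be checked in L². -/
theorem aestronglyMeasurable_of_map [CompleteSpace E₁] [SecondCountableTopology E₁]
    {Ω : Type*} [MeasurableSpace Ω] {μ : Measure Ω} (j : E₁ →L[ℝ] E₂)
    (hj : Function.Injective j) {N : Ω → E₁}
    (hN : AEStronglyMeasurable (fun t => j (N t)) μ) : AEStronglyMeasurable N μ := by
  borelize E₁ E₂
  have h := j.continuous.measurableEmbedding hj
  exact (h.aemeasurable_comp_iff.1 hN.aemeasurable).aestronglyMeasurable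

end Measurability

/-! ### Abstract evolution equations with monotone forms: regularity and energy. -/

section Evolution

variable {H F : Type*} [NormedAddCommGroup H] [InnerProductSpace ℝ H] [CompleteSpace H]
  [NormedAddCommGroup F] [InnerProductSpace ℝ F] [CompleteSpace F]

/-- The embedding of `H` into the dual of `F` induced by `j : F → H`. -/
def dualMap (j : F →L[ℝ] H) : H →L[ℝ] StrongDual ℝ F :=
  (ContinuousLinearMap.compL ℝ F H ℝ).flip j ∘L innerSL ℝ

theorem dualMap_apply (j : F →L[ℝ] H) (h : H) (v : F) : dualMap j h v = inner ℝ h (j v) := rfl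

/-- Forms `α t` on `F`, weights `R t` on `H` and their restrictions `M t` to `F`, such that the
quadratic forms of `α` and `R` are nonincreasing in time. -/
structure EvolutionFamily (j : F →L[ℝ] H) (a b : ℝ) (α : ℝ → F →L[ℝ] F →L[ℝ] ℝ)
    (R : ℝ → H →L[ℝ] H) (M : ℝ → F → F) : Prop where
  form_cont : ContinuousOn α (Icc a b)
  form_symm : ∀ t ∈ Icc a b, ∀ u v, α t u v = α t v u
  form_nonneg : ∀ t ∈ Icc a b, ∀ u, 0 ≤ α t u u
  form_anti : ∀ s ∈ Icc a b, ∀ t ∈ Icc a b, s ≤ t → ∀ u, α t u u ≤ α s u u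
  weight_cont : ContinuousOn R (Icc a b)
  weight_symm : ∀ t ∈ Icc a b, ∀ x y, inner ℝ (R t x) y = inner ℝ (R t y) x
  weight_anti : ∀ s ∈ Icc a b, ∀ t ∈ Icc a b, s ≤ t → ∀ x, inner ℝ (R t x) x ≤ inner ℝ (R s x) x
  weight_lower : ∃ c : ℝ, 0 < c ∧ ∀ t ∈ Icc a b, ∀ x, c * ‖x‖ ^ 2 ≤ inner ℝ (R t x) x
  mul_map : ∀ t ∈ Icc a b, ∀ w, j (M t w) = R t (j w)
  mul_bound : ∃ c : ℝ, ∀ t ∈ Icc a b, ∀ w, ‖M t w‖ ≤ c * ‖w‖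

/-- Expand β(x-y, x-y) ≥ 0. The change from γ to β enters only through its sign, so no time
derivative of the forms is needed. -/
theorem sub_le_two_mul_of_anti {V : Type*} [NormedAddCommGroup V] [NormedSpace ℝ V]
    {β γ : V →L[ℝ] V →L[ℝ] ℝ} (hsymm : ∀ u v, β u v = β v u) (hnn : ∀ u, 0 ≤ β u u)
    (x y : V) (hle : β y y ≤ γ y y) : β x x - γ y y ≤ 2 * β x (x - y) := by
  have h := hnn (x - y)
  simp only [map_sub, _root_.sub_apply] at h ⊢
  have := hsymm x y
  linarith

namespace EvolutionFamily

variable {j : F →L[ℝ] H} {a b : ℝ} {α : ℝ → F →L[ℝ] F →L[ℝ] ℝ} {R : ℝ → H →L[ℝ] H} {M : ℝ → F → F}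

theorem memLp_mul [SecondCountableTopology F] (hE : EvolutionFamily j a b α R M)
    (hj : Function.Injective j) {z : ℝ → F} (hz : MemLp z 2 (volume.restrict (Ioo a b))) :
    MemLp (fun t => M t (z t)) 2 (volume.restrict (Ioo a b)) := by
  obtain ⟨c, hc⟩ := hE.mul_bound
  have hjz : MemLp (fun t => j (z t)) 2 (volume.restrict (Ioo a b)) := j.comp_memLp' hz
  refine hz.of_le_mul (c := c) (aestronglyMeasurable_of_map j hj ?_) ?_
  · refine (memLp_clm_apply hE.weight_cont hjz).1.congr ?_
    filter_upwards [ae_restrict_mem measurableSet_Ioo] with t ht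
    exact (hE.mul_map t (Ioo_subset_Icc_self ht) _).symm
  · filter_upwards [ae_restrict_mem measurableSet_Ioo] with t ht
    exact hc t (Ioo_subset_Icc_self ht) _

/-- The energy inequality of the forms along an absolutely continuous curve in `F`. -/
theorem nonneg_form_add (hE : EvolutionFamily j a b α R M) (hab : a < b) {y z : ℝ → F}
    (hy : Continuous y) (hz : MemLp z 2 (volume.restrict (Ioo a b)))
    (hyz : ∀ t ∈ Icc a b, y t - y a = ∫ r in a..t, z r) :
    0 ≤ α a (y a) (y a) + 2 * ∫ t in Ioo a b, α t (y t) (z t) := by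
  have hzi : IntervalIntegrable z volume a b :=
    (intervalIntegrable_iff_integrableOn_Ioo_of_le hab.le).2 (hz.integrable (by norm_num))
  have hαy : ContinuousOn (fun t => α t (y t)) (Icc a b) := hE.form_cont.clm_apply hy.continuousOn
  have hl : MemLp (fun t => (2 : ℝ) • α t (y t)) 2 (volume.restrict (Ioo a b)) :=
    (memLp_of_continuousOn hαy).const_smul (2 : ℝ)
  have key := nonneg_add_integral (ContinuousLinearMap.apply ℝ ℝ) hab (S := univ) (by simp)
    (q := fun t => α t (y t) (y t)) (d := z)
    (((hαy.clm_apply hy.continuousOn).integrableOn_Icc).mono_set Ioo_subset_Icc_self)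
    (fun t ht => hE.form_nonneg t (Ioo_subset_Icc_self ht) _) hz hl
    (fun t _ ht s hs hst => by
      have hti := Ioo_subset_Icc_self ht
      have hsi : s ∈ Icc a b := ⟨hs, (hst.trans ht.2).le⟩
      refine (sub_le_two_mul_of_anti (hE.form_symm t hti) (hE.form_nonneg t hti) (y t) (y s)
        (hE.form_anti s hsi t hti hst.le _)).trans (le_of_eq ?_)
      have h1 : IntervalIntegrable z volume a s :=
        hzi.mono_set (uIcc_subset_uIcc_left (by rwa [uIcc_of_le hab.le]))
      have h2 : IntervalIntegrable z volume a t :=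
        hzi.mono_set (uIcc_subset_uIcc_left (by rwa [uIcc_of_le hab.le]))
      have h3 : y t - y s = ∫ r in s..t, z r := by
        rw [← intervalIntegral.integral_interval_sub_left h2 h1, ← hyz t hti, ← hyz s hsi]
        abel
      rw [h3, ← ContinuousLinearMap.intervalIntegral_comp_comm _ (h1.symm.trans h2),
        ← intervalIntegral.integral_const_mul]
      rfl)
  have e : ∫ t in Ioo a b, ContinuousLinearMap.apply ℝ ℝ (z t) ((2 : ℝ) • α t (y t)) =
      2 * ∫ t in Ioo a b, α t (y t) (z t) := by
    rw [← integral_const_mul]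
    rfl
  linarith

/-- The energy inequality of the weights along a curve in `L²(F) ∩ H¹(F*)` starting at `0`. -/
theorem nonneg_integral_weight [SecondCountableTopology F] (hE : EvolutionFamily j a b α R M)
    (hab : a < b) (hj : Function.Injective j) {ζ : ℝ → H} (hζ : ContinuousOn ζ (Icc a b))
    (hζa : ζ a = 0) {z : ℝ → F} (hz : MemLp z 2 (volume.restrict (Ioo a b)))
    (hζz : ∀ᵐ t ∂volume.restrict (Ioo a b), j (z t) = ζ t) {dζ : ℝ → StrongDual ℝ F}
    (hdζ : MemLp dζ 2 (volume.restrict (Ioo a b)))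
    (hd : ∀ t ∈ Icc a b, dualMap j (ζ t) = ∫ r in a..t, dζ r) :
    0 ≤ ∫ t in Ioo a b, dζ t (M t (z t)) := by
  have hi : IntervalIntegrable dζ volume a b :=
    (intervalIntegrable_iff_integrableOn_Ioo_of_le hab.le).2 (hdζ.integrable (by norm_num))
  have hRζ : ContinuousOn (fun t => R t (ζ t)) (Icc a b) := hE.weight_cont.clm_apply hζ
  obtain ⟨c, hc0, hc⟩ := hE.weight_lower
  -- The increment bound pairs the increment of ζ in F* with M_t z_t at the later time t only. It is
  -- thus needed only at those t where z_t represents ζ_t.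
  have key := nonneg_add_integral
    (ContinuousLinearMap.id ℝ (StrongDual ℝ F)) hab
    (S := {t | j (z t) = ζ t}) hζz
    (q := fun t => inner ℝ (R t (ζ t)) (ζ t)) (d := dζ) (l := fun t => (2 : ℝ) • M t (z t))
    (((hRζ.inner hζ).integrableOn_Icc).mono_set Ioo_subset_Icc_self)
    (fun t ht => (mul_nonneg hc0.le (sq_nonneg _)).trans (hc t (Ioo_subset_Icc_self ht) _)) hdζ
    ((hE.memLp_mul hj hz).const_smul 2)
    (fun t htS ht s hs hst => by
      have hti := Ioo_subset_Icc_self ht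
      have hsi : s ∈ Icc a b := ⟨hs, (hst.trans ht.2).le⟩
      let β : ℝ → H →L[ℝ] H →L[ℝ] ℝ := fun t => innerSL ℝ ∘L R t
      refine (sub_le_two_mul_of_anti (β := β t) (γ := β s) (hE.weight_symm t hti)
        (fun x => (mul_nonneg hc0.le (sq_nonneg _)).trans (hc t hti x)) (ζ t) (ζ s)
        (hE.weight_anti s hsi t hti hst.le _)).trans (le_of_eq ?_)
      have h1 : IntervalIntegrable dζ volume a s :=
        hi.mono_set (uIcc_subset_uIcc_left (by rwa [uIcc_of_le hab.le]))
      have h2 : IntervalIntegrable dζ volume a t :=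
        hi.mono_set (uIcc_subset_uIcc_left (by rwa [uIcc_of_le hab.le]))
      have h3 : dualMap j (ζ t - ζ s) = ∫ r in s..t, dζ r := by
        rw [← intervalIntegral.integral_interval_sub_left h2 h1, ← hd t hti, ← hd s hsi, map_sub]
      have h4 : ∫ r in s..t, dζ r ((2 : ℝ) • M t (z t)) =
          (∫ r in s..t, dζ r) ((2 : ℝ) • M t (z t)) :=
        ContinuousLinearMap.intervalIntegral_comp_comm
          (ContinuousLinearMap.apply ℝ ℝ ((2 : ℝ) • M t (z t))) (h1.symm.trans h2)
      show 2 * inner ℝ (R t (ζ t)) (ζ t - ζ s) = ∫ r in s..t, dζ r ((2 : ℝ) • M t (z t))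
      rw [h4, ← h3, dualMap_apply, map_smul, hE.mul_map t hti, htS, inner_smul_right,
        real_inner_comm])
  simp only [hζa, inner_zero_right, zero_add] at key
  have e : ∫ t in Ioo a b, ContinuousLinearMap.id ℝ (StrongDual ℝ F) (dζ t) ((2 : ℝ) • M t (z t)) =
      2 * ∫ t in Ioo a b, dζ t (M t (z t)) := by
    rw [← integral_const_mul]
    simp
  linarith

end EvolutionFamily

theorem intervalIntegrable_of_memLp {V : Type*} [NormedAddCommGroup V] {a b : ℝ} (hab : a ≤ b)
    {f : ℝ → V} (hf : MemLp f 2 (volume.restrict (Ioo a b))) {t : ℝ} (ht : t ∈ Icc a b) :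
    IntervalIntegrable f volume a t :=
  ((intervalIntegrable_iff_integrableOn_Ioo_of_le hab).2
    (show Integrable f (volume.restrict (Ioo a b)) from hf.integrable (by norm_num))).mono_set
      (uIcc_subset_uIcc_left (by rwa [uIcc_of_le hab]))

namespace EvolutionFamily

variable {j : F →L[ℝ] H} {a b : ℝ} {α : ℝ → F →L[ℝ] F →L[ℝ] ℝ} {R : ℝ → H →L[ℝ] H} {M : ℝ → F → F}

/-- The exponential time averages of a weak solution with initial value in `F` have derivatives
bounded in `L²(H)`. -/
theorem exists_bounded_filter [SecondCountableTopology F] (hE : EvolutionFamily j a b α R M)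
    (hab : a < b) (hj : Function.Injective j) {u : ℝ → H} (hu : ContinuousOn u (Icc a b)) {x₀ : F}
    (hx₀ : j x₀ = u a) {U : ℝ → F} (hU : MemLp U 2 (volume.restrict (Ioo a b)))
    (hUu : ∀ᵐ t ∂volume.restrict (Ioo a b), j (U t) = u t) {dU : ℝ → StrongDual ℝ F}
    (hdU : MemLp dU 2 (volume.restrict (Ioo a b)))
    (hd : ∀ t ∈ Icc a b, dualMap j (u t) - dualMap j (u a) = ∫ r in a..t, dU r) {p : ℝ → H}
    (hp : MemLp p 2 (volume.restrict (Ioo a b)))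
    (heq : ∀ᵐ t ∂volume.restrict (Ioo a b), ∀ w,
      dU t (M t w) = -α t (U t) w - inner ℝ (p t) (j w)) :
    ∃ C : ℝ, ∀ h : ℝ, 0 < h → ∃ y z : ℝ → F, Continuous y ∧ y a = x₀ ∧
      MemLp z 2 (volume.restrict (Ioo a b)) ∧ (∀ t ∈ Icc a b, y t - x₀ = ∫ r in a..t, z r) ∧
      (∀ t, U t = y t + h • z t) ∧ ∫ t in Ioo a b, ‖j (z t)‖ ^ 2 ≤ C := by
  obtain ⟨c, hc0, hc⟩ := hE.weight_lower
  -- The two energy inequalities and Young's inequality leave (c/2)∫‖j z‖² ≤ α_a(x₀,x₀)/2 +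
  -- (1/(2c))∫‖p‖², in which h no longer appears.
  refine ⟨(α a x₀ x₀ + c⁻¹ * ∫ t in Ioo a b, ‖p t‖ ^ 2) / c, fun h hh => ?_⟩
  obtain ⟨y, hyc, hya, hyi⟩ := exists_filter hab.le hh (hU.integrable (by norm_num)) x₀
  set z : ℝ → F := fun t => h⁻¹ • (U t - y t) with hz
  have hz2 : MemLp z 2 (volume.restrict (Ioo a b)) :=
    (hU.sub (memLp_of_continuousOn hyc.continuousOn)).const_smul h⁻¹
  have hUyz : ∀ t, U t = y t + h • z t := fun t => by
    simp [hz, smul_smul, hh.ne']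
  refine ⟨y, z, hyc, hya, hz2, hyi, hUyz, ?_⟩
  have hjz : MemLp (fun t => j (z t)) 2 (volume.restrict (Ioo a b)) := j.comp_memLp' hz2
  have hJz : MemLp (fun t => dualMap j (j (z t))) 2 (volume.restrict (Ioo a b)) :=
    (dualMap j).comp_memLp' hjz
  have hA := hE.nonneg_form_add hab hyc hz2 (by rwa [hya])
  rw [hya] at hA
  set dζ : ℝ → StrongDual ℝ F := fun t => h⁻¹ • (dU t - dualMap j (j (z t))) with hdζ
  have hdζ2 : MemLp dζ 2 (volume.restrict (Ioo a b)) := (hdU.sub hJz).const_smul h⁻¹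
  -- h⁻¹(u - j y) is the continuous representative of j z. It vanishes at a because y starts at x₀;
  -- this is where u_a ∈ F is used.
  have hB := hE.nonneg_integral_weight hab hj (ζ := fun t => h⁻¹ • (u t - j (y t)))
    ((hu.sub (j.continuous.comp hyc).continuousOn).const_smul h⁻¹) (by simp [hya, hx₀]) hz2
    (by
      filter_upwards [hUu] with t ht
      rw [hz, map_smul, map_sub, ht]) hdζ2 (fun t ht => by
      have h4 : ∫ r in a..t, dualMap j (j (z r)) = dualMap j (j (∫ r in a..t, z r)) :=
        ((dualMap j) ∘L j).intervalIntegral_comp_comm (intervalIntegrable_of_memLp hab.le hz2 ht)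
      rw [hdζ, intervalIntegral.integral_smul,
        intervalIntegral.integral_sub (intervalIntegrable_of_memLp hab.le hdU ht)
          (intervalIntegrable_of_memLp hab.le hJz ht), ← hd t ht, h4, ← hyi t ht, ← hx₀]
      simp only [map_smul, map_sub]
      congr 1
      abel)
  have hiα : Integrable (fun t => α t (y t) (z t)) (volume.restrict (Ioo a b)) :=
    integrable_bilin (ContinuousLinearMap.id ℝ (StrongDual ℝ F))
      (memLp_of_continuousOn (hE.form_cont.clm_apply hyc.continuousOn)) hz2
  have hip : Integrable (fun t => ‖p t‖ ^ 2) (volume.restrict (Ioo a b)) :=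
    (memLp_two_iff_integrable_sq_norm hp.1).1 hp
  have hijz : Integrable (fun t => ‖j (z t)‖ ^ 2) (volume.restrict (Ioo a b)) :=
    (memLp_two_iff_integrable_sq_norm hjz.1).1 hjz
  have hidζ : Integrable (fun t => dζ t (M t (z t))) (volume.restrict (Ioo a b)) :=
    integrable_bilin (ContinuousLinearMap.id ℝ (StrongDual ℝ F)) hdζ2 (hE.memLp_mul hj hz2)
  -- The equation is tested with z. Since U = y + h z, the term -h α(z,z) ≤ 0 splits off and is
  -- dropped, while the weight supplies -c‖j z‖², half of which is spent on the source p.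
  have hle : ∫ t in Ioo a b, h * dζ t (M t (z t)) ≤
      ∫ t in Ioo a b, (-α t (y t) (z t) + c⁻¹ / 2 * ‖p t‖ ^ 2 - c / 2 * ‖j (z t)‖ ^ 2) := by
    refine integral_mono_ae (hidζ.const_mul h)
      ((hiα.neg.add (hip.const_mul _)).sub (hijz.const_mul _)) ?_
    filter_upwards [heq, ae_restrict_mem measurableSet_Ioo] with t ht hmem
    have hti := Ioo_subset_Icc_self hmem
    have e1 : h * dζ t (M t (z t)) = dU t (M t (z t)) - inner ℝ (R t (j (z t))) (j (z t)) := by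
      simp only [hdζ, _root_.smul_apply, _root_.sub_apply, dualMap_apply, hE.mul_map t hti,
        smul_eq_mul]
      rw [real_inner_comm]
      field_simp
    have e2 := hc t hti (j (z t))
    have e3 : α t (U t) (z t) = α t (y t) (z t) + h * α t (z t) (z t) := by
      have := congrArg (fun v => α t v (z t)) (hUyz t)
      simpa only [map_add, map_smul, _root_.add_apply, _root_.smul_apply, smul_eq_mul] using this
    have e4 := mul_nonneg hh.le (hE.form_nonneg t hti (z t))
    have e5 : -inner ℝ (p t) (j (z t)) ≤ c⁻¹ / 2 * ‖p t‖ ^ 2 + c / 2 * ‖j (z t)‖ ^ 2 := by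
      have h1 := abs_le.1 (abs_real_inner_le_norm (p t) (j (z t)))
      have h2 : 0 ≤ c⁻¹ / 2 * (‖p t‖ - c * ‖j (z t)‖) ^ 2 := by positivity
      have h3 : c⁻¹ / 2 * (‖p t‖ - c * ‖j (z t)‖) ^ 2 =
          c⁻¹ / 2 * ‖p t‖ ^ 2 - ‖p t‖ * ‖j (z t)‖ + c / 2 * ‖j (z t)‖ ^ 2 := by
        field_simp
        ring
      linarith [h1.1]
    rw [e1, ht, e3]
    linarith
  have hsum : ∫ t in Ioo a b, (-α t (y t) (z t) + c⁻¹ / 2 * ‖p t‖ ^ 2 - c / 2 * ‖j (z t)‖ ^ 2) =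
      -(∫ t in Ioo a b, α t (y t) (z t)) + c⁻¹ / 2 * (∫ t in Ioo a b, ‖p t‖ ^ 2) -
        c / 2 * ∫ t in Ioo a b, ‖j (z t)‖ ^ 2 := by
    have h1 := integral_sub (hiα.neg.add (hip.const_mul (c⁻¹ / 2))) (hijz.const_mul (c / 2))
    have h2 := integral_add hiα.neg (hip.const_mul (c⁻¹ / 2))
    simp only [Pi.add_apply, Pi.neg_apply, integral_neg, integral_const_mul] at h1 h2
    rw [h1, h2]
  rw [integral_const_mul, hsum] at hle
  rw [le_div_iff₀ hc0]
  have := mul_nonneg hh.le hB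
  linarith

/-- A weak solution with initial value in `F` has a time derivative in `L²(H)`. -/
theorem exists_deriv [SecondCountableTopology F] (hE : EvolutionFamily j a b α R M)
    (hab : a < b) (hj : Function.Injective j)
    {u : ℝ → H} (hu : ContinuousOn u (Icc a b)) {x₀ : F}
    (hx₀ : j x₀ = u a) {U : ℝ → F} (hU : MemLp U 2 (volume.restrict (Ioo a b)))
    (hUu : ∀ᵐ t ∂volume.restrict (Ioo a b), j (U t) = u t) {dU : ℝ → StrongDual ℝ F}
    (hdU : MemLp dU 2 (volume.restrict (Ioo a b)))
    (hd : ∀ t ∈ Icc a b, dualMap j (u t) - dualMap j (u a) = ∫ r in a..t, dU r) {p : ℝ → H}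
    (hp : MemLp p 2 (volume.restrict (Ioo a b)))
    (heq : ∀ᵐ t ∂volume.restrict (Ioo a b), ∀ w,
      dU t (M t w) = -α t (U t) w - inner ℝ (p t) (j w)) :
    ∃ g : ℝ → H, MemLp g 2 (volume.restrict (Ioo a b)) ∧ HasWeakDerivOn a b u g ∧
      (∀ t ∈ Icc a b, u t - u a = ∫ r in a..t, g r) ∧
      ∀ᵐ t ∂volume.restrict (Ioo a b), dU t = dualMap j (g t) := by
  obtain ⟨C, hC⟩ := hE.exists_bounded_filter hab hj hu hx₀ hU hUu hdU hd hp heq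
  choose y z hyc hya hz2 hyi hUyz hbd using
    fun n : ℕ => hC (1 / ((n : ℝ) + 1)) Nat.one_div_pos_of_nat
  have hjz : ∀ n, MemLp (fun t => j (z n t)) 2 (volume.restrict (Ioo a b)) :=
    fun n => j.comp_memLp' (hz2 n)
  set G : ℕ → Lp H 2 (volume.restrict (Ioo a b)) := fun n => (hjz n).toLp _ with hG
  have hGn : ∀ n, ‖G n‖ ≤ √C := fun n => by
    refine Real.le_sqrt_of_sq_le (le_trans (le_of_eq ?_) (hbd n))
    rw [← real_inner_self_eq_norm_sq, L2.inner_def]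
    refine integral_congr_ae ?_
    filter_upwards [(hjz n).coeFn_toLp] with t ht
    rw [hG, ht, real_inner_self_eq_norm_sq]
  obtain ⟨g, -, hg⟩ := exists_weak_limit hGn
  have hpair : ∀ {f : ℝ → H} (hf : MemLp f 2 (volume.restrict (Ioo a b)))
      (θ : ℝ → ℝ) (hθ : Continuous θ) (x : H)
      (hθx : MemLp (fun t => θ t • x) 2 (volume.restrict (Ioo a b))),
      inner ℝ (hf.toLp f) (hθx.toLp _) = inner ℝ (∫ t in Ioo a b, θ t • f t) x := by
    intro f hf θ hθ x hθx
    rw [L2.inner_def, real_inner_comm, ← integral_inner]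
    · refine integral_congr_ae ?_
      filter_upwards [hf.coeFn_toLp, hθx.coeFn_toLp] with t h1 h2
      rw [h1, h2, inner_smul_right, inner_smul_right, real_inner_comm]
    · exact integrable_bilin (ContinuousLinearMap.lsmul ℝ ℝ)
        (memLp_of_continuousOn hθ.continuousOn) hf
  have hmem : ∀ θ : ℝ → ℝ, Continuous θ → ∀ x : H,
      MemLp (fun t => θ t • x) 2 (volume.restrict (Ioo a b)) := fun θ hθ x =>
    memLp_of_continuousOn (hθ.smul continuous_const).continuousOn
  have hu2 := memLp_of_continuousOn hu
  have hweak : HasWeakDerivOn a b u g := fun φ hφ hφc hφs => by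
    have hφ' : Continuous (deriv φ) := hφ.continuous_deriv (by simp)
    have ha : φ a = 0 := by
      by_contra hne
      exact lt_irrefl _ (hφs (subset_tsupport φ hne)).1
    have hb : φ b = 0 := by
      by_contra hne
      exact lt_irrefl _ (hφs (subset_tsupport φ hne)).2
    refine ext_inner_right ℝ fun x => ?_
    have h1 := hg ((hmem φ hφ.continuous x).toLp _)
    have h2 := hg ((hmem _ hφ' x).toLp _)
    have hzero : Tendsto (fun n : ℕ => 1 / ((n : ℝ) + 1)) (hyperfilter ℕ : Filter ℕ) (𝓝 0) :=
      tendsto_one_div_add_atTop_nhds_zero_nat.mono_left Nat.hyperfilter_le_atTop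
    have h3 := hzero.mul h2
    rw [zero_mul] at h3
    -- Integrate by parts in u = j y_n + h_n j z_n with h_n = 1/(n+1). As z_n stays bounded in L²(H)
    -- and h_n → 0, the correction disappears in the limit, and convergence of y_n to u need not be
    -- shown.
    have h4 : ∀ n, inner ℝ (G n) ((hmem φ hφ.continuous x).toLp _) =
        1 / ((n : ℝ) + 1) * inner ℝ (G n) ((hmem _ hφ' x).toLp _) -
          inner ℝ (∫ t in Ioo a b, deriv φ t • u t) x := fun n => by
      have hzi : IntervalIntegrable (z n) volume a b :=
        (intervalIntegrable_iff_integrableOn_Ioo_of_le hab.le).2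
          ((hz2 n).integrable (by norm_num))
      have hpart := integral_deriv_smul_primitive hzi (hφ.of_le (by simp)) ha hb
      have hcong : ∫ t in a..b, deriv φ t • (∫ r in a..t, z n r) =
          ∫ t in a..b, (deriv φ t • y n t - deriv φ t • x₀) := by
        refine intervalIntegral.integral_congr fun t ht => ?_
        rw [uIcc_of_le hab.le] at ht
        simp only [← smul_sub, hyi n t ht]
      have hφ0 : ∫ t in a..b, deriv φ t = 0 := by
        rw [intervalIntegral.integral_deriv_eq_sub
          (fun x _ => (hφ.differentiable (by simp)).differentiableAt)
          (hφ'.intervalIntegrable _ _), ha, hb, sub_zero]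
      have hi1 : IntervalIntegrable (fun t => deriv φ t • y n t) volume a b :=
        (hφ'.smul (hyc n)).intervalIntegrable _ _
      have hi2 : IntervalIntegrable (fun t => deriv φ t • x₀) volume a b :=
        (hφ'.smul continuous_const).intervalIntegrable _ _
      rw [hcong, intervalIntegral.integral_sub hi1 hi2, intervalIntegral.integral_smul_const, hφ0, zero_smul, sub_zero,
        intervalIntegral.integral_of_le hab.le, intervalIntegral.integral_of_le hab.le,
        integral_Ioc_eq_integral_Ioo, integral_Ioc_eq_integral_Ioo] at hpart
      have hint1 : Integrable (fun t => φ t • z n t) (volume.restrict (Ioo a b)) :=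
        integrable_bilin (ContinuousLinearMap.lsmul ℝ ℝ)
          (memLp_of_continuousOn hφ.continuous.continuousOn) (hz2 n)
      have hint2 : Integrable (fun t => deriv φ t • y n t) (volume.restrict (Ioo a b)) :=
        integrable_bilin (ContinuousLinearMap.lsmul ℝ ℝ)
          (memLp_of_continuousOn hφ'.continuousOn) (memLp_of_continuousOn (hyc n).continuousOn)
      have hjpart : ∫ t in Ioo a b, deriv φ t • j (y n t) =
          -∫ t in Ioo a b, φ t • j (z n t) := by
        have := congrArg j hpart
        rw [map_neg, ← j.integral_comp_comm hint1, ← j.integral_comp_comm hint2] at this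
        simpa only [map_smul] using this
      have hsplit : ∫ t in Ioo a b, deriv φ t • u t =
          (∫ t in Ioo a b, deriv φ t • j (y n t)) +
            (1 / ((n : ℝ) + 1)) • ∫ t in Ioo a b, deriv φ t • j (z n t) := by
        rw [← integral_smul, ← integral_add]
        · refine integral_congr_ae ?_
          filter_upwards [hUu] with t ht
          rw [← ht, hUyz n t, map_add, map_smul, smul_add, smul_comm]
        · exact integrable_bilin (ContinuousLinearMap.lsmul ℝ ℝ)
            (memLp_of_continuousOn hφ'.continuousOn)
            (memLp_of_continuousOn (j.continuous.comp (hyc n)).continuousOn)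
        · exact (integrable_bilin (ContinuousLinearMap.lsmul ℝ ℝ)
            (memLp_of_continuousOn hφ'.continuousOn) (hjz n)).smul (1 / ((n : ℝ) + 1))
      rw [hG, hpair (hjz n) φ hφ.continuous x, hpair (hjz n) _ hφ' x, hsplit, hjpart,
        inner_add_left, inner_neg_left, real_inner_smul_left]
      ring
    have h5 := tendsto_nhds_unique h1 (((h3.sub_const _).congr fun n => (h4 n).symm))
    have h6 := hpair (Lp.memLp g) φ hφ.continuous x (hmem φ hφ.continuous x)
    rw [Lp.toLp_coeFn] at h6
    rw [inner_neg_left, ← h6, h5]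
    ring
  have hgm := Lp.memLp g
  have hgi : IntegrableOn g (Ioo a b) := hgm.integrable (by norm_num)
  have hFTC : ∀ t ∈ Icc a b, u t - u a = ∫ r in a..t, g r := fun t ht =>
    hweak.sub_eq_integral hab hu hgi ht
  refine ⟨g, hgm, hweak, hFTC, ?_⟩
  have hJg : MemLp (fun t => dualMap j (g t)) 2 (volume.restrict (Ioo a b)) :=
    (dualMap j).comp_memLp' hgm
  -- Both functions have the same primitive, so they agree almost everywhere by Lebesgue
  -- differentiation.
  have hii : IntervalIntegrable (fun t => dU t - dualMap j (g t)) volume a b :=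
    intervalIntegrable_of_memLp hab.le (hdU.sub hJg) (right_mem_Icc.2 hab.le)
  have hz : ∀ t ∈ Icc a b, ∫ r in a..t, (dU r - dualMap j (g r)) = 0 := fun t ht => by
    rw [intervalIntegral.integral_sub (intervalIntegrable_of_memLp hab.le hdU ht)
        (intervalIntegrable_of_memLp hab.le hJg ht),
      (dualMap j).intervalIntegral_comp_comm (intervalIntegrable_of_memLp hab.le hgm ht), ← hFTC t ht, ← hd t ht,
      map_sub, sub_self]
  rw [ae_restrict_iff' measurableSet_Ioo]
  filter_upwards [hii.ae_hasDerivAt_integral] with t ht hmem'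
  have h1 := ht (by rw [uIcc_of_le hab.le]; exact Ioo_subset_Icc_self hmem') a left_mem_uIcc
  have h2 : (fun x => ∫ r in a..x, (dU r - dualMap j (g r))) =ᶠ[𝓝 t] fun _ => 0 := by
    filter_upwards [Ioo_mem_nhds hmem'.1 hmem'.2] with x hx using hz x (Ioo_subset_Icc_self hx)
  have h3 := (h1.congr_of_eventuallyEq h2.symm).unique (hasDerivAt_const t _)
  exact sub_eq_zero.1 h3

end EvolutionFamily

/-- The difference quotients of a Lipschitz family of quadratic forms along a continuous curve. -/
theorem tendsto_delay_quotient {a b Λ : ℝ} {N : ℝ → H →L[ℝ] H}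
    (hN : ∀ s ∈ Icc a b, ∀ t ∈ Icc a b, ‖N t - N s‖ ≤ Λ * |t - s|) {u : ℝ → H}
    (hu : ContinuousOn u (Icc a b)) {n : ℝ → ℝ}
    (hn : ∀ᵐ t ∂volume.restrict (Ioo a b),
      Tendsto (fun k => k⁻¹ * inner ℝ ((N t - N (t - k)) (u t)) (u t)) (𝓝[>] 0) (𝓝 (n t))) :
    (∀ k > 0, IntegrableOn (fun t =>
      inner ℝ ((N t - N (max a (t - k))) (u (max a (t - k)))) (u (max a (t - k)))) (Ioo a b)) ∧
    Tendsto (fun k => k⁻¹ * ∫ t in Ioo a b,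
      inner ℝ ((N t - N (max a (t - k))) (u (max a (t - k)))) (u (max a (t - k))))
      (𝓝[>] 0) (𝓝 (∫ t in Ioo a b, n t)) := by
  obtain ⟨K, hK⟩ := isCompact_Icc.exists_bound_of_continuousOn hu
  have hdel : ∀ k > (0 : ℝ), ∀ t ∈ Icc a b, max a (t - k) ∈ Icc a b := fun k hk t ht =>
    ⟨le_max_left _ _, max_le (ht.1.trans ht.2) (by linarith [ht.2])⟩
  have hNc : ContinuousOn N (Icc a b) := by
    have : LipschitzOnWith (Real.toNNReal Λ) N (Icc a b) :=
      LipschitzOnWith.of_dist_le_mul fun t ht s hs => by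
        rw [dist_eq_norm, Real.dist_eq]
        exact (hN s hs t ht).trans
          (mul_le_mul_of_nonneg_right (Real.le_coe_toNNReal Λ) (abs_nonneg _))
    exact this.continuousOn
  have hcont : ∀ k > 0, ContinuousOn (fun t =>
      inner ℝ ((N t - N (max a (t - k))) (u (max a (t - k)))) (u (max a (t - k)))) (Icc a b) := by
    intro k hk
    have hm : ContinuousOn (fun t => max a (t - k)) (Icc a b) := by fun_prop
    have hum := hu.comp hm (hdel k hk)
    exact ((hNc.sub (hNc.comp hm (hdel k hk))).clm_apply hum).inner hum
  have hbound : ∀ s ∈ Icc a b, ∀ t ∈ Icc a b, ∀ x y : H,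
      |inner ℝ ((N t - N s) x) y| ≤ Λ * |t - s| * ‖x‖ * ‖y‖ := fun s hs t ht x y =>
    (abs_real_inner_le_norm _ _).trans (mul_le_mul_of_nonneg_right
      ((N t - N s).le_of_opNorm_le (hN s hs t ht) x) (norm_nonneg _))
  refine ⟨fun k hk => (hcont k hk).integrableOn_Icc.mono_set Ioo_subset_Icc_self, ?_⟩
  simp only [← integral_const_mul]
  -- The actual delay is at most k, also where it is frozen at a, so the Lipschitz bound on N gives
  -- the majorant |Λ|K² with K a bound for ‖u‖.
  refine tendsto_integral_filter_of_dominated_convergence (fun _ => |Λ| * K * K) ?_ ?_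
    (integrable_const _) ?_
  · filter_upwards [self_mem_nhdsWithin] with k hk
    exact (((hcont k hk).mono Ioo_subset_Icc_self).aestronglyMeasurable
      measurableSet_Ioo).const_mul _
  · filter_upwards [self_mem_nhdsWithin] with k hk
    filter_upwards [ae_restrict_mem measurableSet_Ioo] with t ht
    have hti := Ioo_subset_Icc_self ht
    have hsi := hdel k hk t hti
    have hk0 : (0 : ℝ) < k := hk
    rw [Real.norm_eq_abs, abs_mul, abs_inv, abs_of_pos hk0, inv_mul_le_iff₀ hk0]
    refine (hbound _ hsi t hti _ _).trans ?_
    have h1 : |t - max a (t - k)| ≤ k := by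
      rw [abs_of_nonneg (sub_nonneg.2 (max_le ht.1.le (by linarith)))]
      linarith [le_max_right a (t - k)]
    have hK0 : 0 ≤ K := (norm_nonneg _).trans (hK t hti)
    calc Λ * |t - max a (t - k)| * ‖u (max a (t - k))‖ * ‖u (max a (t - k))‖
        ≤ |Λ| * k * K * K := by
          have h2 : Λ * |t - max a (t - k)| ≤ |Λ| * k :=
            mul_le_mul (le_abs_self _) h1 (abs_nonneg _) (abs_nonneg _)
          have h3 := hK _ hsi
          have h4 : 0 ≤ |Λ| * k := by positivity
          gcongr
      _ = k * (|Λ| * K * K) := by ring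
  · filter_upwards [hn, ae_restrict_mem measurableSet_Ioo] with t ht hmem
    have hti := Ioo_subset_Icc_self hmem
    have hev : ∀ᶠ k in 𝓝[>] (0 : ℝ), k ∈ Ioo 0 (t - a) :=
      Ioo_mem_nhdsGT (by linarith [hmem.1])
    have hut : Tendsto (fun k => u (t - k)) (𝓝[>] 0) (𝓝 (u t)) := by
      have h1 : Tendsto (fun k : ℝ => t - k) (𝓝[>] 0) (𝓝[Icc a b] t) := by
        refine tendsto_nhdsWithin_iff.2 ⟨?_, ?_⟩
        · have : Tendsto (fun k : ℝ => t - k) (𝓝 0) (𝓝 (t - 0)) := by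
            exact (continuous_const.sub continuous_id).tendsto 0
          rw [sub_zero] at this
          exact this.mono_left nhdsWithin_le_nhds
        · filter_upwards [hev] with k hk
          exact ⟨by linarith [hk.2], by linarith [hk.1, hmem.2]⟩
      exact (hu t hti).tendsto.comp h1
    have hdiff : Tendsto (fun k => |Λ| * ‖u (t - k) - u t‖ * (‖u (t - k)‖ + ‖u t‖))
        (𝓝[>] 0) (𝓝 0) := by
      have h1 : Tendsto (fun k => ‖u (t - k) - u t‖) (𝓝[>] 0) (𝓝 0) := by
        simpa using (hut.sub_const (u t)).norm
      simpa using (h1.const_mul |Λ|).mul (hut.norm.add_const ‖u t‖)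
    -- Replacing u(t-k) by u(t) costs at most a Lipschitz constant times ‖u(t-k) - u(t)‖, after the
    -- factor k of N t - N (t-k) has cancelled k⁻¹.
    have hsq : Tendsto (fun k => k⁻¹ * inner ℝ ((N t - N (t - k)) (u (t - k))) (u (t - k)) -
        k⁻¹ * inner ℝ ((N t - N (t - k)) (u t)) (u t)) (𝓝[>] 0) (𝓝 0) := by
      refine squeeze_zero_norm' ?_ hdiff
      filter_upwards [hev] with k hk
      have hs : t - k ∈ Icc a b := ⟨by linarith [hk.2], by linarith [hk.1, hmem.2]⟩
      have hk0 := hk.1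
      have e : inner ℝ ((N t - N (t - k)) (u (t - k))) (u (t - k)) -
          inner ℝ ((N t - N (t - k)) (u t)) (u t) =
          inner ℝ ((N t - N (t - k)) (u (t - k) - u t)) (u (t - k)) +
          inner ℝ ((N t - N (t - k)) (u t)) (u (t - k) - u t) := by
        rw [map_sub (N t - N (t - k)), inner_sub_left, inner_sub_right]
        ring
      rw [← mul_sub, e, Real.norm_eq_abs, abs_mul, abs_inv, abs_of_pos hk0, inv_mul_le_iff₀ hk0]
      have b1 := hbound _ hs t hti (u (t - k) - u t) (u (t - k))
      have b2 := hbound _ hs t hti (u t) (u (t - k) - u t)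
      rw [sub_sub_cancel, abs_of_pos hk0] at b1 b2
      have b3 := abs_add_le (inner ℝ ((N t - N (t - k)) (u (t - k) - u t)) (u (t - k)))
        (inner ℝ ((N t - N (t - k)) (u t)) (u (t - k) - u t))
      have b4 : Λ * (k * ‖u (t - k) - u t‖ * (‖u (t - k)‖ + ‖u t‖)) ≤
          |Λ| * (k * ‖u (t - k) - u t‖ * (‖u (t - k)‖ + ‖u t‖)) :=
        mul_le_mul_of_nonneg_right (le_abs_self _) (by positivity)
      calc _ ≤ _ := b3
        _ ≤ _ := add_le_add b1 b2
        _ = Λ * (k * ‖u (t - k) - u t‖ * (‖u (t - k)‖ + ‖u t‖)) := by ring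
        _ ≤ _ := b4
        _ = _ := by ring
    have := hsq.add ht
    rw [zero_add] at this
    refine this.congr' ?_
    filter_upwards [hev] with k hk
    rw [max_eq_right (by linarith [hk.2])]
    ring

/-- The energy estimate for a regular solution, with an additional Lipschitz family `N` of
quadratic forms on `H`. -/
theorem exists_energy_le {j : F →L[ℝ] H} {a b : ℝ} (hab : a < b) {α : ℝ → F →L[ℝ] F →L[ℝ] ℝ}
    (hαc : ContinuousOn α (Icc a b)) (hαs : ∀ t ∈ Icc a b, ∀ u v, α t u v = α t v u)
    (hαn : ∀ t ∈ Icc a b, ∀ u, 0 ≤ α t u u)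
    (hαa : ∀ s ∈ Icc a b, ∀ t ∈ Icc a b, s ≤ t → ∀ u, α t u u ≤ α s u u)
    {κ : ℝ} (hκ : 0 < κ) (hκα : ∀ w, κ * ‖w‖ ^ 2 ≤ α b w w + ‖j w‖ ^ 2)
    {Λ : ℝ} {N : ℝ → H →L[ℝ] H}
    (hN : ∀ s ∈ Icc a b, ∀ t ∈ Icc a b, ‖N t - N s‖ ≤ Λ * |t - s|)
    (hNs : ∀ t ∈ Icc a b, ∀ x y, inner ℝ (N t x) y = inner ℝ (N t y) x)
    (hNn : ∀ t ∈ Icc a b, ∀ x, 0 ≤ inner ℝ (N t x) x)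
    {u g : ℝ → H} (hg : MemLp g 2 (volume.restrict (Ioo a b)))
    (hu : ∀ t ∈ Icc a b, u t - u a = ∫ r in a..t, g r) (huc : ContinuousOn u (Icc a b))
    {x₀ : F} (hx₀ : j x₀ = u a) {U : ℝ → F} (hU : MemLp U 2 (volume.restrict (Ioo a b)))
    (hUu : ∀ᵐ t ∂volume.restrict (Ioo a b), j (U t) = u t)
    {G : ℝ → H} (hG : MemLp G 2 (volume.restrict (Ioo a b)))
    (hgen : ∀ᵐ t ∂volume.restrict (Ioo a b), ∀ w, α t (U t) w = -inner ℝ (G t) (j w))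
    {n : ℝ → ℝ} (hn : ∀ᵐ t ∂volume.restrict (Ioo a b),
      Tendsto (fun k => k⁻¹ * inner ℝ ((N t - N (t - k)) (u t)) (u t)) (𝓝[>] 0) (𝓝 (n t))) :
    ∃ x : F, j x = u b ∧ α b x x + inner ℝ (N b (u b)) (u b) ≤
      α a x₀ x₀ + inner ℝ (N a (u a)) (u a) +
        (∫ t in Ioo a b, inner ℝ (g t) ((2 : ℝ) • (N t (u t) - G t))) + ∫ t in Ioo a b, n t := by
  classical
  have hbI : b ∈ Icc a b := right_mem_Icc.2 hab.le
  have hNc : ContinuousOn N (Icc a b) := by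
    have : LipschitzOnWith (Real.toNNReal Λ) N (Icc a b) :=
      LipschitzOnWith.of_dist_le_mul fun t ht s hs => by
        rw [dist_eq_norm, Real.dist_eq]
        exact (hN s hs t ht).trans
          (mul_le_mul_of_nonneg_right (Real.le_coe_toNNReal Λ) (abs_nonneg _))
    exact this.continuousOn
  have hNu : ContinuousOn (fun t => N t (u t)) (Icc a b) := hNc.clm_apply huc
  have hNuu : ContinuousOn (fun t => inner ℝ (N t (u t)) (u t)) (Icc a b) := hNu.inner huc
  -- U is determined only for almost every t, so its value at the initial time may be prescribed.
  -- With x₀ there, the chain of increments starts from α_a(x₀,x₀).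
  set Û : ℝ → F := fun t => if t = a then x₀ else U t with hÛ
  have hÛa : Û a = x₀ := by simp [hÛ]
  have hÛt : ∀ t, a < t → Û t = U t := fun t ht => by simp [hÛ, ht.ne']
  set q : ℝ → ℝ := fun t => α t (Û t) (Û t) + inner ℝ (N t (u t)) (u t) with hq
  set S : Set ℝ := {t | j (U t) = u t ∧ ∀ w, α t (U t) w = -inner ℝ (G t) (j w)} with hS
  have hSae : ∀ᵐ t ∂volume.restrict (Ioo a b), t ∈ S := by
    filter_upwards [hUu, hgen] with t h1 h2 using ⟨h1, h2⟩
  have hqi : IntegrableOn q (Ioo a b) := by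
    have h1 : Integrable (fun t => α t (U t) (U t)) (volume.restrict (Ioo a b)) :=
      integrable_bilin (ContinuousLinearMap.id ℝ (StrongDual ℝ F)) (memLp_clm_apply hαc hU) hU
    have h2 : IntegrableOn (fun t => inner ℝ (N t (u t)) (u t)) (Ioo a b) :=
      hNuu.integrableOn_Icc.mono_set Ioo_subset_Icc_self
    refine (h1.add h2).congr ?_
    filter_upwards [ae_restrict_mem measurableSet_Ioo] with t ht
    simp only [hq, hÛt t ht.1, Pi.add_apply]
  have hl : MemLp (fun t => (2 : ℝ) • (N t (u t) - G t)) 2 (volume.restrict (Ioo a b)) :=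
    ((memLp_of_continuousOn hNu).sub hG).const_smul (2 : ℝ)
  obtain ⟨hCi, hC⟩ := tendsto_delay_quotient hN huc hn
  set c₀ : ℝ := q a + (∫ t in Ioo a b, inner ℝ (g t) ((2 : ℝ) • (N t (u t) - G t))) +
    ∫ t in Ioo a b, n t with hc₀
  have hchain : ∀ ε > (0 : ℝ), ∃ t ∈ S, t ∈ Ioo a b ∧ b - ε < t ∧ q t ≤ c₀ + ε := fun ε hε =>
    exists_le_add_integral (innerSL ℝ) hab hSae hqi hg hl
      (C := fun t s => inner ℝ ((N t - N s) (u s)) (u s)) hCi hC (fun t htS ht s hs hst => by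
      have hti := Ioo_subset_Icc_self ht
      have has : a ≤ s := hs.elim (fun h => h.ge) fun h => h.2.le
      have hsi : s ∈ Icc a b := ⟨has, (hst.trans ht.2).le⟩
      have hjs : j (Û s) = u s := by
        rcases hs with rfl | hs
        · rw [hÛa, hx₀]
        · rw [hÛt s hs.2, hs.1.1]
      -- The generator identity at t turns 2α_t(U_t, U_t - Û_s) into -2⟨G_t, u_t - u_s⟩, so only
      -- increments of u in H remain, which are integrals of g. The change of N between s and t is
      -- left in the error term C.
      have h1 := sub_le_two_mul_of_anti (hαs t hti) (hαn t hti) (U t) (Û s)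
        (hαa s hsi t hti hst.le (Û s))
      have h2 := sub_le_two_mul_of_anti (β := innerSL ℝ ∘L N t) (γ := innerSL ℝ ∘L N t)
        (hNs t hti) (hNn t hti) (u t) (u s) le_rfl
      have h3 : u t - u s = ∫ r in s..t, g r := by
        rw [← intervalIntegral.integral_interval_sub_left (intervalIntegrable_of_memLp hab.le hg hti)
          (intervalIntegrable_of_memLp hab.le hg hsi), ← hu t hti, ← hu s hsi]
        abel
      have h4 : ∫ r in s..t, innerSL ℝ (g r) ((2 : ℝ) • (N t (u t) - G t)) =
          inner ℝ (∫ r in s..t, g r) ((2 : ℝ) • (N t (u t) - G t)) :=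
        ContinuousLinearMap.intervalIntegral_comp_comm
          ((innerSL ℝ).flip ((2 : ℝ) • (N t (u t) - G t)))
          ((intervalIntegrable_of_memLp hab.le hg hsi).symm.trans
            (intervalIntegrable_of_memLp hab.le hg hti))
      have h0 := htS.2 (U t)
      rw [htS.1] at h0
      rw [map_sub, htS.2 (Û s), hjs] at h1
      change inner ℝ (N t (u t)) (u t) - inner ℝ (N t (u s)) (u s) ≤
        2 * inner ℝ (N t (u t)) (u t - u s) at h2
      rw [h4, ← h3, inner_smul_right, inner_sub_right, real_inner_comm (N t (u t)),
        real_inner_comm (G t)]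
      simp only [hq, hÛt t ht.1, _root_.sub_apply]
      rw [inner_sub_left (N t (u s)), inner_sub_right (G t)]
      linarith) hε hε
  have hε0 : ∀ m : ℕ, (0 : ℝ) < 1 / ((m : ℝ) + 1) := fun m => Nat.one_div_pos_of_nat
  choose τ hτS hτI hτb hτq using fun m : ℕ => hchain _ (hε0 m)
  have hlimτ : Tendsto τ atTop (𝓝[Icc a b] b) := by
    refine tendsto_nhdsWithin_iff.2 ⟨?_, Eventually.of_forall fun m => Ioo_subset_Icc_self (hτI m)⟩
    have h1 : Tendsto (fun m : ℕ => b - 1 / ((m : ℝ) + 1)) atTop (𝓝 (b - 0)) :=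
      tendsto_one_div_add_atTop_nhds_zero_nat.const_sub b
    rw [sub_zero] at h1
    exact tendsto_of_tendsto_of_tendsto_of_le_of_le h1 tendsto_const_nhds
      (fun m => (hτb m).le) fun m => (hτI m).2.le
  have hju : Tendsto (fun m => j (U (τ m))) atTop (𝓝 (u b)) := by
    refine ((huc b hbI).tendsto.comp hlimτ).congr fun m => ?_
    exact (hτS m).1.symm
  have he : Tendsto (fun m : ℕ => c₀ + 1 / ((m : ℝ) + 1) -
      inner ℝ (N (τ m) (u (τ m))) (u (τ m))) atTop (𝓝 (c₀ - inner ℝ (N b (u b)) (u b))) := by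
    have h1 : Tendsto (fun m : ℕ => c₀ + 1 / ((m : ℝ) + 1)) atTop (𝓝 (c₀ + 0)) :=
      tendsto_one_div_add_atTop_nhds_zero_nat.const_add c₀
    rw [add_zero] at h1
    exact h1.sub ((hNuu b hbI).tendsto.comp hlimτ)
  -- Monotonicity transfers the bound at τ_m to the fixed form α_b. Coercivity of α_b then bounds
  -- U(τ_m) in F, as required for a weak limit.
  have hle : ∀ m, α b (U (τ m)) (U (τ m)) ≤ c₀ + 1 / ((m : ℝ) + 1) -
      inner ℝ (N (τ m) (u (τ m))) (u (τ m)) := fun m => by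
    have h1 := hαa _ (Ioo_subset_Icc_self (hτI m)) b hbI (hτI m).2.le (U (τ m))
    have h2 := hτq m
    simp only [hq, hÛt _ (hτI m).1] at h2
    linarith
  obtain ⟨C₁, hC₁⟩ := he.bddAbove_range
  obtain ⟨C₂, hC₂⟩ := isCompact_Icc.exists_bound_of_continuousOn huc
  have hbdd : ∀ m, ‖U (τ m)‖ ≤ √((C₁ + C₂ ^ 2) / κ) := fun m => by
    refine Real.le_sqrt_of_sq_le ?_
    rw [le_div_iff₀ hκ, mul_comm]
    refine (hκα _).trans (add_le_add ((hle m).trans (hC₁ ⟨m, rfl⟩)) ?_)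
    rw [(hτS m).1]
    exact pow_le_pow_left₀ (norm_nonneg _) (hC₂ _ (Ioo_subset_Icc_self (hτI m))) 2
  obtain ⟨x, hx, hxle⟩ := exists_form_le_of_tendsto j (α b) (hαs b hbI) (hαn b hbI) hbdd hju he hle
  refine ⟨x, hx, ?_⟩
  have hqa : q a = α a x₀ x₀ + inner ℝ (N a (u a)) (u a) := by simp only [hq, hÛa]
  rw [← hqa]
  linarith

end Evolution

/-! ### Multiplication operators on L². -/

section MulL2

variable {X : Type*} [MeasurableSpace X] {m : Measure X}

theorem norm_sq_eq_integral (f : Lp ℝ 2 m) : ‖f‖ ^ 2 = ∫ x, f x ^ 2 ∂m := by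
  rw [← real_inner_self_eq_norm_sq, L2.inner_def]
  refine integral_congr_ae (Eventually.of_forall fun x => ?_)
  simp only [real_inner_self_eq_norm_sq, Real.norm_eq_abs, sq_abs]

open Classical in
/-- Multiplication by an essentially bounded function on `L²` (and `0` for other functions). -/
def mulL2 (m : Measure X) (ρ : X → ℝ) : Lp ℝ 2 m →L[ℝ] Lp ℝ 2 m :=
  if h : MemLp ρ ⊤ m then (ContinuousLinearMap.mul ℝ ℝ).holderL m ⊤ 2 2 (h.toLp ρ) else 0

theorem coeFn_mulL2 {ρ : X → ℝ} (h : MemLp ρ ⊤ m) (f : Lp ℝ 2 m) :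
    mulL2 m ρ f =ᵐ[m] fun x => ρ x * f x := by
  rw [mulL2, dif_pos h]
  filter_upwards [(ContinuousLinearMap.mul ℝ ℝ).coeFn_holder (r := 2) (h.toLp ρ) f,
    h.coeFn_toLp] with x h1 h2
  rw [← h2]
  exact h1

theorem norm_mulL2_apply_le {ρ : X → ℝ} (h : MemLp ρ ⊤ m) {C : ℝ} (hC : ∀ᵐ x ∂m, |ρ x| ≤ C)
    (f : Lp ℝ 2 m) : ‖mulL2 m ρ f‖ ≤ C * ‖f‖ := by
  refine Lp.norm_le_mul_norm_of_ae_le_mul ?_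
  filter_upwards [coeFn_mulL2 h f, hC] with x h1 h2
  rw [h1, norm_mul, Real.norm_eq_abs]
  exact mul_le_mul_of_nonneg_right h2 (norm_nonneg _)

theorem mulL2_sub {ρ σ : X → ℝ} (h : MemLp ρ ⊤ m) (h' : MemLp σ ⊤ m) :
    mulL2 m ρ - mulL2 m σ = mulL2 m (ρ - σ) := by
  ext1 f
  refine Lp.ext ?_
  rw [_root_.sub_apply]
  filter_upwards [Lp.coeFn_sub (mulL2 m ρ f) (mulL2 m σ f), coeFn_mulL2 h f, coeFn_mulL2 h' f,
    coeFn_mulL2 (h.sub h') f] with x h1 h2 h3 h4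
  rw [h1, h4, Pi.sub_apply, Pi.sub_apply, h2, h3]
  ring

theorem inner_mulL2 {ρ : X → ℝ} (h : MemLp ρ ⊤ m) (f g : Lp ℝ 2 m) :
    inner ℝ (mulL2 m ρ f) g = ∫ x, ρ x * f x * g x ∂m := by
  rw [L2.inner_def]
  refine integral_congr_ae ?_
  filter_upwards [coeFn_mulL2 h f] with x h1
  rw [h1]
  simp [mul_comm]

theorem integrable_mul_L2 {ρ : X → ℝ} (h : MemLp ρ ⊤ m) (f g : Lp ℝ 2 m) :
    Integrable (fun x => ρ x * f x * g x) m := by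
  have h1 : Integrable (fun x => f x * g x) m :=
    integrable_bilin (ContinuousLinearMap.mul ℝ ℝ) (Lp.memLp f) (Lp.memLp g)
  have h2 := memLp_one_iff_integrable.1
    ((ContinuousLinearMap.mul ℝ ℝ).memLp_of_bilin 1 h (memLp_one_iff_integrable.2 h1))
  refine h2.congr (Eventually.of_forall fun x => ?_)
  simp [mul_assoc]

end MulL2

/-! ### The form domain: completeness, separability, and the algebra of bounded elements. -/

namespace DirichletForm

variable {X : Type*} [MeasurableSpace X] {m : Measure X} (E : DirichletForm m)

theorem norm_sq_eq (u : E.Dom) : ‖u‖ ^ 2 = E.bilin u u + ‖E.toL2 u‖ ^ 2 := by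
  rw [← real_inner_self_eq_norm_sq, E.inner_def, real_inner_self_eq_norm_sq]
  rfl

theorem bilin_nonneg (u : E.Dom) : 0 ≤ E.bilin u u := E.nonneg u

theorem toL2_injective : Function.Injective E.toL2 := fun _ _ h => Subtype.ext h

theorem denseRange_toL2 : DenseRange E.toL2 := by
  have h : range E.toL2 = (E.domain : Set (Lp ℝ 2 m)) := by
    ext x
    exact ⟨fun ⟨u, hu⟩ => hu ▸ Subtype.property (p := (· ∈ E.domain)) u, fun hx => ⟨⟨x, hx⟩, rfl⟩⟩
  rw [DenseRange, h]
  exact E.dense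

instance : CompleteSpace E.Dom := by
  refine UniformSpace.complete_of_cauchySeq_tendsto fun u hu => ?_
  obtain ⟨v, hv⟩ := E.closed u fun ε hε => by
    obtain ⟨N, hN⟩ := Metric.cauchySeq_iff.1 hu (√ε) (Real.sqrt_pos.2 hε)
    refine ⟨N, fun i hi k hk => ?_⟩
    have h1 := hN i hi k hk
    rw [dist_eq_norm] at h1
    have h2 : ‖u i - u k‖ ^ 2 < ε := by
      have := pow_lt_pow_left₀ h1 (norm_nonneg _) two_ne_zero
      rwa [Real.sq_sqrt hε.le] at this
    rw [E.norm_sq_eq] at h2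
    exact h2
  refine ⟨v, tendsto_iff_norm_sub_tendsto_zero.2 ?_⟩
  have h3 : Tendsto (fun n => ‖u n - (show E.Dom from v)‖ ^ 2) atTop (𝓝 0) := by
    refine hv.congr fun n => ?_
    rw [E.norm_sq_eq]
    rfl
  have h4 := h3.sqrt
  simpa only [Real.sqrt_sq (norm_nonneg _), Real.sqrt_zero] using h4

/-- The adjoint of an injective operator has dense range, so F inherits separability from L². -/
theorem secondCountable_dom [SecondCountableTopology (Lp ℝ 2 m)] :
    SecondCountableTopology E.Dom := by
  have h : DenseRange (ContinuousLinearMap.adjoint E.toL2) := by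
    have h1 : (ContinuousLinearMap.adjoint E.toL2).range.topologicalClosure = ⊤ := by
      rw [Submodule.topologicalClosure_eq_top_iff, ContinuousLinearMap.orthogonal_range,
        ContinuousLinearMap.adjoint_adjoint]
      exact LinearMap.ker_eq_bot.2 E.toL2_injective
    rw [DenseRange, dense_iff_closure_eq]
    exact congrArg (fun S : Submodule ℝ E.Dom => (S : Set E.Dom)) h1
  have : TopologicalSpace.SeparableSpace E.Dom := h.separableSpace (map_continuous _)
  exact UniformSpace.secondCountable_of_separable _

/-- The Markov property for Lipschitz maps on the range of a bounded element. -/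
theorem exists_comp {u : E.Dom} {c K : ℝ} (hu : ∀ᵐ x ∂m, |E.toL2 u x| ≤ c) {ξ : ℝ → ℝ}
    (hξ : ∀ x y, |x| ≤ c → |y| ≤ c → |ξ x - ξ y| ≤ K * |x - y|) (h0 : ξ 0 = 0) :
    ∃ w : E.Dom, ∀ᵐ x ∂m, E.toL2 w x = ξ (E.toL2 u x) := by
  rcases lt_or_ge c 0 with hc | hc
  · refine ⟨0, ?_⟩
    filter_upwards [hu] with x hx
    exact absurd ((abs_nonneg _).trans hx) (not_le.2 hc)
  -- Clipping to [-c, c] does not change ξ on the range of u and makes it globally Lipschitz;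
  -- dividing by κ makes it 1-Lipschitz. The maximum with 1 keeps κ positive whatever K is.
  set κ : ℝ := max K 1 with hκ
  have hκ0 : 0 < κ := lt_max_of_lt_right one_pos
  set cl : ℝ → ℝ := fun x => max (-c) (min c x) with hcl
  have hcl1 : ∀ x, |cl x| ≤ c := fun x => abs_le.2
    ⟨le_max_left _ _, max_le (by linarith) (min_le_left _ _)⟩
  have hcl2 : ∀ x y, |cl x - cl y| ≤ |x - y| := fun x y =>
    (abs_max_sub_max_le_max _ _ _ _).trans (max_le (by simp)
      ((abs_min_sub_min_le_max _ _ _ _).trans (max_le (by simp) le_rfl)))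
  have hcl3 : ∀ x, |x| ≤ c → cl x = x := fun x hx => by
    rw [abs_le] at hx
    simp only [hcl, min_eq_right hx.2, max_eq_right hx.1]
  have hlip : LipschitzWith 1 fun x => κ⁻¹ * ξ (cl x) := LipschitzWith.of_dist_le_mul fun x y => by
    rw [Real.dist_eq, Real.dist_eq, ← mul_sub, abs_mul, abs_inv, abs_of_pos hκ0,
      inv_mul_le_iff₀ hκ0, NNReal.coe_one, one_mul]
    exact (hξ _ _ (hcl1 x) (hcl1 y)).trans (mul_le_mul (le_max_left _ _) (hcl2 x y)
      (abs_nonneg _) hκ0.le)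
  obtain ⟨w, hw, -⟩ := E.markov _ hlip (by simp [hcl3 0 (by simpa using hc), h0]) u
  refine ⟨κ • (show E.Dom from w), ?_⟩
  rw [map_smul]
  filter_upwards [hw, hu, Lp.coeFn_smul κ (E.toL2 (show E.Dom from w))] with x h1 h2 h3
  rw [h3, Pi.smul_apply, smul_eq_mul]
  change κ * (w : Lp ℝ 2 m) x = _
  rw [h1]
  change κ * (κ⁻¹ * ξ (cl (E.toL2 u x))) = _
  rw [hcl3 _ h2, mul_inv_cancel_left₀ hκ0.ne']

theorem exists_sq {u : E.Dom} (hu : E.IsBdd u) :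
    ∃ w : E.Dom, ∀ᵐ x ∂m, E.toL2 w x = E.toL2 u x ^ 2 := by
  obtain ⟨c, hc⟩ := hu
  refine E.exists_comp (K := 2 * c) hc (ξ := fun x => x ^ 2) (fun x y hx hy => ?_) (by simp)
  rw [show x ^ 2 - y ^ 2 = (x + y) * (x - y) by ring, abs_mul]
  refine mul_le_mul_of_nonneg_right ((abs_add_le x y).trans (by linarith)) (abs_nonneg _)

theorem isBdd_add {u v : E.Dom} (hu : E.IsBdd u) (hv : E.IsBdd v) : E.IsBdd (u + v) := by
  obtain ⟨c, hc⟩ := hu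
  obtain ⟨d, hd⟩ := hv
  refine ⟨c + d, ?_⟩
  rw [map_add]
  filter_upwards [hc, hd, Lp.coeFn_add (E.toL2 u) (E.toL2 v)] with x h1 h2 h3
  rw [h3, Pi.add_apply]
  exact (abs_add_le _ _).trans (add_le_add h1 h2)

/-- `F ∩ L^∞` is an algebra. -/
theorem exists_mul {u v : E.Dom} (hu : E.IsBdd u) (hv : E.IsBdd v) :
    ∃ w : E.Dom, ∀ᵐ x ∂m, E.toL2 w x = E.toL2 u x * E.toL2 v x := by
  obtain ⟨p, hp⟩ := E.exists_sq (E.isBdd_add hu hv)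
  obtain ⟨q, hq⟩ := E.exists_sq hu
  obtain ⟨r, hr⟩ := E.exists_sq hv
  refine ⟨(1 / 2 : ℝ) • (p - (q + r)), ?_⟩
  rw [map_add] at hp
  rw [map_smul, map_sub, map_add]
  filter_upwards [hp, hq, hr, Lp.coeFn_add (E.toL2 u) (E.toL2 v),
    Lp.coeFn_smul (1 / 2 : ℝ) (E.toL2 p - (E.toL2 q + E.toL2 r)),
    Lp.coeFn_sub (E.toL2 p) (E.toL2 q + E.toL2 r), Lp.coeFn_add (E.toL2 q) (E.toL2 r)]
    with x h1 h2 h3 h4 h5 h6 h7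
  rw [h5, Pi.smul_apply, h6, Pi.sub_apply, h7, Pi.add_apply, h1, h2, h3, h4, Pi.add_apply,
    smul_eq_mul]
  ring

/-- When m is infinite, e^{-φ} need not even lie in L². But e^{-x} - 1 vanishes at 0 and is
Lipschitz on bounded sets, so e^{-φ} - 1 is in F, and u e^{-φ} = u + u(e^{-φ} - 1). -/
theorem exists_mul_exp {u φ : E.Dom} (hu : E.IsBdd u) (hφ : E.IsBdd φ) :
    ∃ w : E.Dom, ∀ᵐ x ∂m, E.toL2 w x = E.toL2 u x * Real.exp (-E.toL2 φ x) := by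
  obtain ⟨c, hc⟩ := hφ
  obtain ⟨γ, hγ⟩ := E.exists_comp (K := Real.exp c) hc (ξ := fun x => Real.exp (-x) - 1)
    (fun x y hx hy => by
      have hd : ∀ z ∈ Icc (-c) c, HasDerivWithinAt (fun x => Real.exp (-x) - 1)
          (Real.exp (-z) * -1) (Icc (-c) c) z := fun z _ =>
        (((hasDerivAt_id z).neg.exp).sub_const 1).hasDerivWithinAt
      have := (convex_Icc (-c) c).norm_image_sub_le_of_norm_hasDerivWithin_le
        (C := Real.exp c) hd (fun z hz => by
          rw [mul_neg, mul_one, norm_neg, Real.norm_eq_abs, abs_of_pos (Real.exp_pos _)]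
          exact Real.exp_le_exp.2 (by linarith [hz.1])) (abs_le.1 hy) (abs_le.1 hx)
      simpa only [Real.norm_eq_abs] using this) (by simp)
  have hγb : E.IsBdd γ := by
    refine ⟨Real.exp c + 1, ?_⟩
    filter_upwards [hγ, hc] with x h1 h2
    rw [h1, abs_le]
    have h3 : Real.exp (-E.toL2 φ x) ≤ Real.exp c :=
      Real.exp_le_exp.2 (by linarith [(abs_le.1 h2).1])
    have h4 := Real.exp_pos (-E.toL2 φ x)
    have h5 := Real.exp_pos c
    constructor <;> linarith
  obtain ⟨w, hw⟩ := E.exists_mul hu hγb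
  refine ⟨u + w, ?_⟩
  rw [map_add]
  filter_upwards [hw, hγ, Lp.coeFn_add (E.toL2 u) (E.toL2 w)] with x h1 h2 h3
  rw [h3, Pi.add_apply, h1, h2]
  ring

/-- Truncations of an element of `F`. -/
theorem exists_truncation (w : E.Dom) : ∃ g : ℕ → E.Dom, (∀ n, E.IsBdd (g n)) ∧
    (∀ n, ‖g n‖ ≤ ‖w‖) ∧ Tendsto (fun n => E.toL2 (g n)) atTop (𝓝 (E.toL2 w)) := by
  set cl : ℕ → ℝ → ℝ := fun n x => max (-(n : ℝ)) (min n x) with hcl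
  have hcl2 : ∀ n x y, |cl n x - cl n y| ≤ |x - y| := fun n x y =>
    (abs_max_sub_max_le_max _ _ _ _).trans (max_le (by simp)
      ((abs_min_sub_min_le_max _ _ _ _).trans (max_le (by simp) le_rfl)))
  have hcl0 : ∀ n, cl n 0 = 0 := fun n => by simp [hcl]
  have hclle : ∀ n x, |cl n x| ≤ |x| := fun n x => by
    have := hcl2 n x 0
    rwa [hcl0, sub_zero, sub_zero] at this
  have hcl3 : ∀ (n : ℕ) x, |x| ≤ (n : ℝ) → cl n x = x := fun n x hx => by
    rw [abs_le] at hx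
    simp only [hcl, min_eq_right hx.2, max_eq_right hx.1]
  have hM : ∀ n, ∃ g : E.Dom, (∀ᵐ x ∂m, E.toL2 g x = cl n (E.toL2 w x)) ∧
      E.bilin g g ≤ E.bilin w w := fun n => E.markov (cl n) (LipschitzWith.of_dist_le_mul fun x y => by
    rw [Real.dist_eq, Real.dist_eq, NNReal.coe_one, one_mul]
    exact hcl2 n x y) (hcl0 n) w
  choose g hg' hgle using hM
  refine ⟨g, fun n => ⟨n, ?_⟩, fun n => ?_, ?_⟩
  · filter_upwards [hg' n] with x hx
    rw [hx, abs_le]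
    exact ⟨le_max_left _ _, max_le (by linarith [Nat.cast_nonneg (α := ℝ) n]) (min_le_left _ _)⟩
  · refine le_of_sq_le_sq ?_ (norm_nonneg _)
    rw [E.norm_sq_eq, E.norm_sq_eq]
    refine add_le_add (hgle n) (pow_le_pow_left₀ (norm_nonneg _) (Lp.norm_le_norm_of_ae_le ?_) 2)
    filter_upwards [hg' n] with x hx
    rw [hx, Real.norm_eq_abs, Real.norm_eq_abs]
    exact hclle n _
  · rw [tendsto_iff_norm_sub_tendsto_zero]
    have h1 : Tendsto (fun n => ‖E.toL2 (g n) - E.toL2 w‖ ^ 2) atTop (𝓝 0) := by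
      have h2 : ∀ n, ‖E.toL2 (g n) - E.toL2 w‖ ^ 2 =
          ∫ x, (cl n (E.toL2 w x) - E.toL2 w x) ^ 2 ∂m := fun n => by
        rw [norm_sq_eq_integral]
        refine integral_congr_ae ?_
        filter_upwards [hg' n, Lp.coeFn_sub (E.toL2 (g n)) (E.toL2 w)]
          with x h3 h4
        rw [h4, Pi.sub_apply, h3]
      simp only [h2]
      have hsq : Integrable (fun x => (2 * |E.toL2 w x|) ^ 2) m := by
        have := ((Lp.memLp (E.toL2 w)).integrable_sq).const_mul 4
        refine this.congr (Eventually.of_forall fun x => ?_)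
        simp only [mul_pow, sq_abs]
        norm_num
      rw [show (0 : ℝ) = ∫ _, (0 : ℝ) ∂m by simp]
      refine tendsto_integral_of_dominated_convergence _ (fun n => ?_) hsq (fun n => ?_) ?_
      · have hclm : Measurable (cl n) := by fun_prop
        exact (((hclm.comp_aemeasurable (Lp.aestronglyMeasurable _).aemeasurable).sub
          (Lp.aestronglyMeasurable _).aemeasurable).pow_const 2).aestronglyMeasurable
      · refine Eventually.of_forall fun x => ?_
        rw [norm_pow, Real.norm_eq_abs]
        refine pow_le_pow_left₀ (abs_nonneg _) ?_ 2
        exact (abs_sub _ _).trans (by linarith [hclle n (E.toL2 w x)])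
      · refine Eventually.of_forall fun x => ?_
        refine tendsto_const_nhds.congr' ?_
        filter_upwards [eventually_ge_atTop ⌈|E.toL2 w x|⌉₊] with n hn
        rw [hcl3 n _ ((Nat.le_ceil _).trans (Nat.cast_le.2 hn)), sub_self, zero_pow two_ne_zero]
    have h5 := h1.sqrt
    simpa only [Real.sqrt_sq (norm_nonneg _), Real.sqrt_zero] using h5

end DirichletForm

/-! ### Control of symmetric forms by their diagonal, and Gronwall's inequality. -/

/-- Continuous bilinear forms on a normed space. -/
abbrev ContinuousForm (V : Type*) [NormedAddCommGroup V] [NormedSpace ℝ V] : Type _ :=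
  V →L[ℝ] V →L[ℝ] ℝ

/-- Polarisation gives the bound K/2 (‖u‖² + ‖v‖²). Applying it to ‖v‖u and ‖u‖v, which have equal
norms, turns the sum into a product. -/
theorem abs_apply_le_of_diag {V : Type*} [NormedAddCommGroup V] [NormedSpace ℝ V]
    {B : V →ₗ[ℝ] V →ₗ[ℝ] ℝ} (hs : ∀ u v, B u v = B v u) {K : ℝ}
    (hK : ∀ u, |B u u| ≤ K * ‖u‖ ^ 2)
    (hpar : ∀ u v : V, ‖u + v‖ ^ 2 + ‖u - v‖ ^ 2 = 2 * (‖u‖ ^ 2 + ‖v‖ ^ 2)) (u v : V) :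
    |B u v| ≤ K * ‖u‖ * ‖v‖ := by
  have h1 : ∀ u v : V, |B u v| ≤ K / 2 * (‖u‖ ^ 2 + ‖v‖ ^ 2) := fun u v => by
    have e : 4 * B u v = B (u + v) (u + v) - B (u - v) (u - v) := by
      simp only [map_add, map_sub, LinearMap.add_apply, LinearMap.sub_apply, hs v u]
      ring
    have h2 := abs_sub (B (u + v) (u + v)) (B (u - v) (u - v))
    rw [← e, abs_mul, abs_of_pos (by norm_num : (0 : ℝ) < 4)] at h2
    have h3 : K * (‖u + v‖ ^ 2 + ‖u - v‖ ^ 2) = K * (2 * (‖u‖ ^ 2 + ‖v‖ ^ 2)) := by rw [hpar]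
    linarith [hK (u + v), hK (u - v)]
  rcases eq_or_ne u 0 with rfl | hu
  · simp
  rcases eq_or_ne v 0 with rfl | hv
  · simp
  have h2 := h1 (‖v‖ • u) (‖u‖ • v)
  have hp : 0 < ‖u‖ * ‖v‖ := mul_pos (norm_pos_iff.2 hu) (norm_pos_iff.2 hv)
  simp only [map_smul, LinearMap.smul_apply, smul_eq_mul, norm_smul, norm_norm, abs_mul,
    abs_norm] at h2
  refine le_of_mul_le_mul_left ?_ hp
  calc ‖u‖ * ‖v‖ * |B u v| = ‖u‖ * (‖v‖ * |B u v|) := by ring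
    _ ≤ K / 2 * ((‖v‖ * ‖u‖) ^ 2 + (‖u‖ * ‖v‖) ^ 2) := h2
    _ = ‖u‖ * ‖v‖ * (K * ‖u‖ * ‖v‖) := by ring

theorem ContinuousForm.norm_sub_le {V : Type*} [NormedAddCommGroup V] [InnerProductSpace ℝ V]
    {A B : ContinuousForm V} (hA : ∀ u v, A u v = A v u) (hB : ∀ u v, B u v = B v u) {K : ℝ}
    (hK0 : 0 ≤ K) (hK : ∀ u, |A u u - B u u| ≤ K * ‖u‖ ^ 2) : ‖A - B‖ ≤ K := by
  refine ContinuousLinearMap.opNorm_le_bound₂ _ hK0 fun u v => ?_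
  refine abs_apply_le_of_diag (B := (A - B).toLinearMap₁₂) (fun u v => ?_) hK (fun u v => ?_) u v
  · change A u v - B u v = A v u - B v u
    rw [hA, hB]
  · have := parallelogram_law_with_norm ℝ u v
    linarith

/-- Using the comparison in both directions, the diagonal of A_t - A_s is at most (e^{κ|t-s|} -
1)c‖u‖², and the diagonal controls the operator norm. -/
theorem ContinuousForm.continuousOn_of_le_exp {V : Type*} [NormedAddCommGroup V]
    [InnerProductSpace ℝ V] {A : ℝ → ContinuousForm V} {S : Set ℝ} {κ c : ℝ} (hκ : 0 ≤ κ)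
    (hc : 0 ≤ c) (hs : ∀ t ∈ S, ∀ u v, A t u v = A t v u)
    (hA : ∀ s ∈ S, ∀ t ∈ S, ∀ u, A t u u ≤ Real.exp (κ * |t - s|) * A s u u)
    (hb : ∀ t ∈ S, ∀ u, A t u u ≤ c * ‖u‖ ^ 2) : ContinuousOn A S := by
  have hone : ∀ s t : ℝ, 0 ≤ Real.exp (κ * |t - s|) - 1 := fun s t =>
    sub_nonneg.2 (Real.one_le_exp (by positivity))
  intro s hsS
  refine (tendsto_iff_norm_sub_tendsto_zero (E := ContinuousForm V)).2 ?_
  have hlim : Tendsto (fun t => (Real.exp (κ * |t - s|) - 1) * c) (𝓝[S] s) (𝓝 0) := by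
    have h1 : Continuous fun t => (Real.exp (κ * |t - s|) - 1) * c := by fun_prop
    have h2 := (h1.tendsto s).mono_left (nhdsWithin_le_nhds (s := S))
    simpa using h2
  refine squeeze_zero' (Eventually.of_forall fun t => norm_nonneg (A t - A s)) ?_ hlim
  filter_upwards [self_mem_nhdsWithin] with t ht
  refine ContinuousForm.norm_sub_le (hs t ht) (hs s hsS) (mul_nonneg (hone s t) hc) fun u => ?_
  have h1 := hA s hsS t ht u
  have h2 := hA t ht s hsS u
  rw [abs_sub_comm s t] at h2
  have h3 := mul_le_mul_of_nonneg_left (hb s hsS u) (hone s t)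
  have h4 := mul_le_mul_of_nonneg_left (hb t ht u) (hone s t)
  rw [abs_le]
  constructor <;> linarith

/-- Gronwall's inequality: the hypothesis says exactly that e^{-κr}(G s + κ∫_s^r G) is nonincreasing
in r. -/
theorem le_exp_mul_of_sub_le_integral {G : ℝ → ℝ} {κ s t : ℝ} (hκ : 0 ≤ κ) (hst : s ≤ t)
    (hG : ContinuousOn G (Icc s t))
    (h : ∀ r ∈ Icc s t, G r - G s ≤ κ * ∫ x in s..r, G x) :
    G t ≤ Real.exp (κ * (t - s)) * G s := by
  have hprim : ContinuousOn (fun r => ∫ x in s..r, G x) (Icc s t) := by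
    have := intervalIntegral.continuousOn_primitive_interval'
      (hG.intervalIntegrable_of_Icc (μ := volume) hst) left_mem_uIcc
    rwa [uIcc_of_le hst] at this
  set Φ : ℝ → ℝ := fun r => Real.exp (-(κ * r)) * (G s + κ * ∫ x in s..r, G x) with hΦ
  have hd : ∀ r ∈ Ioo s t, HasDerivAt Φ (-κ * Real.exp (-(κ * r)) * (G s + κ * ∫ x in s..r, G x) +
      Real.exp (-(κ * r)) * (κ * G r)) r := fun r hr => by
    have h1 : HasDerivAt (fun r => ∫ x in s..r, G x) (G r) r := by
      refine intervalIntegral.integral_hasDerivAt_right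
        ((hG.mono (Icc_subset_Icc le_rfl hr.2.le)).intervalIntegrable_of_Icc hr.1.le) ?_ ?_
      · exact (hG.mono Ioo_subset_Icc_self).stronglyMeasurableAtFilter isOpen_Ioo r hr
      · exact hG.continuousAt (Icc_mem_nhds hr.1 hr.2)
    have h2 : HasDerivAt (fun r => Real.exp (-(κ * r))) (-κ * Real.exp (-(κ * r))) r := by
      have := (((hasDerivAt_id r).const_mul κ).neg).exp
      simpa [mul_comm] using this
    exact h2.mul ((h1.const_mul κ).const_add (G s))
  have hanti : AntitoneOn Φ (Icc s t) := by
    refine antitoneOn_of_deriv_nonpos (convex_Icc s t) ?_ ?_ ?_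
    · exact (by fun_prop : Continuous fun r => Real.exp (-(κ * r))).continuousOn.mul
        (continuousOn_const.add (hprim.const_mul κ))
    · rw [interior_Icc]
      exact fun r hr => (hd r hr).differentiableAt.differentiableWithinAt
    · rw [interior_Icc]
      intro r hr
      rw [(hd r hr).deriv]
      have h1 := h r (Ioo_subset_Icc_self hr)
      have h2 : 0 ≤ Real.exp (-(κ * r)) * κ * (G s + κ * (∫ x in s..r, G x) - G r) :=
        mul_nonneg (mul_nonneg (Real.exp_pos _).le hκ) (by linarith)
      linarith
  have h1 := hanti (left_mem_Icc.2 hst) (right_mem_Icc.2 hst) hst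
  simp only [hΦ, intervalIntegral.integral_same, mul_zero, add_zero] at h1
  have h2 := h t (right_mem_Icc.2 hst)
  have h3 : G s + κ * ∫ x in s..t, G x ≤ Real.exp (κ * (t - s)) * G s := by
    have h4 := mul_le_mul_of_nonneg_left h1 (Real.exp_pos (κ * t)).le
    rw [← mul_assoc, ← mul_assoc, ← Real.exp_add, ← Real.exp_add, add_neg_cancel, Real.exp_zero,
      one_mul] at h4
    rwa [show κ * (t - s) = κ * t + -(κ * s) by ring]
  linarith

theorem abs_exp_neg_sub_le {c x y : ℝ} (hx : |x| ≤ c) (hy : |y| ≤ c) :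
    |Real.exp (-x) - Real.exp (-y)| ≤ Real.exp c * |x - y| := by
  have hd : ∀ z ∈ Icc (-c) c, HasDerivWithinAt (fun x => Real.exp (-x))
      (Real.exp (-z) * -1) (Icc (-c) c) z := fun z _ =>
    ((hasDerivAt_id z).neg.exp).hasDerivWithinAt
  have := (convex_Icc (-c) c).norm_image_sub_le_of_norm_hasDerivWithin_le
    (C := Real.exp c) hd (fun z hz => by
      rw [mul_neg, mul_one, norm_neg, Real.norm_eq_abs, abs_of_pos (Real.exp_pos _)]
      exact Real.exp_le_exp.2 (by linarith [hz.1])) (abs_le.1 hy) (abs_le.1 hx)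
  simpa only [Real.norm_eq_abs] using this

/-! ### The time-dependent forms: two-sided bounds and regularity in time. -/

namespace TimeDependentForm

variable {X : Type*} [MeasurableSpace X] {m : Measure X} {E : DirichletForm m}
  {Γ₀ : E.Dom →ₗ[ℝ] E.Dom →ₗ[ℝ] Lp ℝ 1 m} {T : ℝ} (D : TimeDependentForm E Γ₀ T)

/-- The density of `m_t` with respect to `m`. -/
def dens (t : ℝ) (x : X) : ℝ := Real.exp (-D.f t x)

theorem dens_pos (t : ℝ) (x : X) : 0 < D.dens t x := Real.exp_pos _

theorem measurable_f {t : ℝ} (ht : t ∈ Ioo 0 T) : Measurable (D.f t) :=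
  D.f_measurable.comp (measurable_const.prodMk measurable_id :
    Measurable fun x : X => ((⟨t, ht⟩ : Ioo (0 : ℝ) T), x))

theorem measurable_dens {t : ℝ} (ht : t ∈ Ioo 0 T) : Measurable (D.dens t) :=
  (D.measurable_f ht).neg.exp

theorem exists_dens_bound : ∃ c : ℝ, 0 < c ∧ (∀ t ∈ Ioo 0 T, ∀ x, D.dens t x ≤ c) ∧
    ∀ t ∈ Ioo 0 T, ∀ x, 1 ≤ c * D.dens t x := by
  obtain ⟨c, hc⟩ := D.f_bounded
  refine ⟨Real.exp c, Real.exp_pos c, fun t ht x => ?_, fun t ht x => ?_⟩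
  · exact Real.exp_le_exp.2 (by linarith [(abs_le.1 (hc t ht x)).1])
  · rw [dens, ← Real.exp_add, Real.one_le_exp_iff]
    linarith [(abs_le.1 (hc t ht x)).2]

theorem memLp_dens {t : ℝ} (ht : t ∈ Ioo 0 T) : MemLp (D.dens t) ⊤ m := by
  obtain ⟨c, -, hc, -⟩ := D.exists_dens_bound
  refine memLp_top_of_bound (D.measurable_dens ht).aestronglyMeasurable c
    (Eventually.of_forall fun x => ?_)
  rw [Real.norm_eq_abs, abs_of_pos (D.dens_pos t x)]
  exact hc t ht x

theorem integral_meas {t : ℝ} (ht : t ∈ Ioo 0 T) (g : X → ℝ) :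
    ∫ x, g x ∂D.meas t = ∫ x, D.dens t x * g x ∂m := by
  rw [meas, integral_withDensity_eq_integral_toReal_smul
    (show Measurable fun x => ENNReal.ofReal (Real.exp (-D.f t x)) from
      (D.measurable_dens ht).ennreal_ofReal) (by simp)]
  refine integral_congr_ae (Eventually.of_forall fun x => ?_)
  simp only [ENNReal.toReal_ofReal (Real.exp_pos _).le, smul_eq_mul]
  rfl

/-- Integration against `m_t` on `L¹(m)`. -/
def weightedIntegral (t : ℝ) (ht : t ∈ Ioo 0 T) : Lp ℝ 1 m →L[ℝ] ℝ :=
  (ContinuousLinearMap.mul ℝ ℝ).lpPairing m ⊤ 1 ((D.memLp_dens ht).toLp (D.dens t))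

theorem weightedIntegral_apply {t : ℝ} (ht : t ∈ Ioo 0 T) (g : Lp ℝ 1 m) :
    D.weightedIntegral t ht g = ∫ x, D.dens t x * g x ∂m := by
  rw [weightedIntegral, ContinuousLinearMap.lpPairing_eq_integral]
  refine integral_congr_ae ?_
  filter_upwards [(D.memLp_dens ht).coeFn_toLp] with x hx
  rw [hx]
  rfl

theorem integrable_dens_mul {t : ℝ} (ht : t ∈ Ioo 0 T) (g : Lp ℝ 1 m) :
    Integrable (fun x => D.dens t x * g x) m :=
  memLp_one_iff_integrable.1
    ((ContinuousLinearMap.mul ℝ ℝ).memLp_of_bilin 1 (D.memLp_dens ht) (Lp.memLp g))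

theorem weightedIntegral_mono {t : ℝ} (ht : t ∈ Ioo 0 T) {g h : Lp ℝ 1 m} {c : ℝ}
    (hgh : ∀ᵐ x ∂m, g x ≤ c * h x) : D.weightedIntegral t ht g ≤ c * D.weightedIntegral t ht h := by
  rw [weightedIntegral_apply, weightedIntegral_apply, ← integral_const_mul]
  refine integral_mono_ae (D.integrable_dens_mul ht g) ((D.integrable_dens_mul ht h).const_mul c) ?_
  filter_upwards [hgh] with x hx
  nlinarith [D.dens_pos t x]

theorem form_eq {t : ℝ} (ht : t ∈ Ioo 0 T) (u v : E.Dom) :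
    D.form t u v = D.weightedIntegral t ht (D.Γ t u v) := by
  rw [form, D.integral_meas ht, weightedIntegral_apply]

theorem form_symm {t : ℝ} (ht : t ∈ Ioo 0 T) (u v : E.Dom) : D.form t u v = D.form t v u := by
  rw [D.form_eq ht, D.form_eq ht, D.Γ_symm t ht]

theorem form_nonneg {t : ℝ} (ht : t ∈ Ioo 0 T) (u : E.Dom) : 0 ≤ D.form t u u := by
  rw [D.form_eq ht, weightedIntegral_apply]
  refine integral_nonneg_of_ae ?_
  filter_upwards [D.Γ_nonneg t ht u] with x hx using mul_nonneg (D.dens_pos t x).le hx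

theorem exists_form_bounds (hΓ₀ : E.IsSquareField Γ₀) : ∃ c : ℝ, 0 < c ∧
    (∀ t ∈ Ioo 0 T, ∀ u, D.form t u u ≤ c * E.bilin u u) ∧
    (∀ t ∈ Ioo 0 T, ∀ u, E.bilin u u ≤ c * D.form t u u) ∧
    ∀ t ∈ Ioo 0 T, ∀ u, ∀ (_ : ∀ᵐ x ∂m, 0 ≤ D.Γ t u u x), ‖D.Γ t u u‖ ≤ c * E.bilin u u := by
  obtain ⟨c, hc0, hc1, hc2⟩ := D.exists_dens_bound
  obtain ⟨e, he0, he⟩ := D.Γ_elliptic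
  have hint : ∀ u v, Integrable (fun x => Γ₀ u v x) m := fun u v => L1.integrable_coeFn _
  -- The factor c + 1 instead of c lets the same constant serve the last bound, where no density
  -- occurs.
  refine ⟨(c + 1) * e, by positivity, fun t ht u => ?_, fun t ht u => ?_, fun t ht u hn => ?_⟩
  · rw [D.form_eq ht, weightedIntegral_apply, hΓ₀.form_eq, ← integral_const_mul]
    refine integral_mono_ae (D.integrable_dens_mul ht _) ((hint u u).const_mul _) ?_
    filter_upwards [he t ht u, hΓ₀.nonneg u, D.Γ_nonneg t ht u] with x h1 h2 h3
    calc D.dens t x * D.Γ t u u x ≤ (c + 1) * (e * Γ₀ u u x) :=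
          mul_le_mul ((hc1 t ht x).trans (by linarith)) h1.2 h3 (by positivity)
      _ = _ := by ring
  · rw [D.form_eq ht, weightedIntegral_apply, hΓ₀.form_eq, ← integral_const_mul]
    refine integral_mono_ae (hint u u) ((D.integrable_dens_mul ht _).const_mul _) ?_
    filter_upwards [he t ht u, hΓ₀.nonneg u, D.Γ_nonneg t ht u] with x h1 h2 h3
    have h4 : Γ₀ u u x ≤ e * D.Γ t u u x := by
      have := mul_le_mul_of_nonneg_left h1.1 he0.le
      rwa [← mul_assoc, mul_one_div_cancel he0.ne', one_mul] at this
    have h5 : 1 ≤ (c + 1) * D.dens t x := by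
      have := D.dens_pos t x
      linarith [hc2 t ht x]
    calc Γ₀ u u x ≤ 1 * (e * D.Γ t u u x) := by rwa [one_mul]
      _ ≤ ((c + 1) * D.dens t x) * (e * D.Γ t u u x) :=
          mul_le_mul_of_nonneg_right h5 (mul_nonneg he0.le h3)
      _ = _ := by ring
  · rw [L1.norm_eq_integral_norm, hΓ₀.form_eq, ← integral_const_mul]
    refine integral_mono_ae (L1.integrable_coeFn _).norm ((hint u u).const_mul _) ?_
    filter_upwards [he t ht u, hΓ₀.nonneg u, hn] with x h1 h2 h3
    rw [Real.norm_eq_abs, abs_of_nonneg h3]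
    have : 0 ≤ c * e * Γ₀ u u x := by positivity
    linarith [h1.2]

theorem exists_formL (hΓ₀ : E.IsSquareField Γ₀) {t : ℝ} (ht : t ∈ Ioo 0 T) :
    ∃ B : ContinuousForm E.Dom, ∀ u v, B u v = D.form t u v := by
  obtain ⟨c, hc0, hc, -⟩ := D.exists_form_bounds hΓ₀
  let B₀ : E.Dom →ₗ[ℝ] E.Dom →ₗ[ℝ] ℝ :=
    (D.Γ t).compr₂ (D.weightedIntegral t ht : Lp ℝ 1 m →ₗ[ℝ] ℝ)
  have hB₀ : ∀ u v, B₀ u v = D.form t u v := fun u v => (D.form_eq ht u v).symm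
  refine ⟨B₀.mkContinuous₂ c fun u v => ?_, fun u v => ?_⟩
  · refine abs_apply_le_of_diag (fun u v => ?_) (fun u => ?_) (fun u v => ?_) u v
    · rw [hB₀, hB₀, D.form_symm ht]
    · rw [hB₀, abs_of_nonneg (D.form_nonneg ht u)]
      refine (hc t ht u).trans (mul_le_mul_of_nonneg_left ?_ hc0.le)
      rw [E.norm_sq_eq]
      linarith [sq_nonneg ‖E.toL2 u‖]
    · have := parallelogram_law_with_norm ℝ u v
      linarith
  · rw [LinearMap.mkContinuous₂_apply, hB₀]

open Classical in
/-- The form `E_t` as a continuous bilinear form on `F`. -/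
def formL (t : ℝ) : ContinuousForm E.Dom :=
  if h : ∃ B : ContinuousForm E.Dom, ∀ u v, B u v = D.form t u v then h.choose else 0

theorem formL_apply (hΓ₀ : E.IsSquareField Γ₀) {t : ℝ} (ht : t ∈ Ioo 0 T) (u v : E.Dom) :
    D.formL t u v = D.form t u v := by
  have h := D.exists_formL hΓ₀ ht
  rw [formL, dif_pos h]
  exact h.choose_spec u v

variable {D} {L : ℝ}

theorem IsLogLipschitz.dens_le (hL : D.IsLogLipschitz L) {s t : ℝ} (hs : s ∈ Ioo 0 T)
    (ht : t ∈ Ioo 0 T) (x : X) : D.dens t x ≤ Real.exp (L * |t - s|) * D.dens s x := by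
  rw [dens, dens, ← Real.exp_add, Real.exp_le_exp]
  linarith [(abs_le.1 (hL.density s hs t ht x)).1]

/-- Ellipticity bounds ‖Γ_r(u)‖ in L¹ uniformly in r, so t ↦ Γ_t(u) is Lipschitz into L¹. The norm
estimate for the Bochner integral needs no integrability; the latter is a consequence of the
continuity obtained here. -/
theorem IsLogLipschitz.continuousOn_squareField (hL : D.IsLogLipschitz L)
    (hΓ₀ : E.IsSquareField Γ₀) (hL0 : 0 ≤ L) (u : E.Dom) :
    ContinuousOn (fun t => D.Γ t u u) (Ioo 0 T) := by
  obtain ⟨c, hc0, -, -, hc⟩ := D.exists_form_bounds hΓ₀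
  have key : ∀ s ∈ Ioo 0 T, ∀ t ∈ Ioo 0 T, s < t →
      ‖D.Γ t u u - D.Γ s u u‖ ≤ 2 * L * (c * E.bilin u u) * |t - s| := by
    intro s hs t ht hst
    have h1 : ‖∫ r in s..t, D.Γ r u u‖ ≤ c * E.bilin u u * |t - s| := by
      refine intervalIntegral.norm_integral_le_of_norm_le_const fun r hr => ?_
      rw [uIoc_of_le hst.le] at hr
      have hrI : r ∈ Ioo 0 T := ⟨hs.1.trans hr.1, hr.2.trans_lt ht.2⟩
      exact hc r hrI u (D.Γ_nonneg r hrI u)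
    have h2 : ‖D.Γ t u u - D.Γ s u u‖ ≤ 2 * L * ‖∫ r in s..t, D.Γ r u u‖ := by
      refine Lp.norm_le_mul_norm_of_ae_le_mul ?_
      filter_upwards [hL.squareField s hs t ht hst u, Lp.coeFn_sub (D.Γ t u u) (D.Γ s u u)]
        with x h3 h4
      rw [h4, Pi.sub_apply, Real.norm_eq_abs, Real.norm_eq_abs]
      exact h3.trans (mul_le_mul_of_nonneg_left (le_abs_self _) (by positivity))
    refine h2.trans ((mul_le_mul_of_nonneg_left h1 (by positivity)).trans (le_of_eq (by ring)))
  have hlip : LipschitzOnWith (Real.toNNReal (2 * L * (c * E.bilin u u)))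
      (fun t => D.Γ t u u) (Ioo 0 T) := by
    refine LipschitzOnWith.of_dist_le_mul fun t ht s hs => ?_
    rw [dist_eq_norm, Real.dist_eq,
      Real.coe_toNNReal _ (mul_nonneg (by positivity) (mul_nonneg hc0.le (E.bilin_nonneg u)))]
    rcases lt_trichotomy s t with h | rfl | h
    · exact key s hs t ht h
    · simp
    · rw [norm_sub_rev, abs_sub_comm]
      exact key t ht s hs h
  exact hlip.continuousOn

/-- The exponent 3L is L + 2L: the first from the change of density, the second from Gronwall's
inequality for r ↦ ∫Γ_r(u) dm_s with the measure frozen at time s. -/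
theorem IsLogLipschitz.form_le (hL : D.IsLogLipschitz L) (hΓ₀ : E.IsSquareField Γ₀) (hL0 : 0 ≤ L)
    {s t : ℝ} (hs : s ∈ Ioo 0 T) (ht : t ∈ Ioo 0 T) (u : E.Dom) :
    D.form t u u ≤ Real.exp (3 * L * |t - s|) * D.form s u u := by
  have hγ := hL.continuousOn_squareField hΓ₀ hL0 u
  -- change of density
  have hdens : D.weightedIntegral t ht (D.Γ t u u) ≤
      Real.exp (L * |t - s|) * D.weightedIntegral s hs (D.Γ t u u) := by
    rw [weightedIntegral_apply, weightedIntegral_apply, ← integral_const_mul]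
    refine integral_mono_ae (D.integrable_dens_mul ht _)
      ((D.integrable_dens_mul hs _).const_mul _) ?_
    filter_upwards [D.Γ_nonneg t ht u] with x hx
    rw [← mul_assoc]
    exact mul_le_mul_of_nonneg_right (hL.dens_le hs ht x) hx
  set G : ℝ → ℝ := fun r => D.weightedIntegral s hs (D.Γ r u u) with hG
  have hGc : ContinuousOn G (Ioo 0 T) := (D.weightedIntegral s hs).continuous.comp_continuousOn hγ
  have hinc : ∀ a ∈ Ioo 0 T, ∀ b ∈ Ioo 0 T, a ≤ b → |G b - G a| ≤ 2 * L * ∫ r in a..b, G r := by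
    intro a ha b hb hab
    rcases hab.eq_or_lt with rfl | hab
    · simp
    have hii : IntervalIntegrable (fun r => D.Γ r u u) volume a b :=
      (hγ.mono (by rw [uIcc_of_le hab.le]; exact Icc_subset_Ioo ha.1 hb.2)).intervalIntegrable
    have h1 : ∫ r in a..b, G r = D.weightedIntegral s hs (∫ r in a..b, D.Γ r u u) :=
      (D.weightedIntegral s hs).intervalIntegral_comp_comm hii
    rw [h1, abs_le, hG]
    simp only [← map_sub]
    refine ⟨?_, D.weightedIntegral_mono hs ?_⟩
    · rw [neg_le, ← map_neg]
      refine D.weightedIntegral_mono hs ?_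
      filter_upwards [hL.squareField a ha b hb hab u, Lp.coeFn_sub (D.Γ b u u) (D.Γ a u u),
        Lp.coeFn_neg (D.Γ b u u - D.Γ a u u)] with x h3 h4 h5
      rw [h5, Pi.neg_apply, h4, Pi.sub_apply]
      linarith [(abs_le.1 h3).1]
    · filter_upwards [hL.squareField a ha b hb hab u, Lp.coeFn_sub (D.Γ b u u) (D.Γ a u u)]
        with x h3 h4
      rw [h4, Pi.sub_apply]
      exact (abs_le.1 h3).2
  have hGts : G t ≤ Real.exp (2 * L * |t - s|) * G s := by
    rcases le_total s t with hst | hst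
    · have hsub : Icc s t ⊆ Ioo 0 T := Icc_subset_Ioo hs.1 ht.2
      rw [abs_of_nonneg (sub_nonneg.2 hst)]
      exact le_exp_mul_of_sub_le_integral (by positivity) hst (hGc.mono hsub)
        fun r hr => (abs_le.1 (hinc s hs r (hsub hr) hr.1)).2
    · have hsub : Icc t s ⊆ Ioo 0 T := Icc_subset_Ioo ht.1 hs.2
      have hmem : ∀ r ∈ Icc (-s) (-t), -r ∈ Icc t s := fun r hr =>
        ⟨by linarith [hr.2], by linarith [hr.1]⟩
      -- For t < s Gronwall's inequality is run backwards in time, which the two-sided bound on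
      -- increments allows.
      have h1 := le_exp_mul_of_sub_le_integral (G := fun r => G (-r)) (κ := 2 * L) (s := -s)
        (t := -t) (by positivity) (by linarith)
        ((hGc.mono hsub).comp continuousOn_neg hmem) (fun r hr => by
          have h2 := (abs_le.1 (hinc (-r) (hsub (hmem r hr)) s hs (hmem r hr).2)).1
          rw [neg_neg, intervalIntegral.integral_comp_neg G, neg_neg]
          linarith)
      rw [neg_neg, neg_neg] at h1
      rw [abs_of_nonpos (by linarith)]
      convert h1 using 3
      ring
  rw [D.form_eq ht, D.form_eq hs]
  calc D.weightedIntegral t ht (D.Γ t u u) ≤ _ := hdens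
    _ ≤ Real.exp (L * |t - s|) * (Real.exp (2 * L * |t - s|) * G s) :=
        mul_le_mul_of_nonneg_left hGts (Real.exp_pos _).le
    _ = _ := by
        rw [← mul_assoc, ← Real.exp_add]
        congr 2
        ring

theorem IsLogLipschitz.continuousOn_formL (hL : D.IsLogLipschitz L) (hΓ₀ : E.IsSquareField Γ₀)
    (hL0 : 0 ≤ L) : ContinuousOn D.formL (Ioo 0 T) := by
  obtain ⟨c, hc0, hc, -⟩ := D.exists_form_bounds hΓ₀
  refine ContinuousForm.continuousOn_of_le_exp (κ := 3 * L) (c := c) (by positivity) hc0.le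
    (fun t ht u v => ?_) (fun s hs t ht u => ?_) fun t ht u => ?_
  · rw [D.formL_apply hΓ₀ ht, D.formL_apply hΓ₀ ht, D.form_symm ht]
  · rw [D.formL_apply hΓ₀ ht, D.formL_apply hΓ₀ hs]
    exact hL.form_le hΓ₀ hL0 hs ht u
  · rw [D.formL_apply hΓ₀ ht]
    refine (hc t ht u).trans (mul_le_mul_of_nonneg_left ?_ hc0.le)
    rw [E.norm_sq_eq]
    linarith [sq_nonneg ‖E.toL2 u‖]

theorem IsLogLipschitz.exists_norm_mulL2_sub_le (hL : D.IsLogLipschitz L) : ∃ c : ℝ, ∀ s ∈ Ioo 0 T, ∀ t ∈ Ioo 0 T,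
    ‖mulL2 m (D.dens t) - mulL2 m (D.dens s)‖ ≤ c * |t - s| := by
  obtain ⟨c, hc⟩ := D.f_bounded
  refine ⟨|Real.exp c * L|, fun s hs t ht => ?_⟩
  refine ContinuousLinearMap.opNorm_le_bound _ (by positivity) fun g => ?_
  rw [mulL2_sub (D.memLp_dens ht) (D.memLp_dens hs)]
  refine norm_mulL2_apply_le ((D.memLp_dens ht).sub (D.memLp_dens hs))
    (Eventually.of_forall fun x => ?_) g
  refine (abs_exp_neg_sub_le (hc t ht x) (hc s hs x)).trans ?_
  refine (mul_le_mul_of_nonneg_left (hL.density s hs t ht x) (Real.exp_pos c).le).trans ?_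
  rw [← mul_assoc]
  exact mul_le_mul_of_nonneg_right (le_abs_self _) (abs_nonneg _)

end TimeDependentForm

variable {X : Type*} [MeasurableSpace X] {m : Measure X} {E : DirichletForm m}

/-! ### Consequences of the diffusion property. -/

namespace DirichletForm

theorem isBdd_neg {u : E.Dom} (hu : E.IsBdd u) : E.IsBdd (-u) := by
  obtain ⟨c, hc⟩ := hu
  refine ⟨c, ?_⟩
  rw [map_neg]
  filter_upwards [hc, Lp.coeFn_neg (E.toL2 u)] with x h1 h2
  rwa [h2, Pi.neg_apply, abs_neg]

/-- The square field operator of a product `u e^{-φ}`. -/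
theorem IsDiffusion.apply_mul_exp {Γ : E.Dom →ₗ[ℝ] E.Dom →ₗ[ℝ] Lp ℝ 1 m} (hΓ : E.IsDiffusion Γ)
    (hs : ∀ u v, Γ u v = Γ v u) {u φ z : E.Dom} (hu : E.IsBdd u) (hφ : E.IsBdd φ)
    (hz : ∀ᵐ x ∂m, E.toL2 z x = E.toL2 u x * Real.exp (-E.toL2 φ x)) :
    ∀ᵐ x ∂m, Γ z z x = Real.exp (-E.toL2 φ x) ^ 2 * (Γ u u x - 2 * E.toL2 u x * Γ φ u x +
      E.toL2 u x ^ 2 * Γ φ φ x) := by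
  have hzb : E.IsBdd z := by
    obtain ⟨c, hc⟩ := hu
    obtain ⟨d, hd⟩ := hφ
    refine ⟨c * Real.exp d, ?_⟩
    filter_upwards [hz, hc, hd] with x h1 h2 h3
    rw [h1, abs_mul, abs_of_pos (Real.exp_pos _)]
    exact mul_le_mul h2 (Real.exp_le_exp.2 (by linarith [(abs_le.1 h3).1])) (Real.exp_pos _).le
      ((abs_nonneg _).trans h2)
  set Ψ : (Fin 2 → ℝ) → ℝ := fun y => y 0 * Real.exp (-y 1) with hΨ
  have hΨc : ContDiff ℝ 1 Ψ := by fun_prop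
  have hd : ∀ y : Fin 2 → ℝ, fderiv ℝ Ψ y (Pi.single 0 1) = Real.exp (-y 1) ∧
      fderiv ℝ Ψ y (Pi.single 1 1) = -(y 0 * Real.exp (-y 1)) := fun y => by
    have h0 : HasFDerivAt (fun y : Fin 2 → ℝ => y 0) (ContinuousLinearMap.proj 0) y :=
      (ContinuousLinearMap.proj (R := ℝ) (φ := fun _ : Fin 2 => ℝ) 0).hasFDerivAt
    have h1 : HasFDerivAt (fun y : Fin 2 → ℝ => y 1) (ContinuousLinearMap.proj 1) y :=
      (ContinuousLinearMap.proj (R := ℝ) (φ := fun _ : Fin 2 => ℝ) 1).hasFDerivAt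
    have h2 := (h0.mul (h1.neg.exp)).fderiv
    rw [hΨ]
    constructor
    · erw [h2]
      simp
    · erw [h2]
      simp
  have key : ∀ v : E.Dom, E.IsBdd v → ∀ᵐ x ∂m, Γ z v x =
      Real.exp (-E.toL2 φ x) * (Γ u v x - E.toL2 u x * Γ φ v x) := fun v hv => by
    have h := hΓ 2 Ψ hΨc (by simp [hΨ]) ![u, φ] v z
      (fun i => by fin_cases i <;> simpa) hv (by simpa [hΨ] using hz)
    filter_upwards [h] with x hx
    rw [hx, Fin.sum_univ_two, (hd _).1, (hd _).2]
    simp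
    ring
  -- Expanding the first slot of Γ(z,z) leaves Γ(u,z) and Γ(φ,z), which by symmetry are expanded
  -- once more.
  filter_upwards [key z hzb, key u hu, key φ hφ] with x h1 h2 h3
  rw [h1, hs u z, hs φ z, h2, h3, hs u φ]
  ring

/-- The mixed term is bounded without Cauchy–Schwarz: nonnegativity of Γ(u e^{φ}) says that
-2uΓ(φ,u) ≤ Γ(u) + u²Γ(φ). -/
theorem IsDiffusion.apply_mul_exp_le {Γ : E.Dom →ₗ[ℝ] E.Dom →ₗ[ℝ] Lp ℝ 1 m} (hΓ : E.IsDiffusion Γ)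
    (hs : ∀ u v, Γ u v = Γ v u) (hn : ∀ u, ∀ᵐ x ∂m, 0 ≤ Γ u u x) {u φ z : E.Dom}
    (hu : E.IsBdd u) (hφ : E.IsBdd φ)
    (hz : ∀ᵐ x ∂m, E.toL2 z x = E.toL2 u x * Real.exp (-E.toL2 φ x)) :
    ∀ᵐ x ∂m, Γ z z x ≤ 2 * Real.exp (-E.toL2 φ x) ^ 2 *
      (Γ u u x + E.toL2 u x ^ 2 * Γ φ φ x) := by
  obtain ⟨y, hy⟩ := E.exists_mul_exp hu (isBdd_neg hφ)
  filter_upwards [hΓ.apply_mul_exp hs hu hφ hz, hΓ.apply_mul_exp hs hu (isBdd_neg hφ) hy, hn y,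
    Lp.coeFn_neg (Γ φ u)] with x h1 h2 h3 h4
  rw [h2] at h3
  have h5 := nonneg_of_mul_nonneg_right h3 (by positivity)
  simp only [map_neg, LinearMap.neg_apply, neg_neg, h4, Pi.neg_apply] at h5
  rw [h1]
  have : 0 ≤ Real.exp (-E.toL2 φ x) ^ 2 := by positivity
  nlinarith

end DirichletForm

/-! ### Multiplication by the density e^{-f_t} is bounded on F. -/

namespace TimeDependentForm

variable {Γ₀ : E.Dom →ₗ[ℝ] E.Dom →ₗ[ℝ] Lp ℝ 1 m} {T : ℝ} (D : TimeDependentForm E Γ₀ T)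

theorem mulDensity_eq_of {t : ℝ} (ht : t ∈ Ioo 0 T) {w z : E.Dom}
    (h : E.toL2 z = mulL2 m (D.dens t) (E.toL2 w)) :
    E.toL2 (D.mulDensity t w) = mulL2 m (D.dens t) (E.toL2 w) := by
  have hmul := coeFn_mulL2 (D.memLp_dens ht) (E.toL2 w)
  have h' : ∃ z : E.Dom, ∀ᵐ x ∂m, E.toL2 z x = E.toL2 w x * Real.exp (-D.f t x) := by
    refine ⟨z, ?_⟩
    rw [h]
    filter_upwards [hmul] with x hx
    rw [hx, mul_comm]
    rfl
  rw [mulDensity, dif_pos h']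
  refine Lp.ext ?_
  filter_upwards [h'.choose_spec, hmul] with x h1 h2
  rw [h1, h2, mul_comm]
  rfl

/-- The diffusion property covers only bounded w. For general w the products of the truncations are
bounded in F and converge in L² to w e^{-f_t}, so a weak limit in F is the product, with the same
norm bound. -/
theorem exists_mul_dens (hΓ₀ : E.IsSquareField Γ₀) : ∃ c : ℝ, ∀ t ∈ Ioo 0 T, ∀ w : E.Dom,
    ∃ z : E.Dom, E.toL2 z = mulL2 m (D.dens t) (E.toL2 w) ∧ ‖z‖ ≤ c * ‖w‖ := by
  obtain ⟨c, hc0, hc, -⟩ := D.exists_dens_bound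
  obtain ⟨b, hb⟩ := D.f_bounded
  obtain ⟨d, hd⟩ := D.f_mem
  obtain ⟨e, he0, he⟩ := D.Γ_elliptic
  set d' := max d 0 with hd'
  have hd0 : 0 ≤ d' := le_max_right _ _
  -- Passing from Γ₀ to Γ_t and back costs e twice, the squared density costs c², and the 2 comes
  -- from the mixed term; the last c² is for the L² part of the norm.
  set K : ℝ := 2 * e ^ 2 * c ^ 2 * (1 + d') + c ^ 2 with hK
  have hK0 : 0 ≤ K := by positivity
  have bdd : ∀ t ∈ Ioo 0 T, ∀ w : E.Dom, E.IsBdd w →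
      ∃ z : E.Dom, E.toL2 z = mulL2 m (D.dens t) (E.toL2 w) ∧ ‖z‖ ≤ √K * ‖w‖ := by
    intro t ht w hw
    obtain ⟨φ, hφ, hφd⟩ := hd t ht
    have hφb : E.IsBdd φ := ⟨b, by filter_upwards [hφ] with x hx; rw [hx]; exact hb t ht x⟩
    obtain ⟨z, hz⟩ := E.exists_mul_exp hw hφb
    have hzm : E.toL2 z = mulL2 m (D.dens t) (E.toL2 w) := by
      refine Lp.ext ?_
      filter_upwards [hz, hφ, coeFn_mulL2 (D.memLp_dens ht) (E.toL2 w)] with x h1 h2 h3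
      rw [h1, h2, h3, mul_comm]
      rfl
    refine ⟨z, hzm, ?_⟩
    have h1 : E.bilin z z ≤ 2 * e ^ 2 * c ^ 2 * (E.bilin w w + d' * ‖E.toL2 w‖ ^ 2) := by
      rw [hΓ₀.form_eq, hΓ₀.form_eq, norm_sq_eq_integral, ← integral_const_mul, ← integral_add
        (L1.integrable_coeFn _) ((Lp.memLp (E.toL2 w)).integrable_sq.const_mul _),
        ← integral_const_mul]
      refine integral_mono_ae (L1.integrable_coeFn _) (((L1.integrable_coeFn _).add
        ((Lp.memLp (E.toL2 w)).integrable_sq.const_mul _)).const_mul _) ?_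
      filter_upwards [he t ht z, he t ht w, he t ht φ, hφd, hφ, (D.Γ_diffusion t ht).apply_mul_exp_le
        (D.Γ_symm t ht) (D.Γ_nonneg t ht) hw hφb hz, D.Γ_nonneg t ht w, D.Γ_nonneg t ht φ]
        with x g1 g2 g3 g4 g5 g6 g7 g8
      have k1 : Γ₀ z z x ≤ e * D.Γ t z z x := by
        have := mul_le_mul_of_nonneg_left g1.1 he0.le
        rwa [← mul_assoc, mul_one_div_cancel he0.ne', one_mul] at this
      have k2 : Real.exp (-E.toL2 φ x) ^ 2 ≤ c ^ 2 := by
        rw [g5]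
        exact pow_le_pow_left₀ (Real.exp_pos _).le (hc t ht x) 2
      have k3 : D.Γ t φ φ x ≤ e * d' :=
        g3.2.trans (mul_le_mul_of_nonneg_left (g4.trans (le_max_left _ _)) he0.le)
      have k4 : D.Γ t w w x + E.toL2 w x ^ 2 * D.Γ t φ φ x ≤
          e * (Γ₀ w w x + d' * E.toL2 w x ^ 2) := by
        have := mul_le_mul_of_nonneg_left k3 (sq_nonneg (E.toL2 w x))
        linarith [g2.2]
      have k5 : 0 ≤ D.Γ t w w x + E.toL2 w x ^ 2 * D.Γ t φ φ x := by positivity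
      calc Γ₀ z z x ≤ e * (2 * Real.exp (-E.toL2 φ x) ^ 2 *
            (D.Γ t w w x + E.toL2 w x ^ 2 * D.Γ t φ φ x)) :=
            k1.trans (mul_le_mul_of_nonneg_left g6 he0.le)
        _ ≤ e * (2 * c ^ 2 * (e * (Γ₀ w w x + d' * E.toL2 w x ^ 2))) := by
            gcongr
        _ = _ := by ring
    have h2 : ‖E.toL2 z‖ ≤ c * ‖E.toL2 w‖ := by
      rw [hzm]
      refine norm_mulL2_apply_le (D.memLp_dens ht) (Eventually.of_forall fun x => ?_) _
      rw [abs_of_pos (D.dens_pos t x)]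
      exact hc t ht x
    refine le_of_sq_le_sq ?_ (by positivity)
    have h3 := pow_le_pow_left₀ (norm_nonneg _) h2 2
    have h4 := E.bilin_nonneg w
    rw [mul_pow, Real.sq_sqrt hK0, E.norm_sq_eq, E.norm_sq_eq, hK]
    have h5 : 0 ≤ e ^ 2 * c ^ 2 * ‖E.toL2 w‖ ^ 2 := by positivity
    have h6 : 0 ≤ e ^ 2 * c ^ 2 * E.bilin w w * d' := by positivity
    have h7 : 0 ≤ c ^ 2 * E.bilin w w := by positivity
    nlinarith
  refine ⟨√K, fun t ht w => ?_⟩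
  obtain ⟨g, hgb, hgn, hgt⟩ := E.exists_truncation w
  choose z hz hzn using fun n => bdd t ht (g n) (hgb n)
  obtain ⟨y, hy, hyn, -⟩ := exists_weak_limit_map E.toL2 (g := z) (C := √K * ‖w‖)
    (h := mulL2 m (D.dens t) (E.toL2 w))
    (fun n => (hzn n).trans (mul_le_mul_of_nonneg_left (hgn n) (Real.sqrt_nonneg _))) (by
      simp only [hz]
      exact ((mulL2 m (D.dens t)).continuous.tendsto _).comp hgt)
  exact ⟨y, hy, hyn⟩

theorem toL2_mulDensity (hΓ₀ : E.IsSquareField Γ₀) {t : ℝ} (ht : t ∈ Ioo 0 T) (w : E.Dom) :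
    E.toL2 (D.mulDensity t w) = mulL2 m (D.dens t) (E.toL2 w) := by
  obtain ⟨c, hc⟩ := D.exists_mul_dens hΓ₀
  obtain ⟨z, hz, -⟩ := hc t ht w
  exact D.mulDensity_eq_of ht hz

theorem exists_norm_mulDensity_le (hΓ₀ : E.IsSquareField Γ₀) : ∃ c : ℝ, 0 ≤ c ∧ ∀ t ∈ Ioo 0 T,
    ∀ w : E.Dom, ‖D.mulDensity t w‖ ≤ c * ‖w‖ := by
  obtain ⟨c, hc⟩ := D.exists_mul_dens hΓ₀
  refine ⟨|c|, abs_nonneg c, fun t ht w => ?_⟩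
  obtain ⟨z, hz, hzn⟩ := hc t ht w
  have : D.mulDensity t w = z := E.toL2_injective ((D.mulDensity_eq_of ht hz).trans hz.symm)
  rw [this]
  exact hzn.trans (mul_le_mul_of_nonneg_right (le_abs_self c) (norm_nonneg _))

theorem mulDensity_smul (hΓ₀ : E.IsSquareField Γ₀) {t : ℝ} (ht : t ∈ Ioo 0 T) (c : ℝ) (w : E.Dom) :
    D.mulDensity t (c • w) = c • D.mulDensity t w := E.toL2_injective <| by
  rw [map_smul, D.toL2_mulDensity hΓ₀ ht, D.toL2_mulDensity hΓ₀ ht, map_smul, map_smul]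

theorem mulDensity_sub (hΓ₀ : E.IsSquareField Γ₀) {t : ℝ} (ht : t ∈ Ioo 0 T) (v w : E.Dom) :
    D.mulDensity t (v - w) = D.mulDensity t v - D.mulDensity t w := E.toL2_injective <| by
  rw [map_sub, D.toL2_mulDensity hΓ₀ ht, D.toL2_mulDensity hΓ₀ ht, D.toL2_mulDensity hΓ₀ ht,
    map_sub, map_sub]

end TimeDependentForm

/-! ### Differentiability of Lipschitz families. -/

section Parameter

/-- Derivatives of a measurable family of uniformly Lipschitz functions are jointly measurable. -/
theorem measurable_deriv_of_lipschitz {g : X → ℝ → ℝ} {C : NNReal} (hm : ∀ r, Measurable (g · r))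
    (hl : ∀ x, LipschitzWith C (g x)) : Measurable (fun p : X × ℝ => deriv (g p.1) p.2) ∧
      MeasurableSet {p : X × ℝ | DifferentiableAt ℝ (g p.1) p.2} := by
  set Φ : X → ℚ → ℝ := fun x q => g x q with hΦ
  have hΦm : Measurable Φ := measurable_pi_lambda _ fun q => hm q
  -- X gets the coarsest topology making the evaluations at rational times continuous. Its open sets
  -- are measurable, and the uniform Lipschitz bound makes g jointly continuous, so measurability of
  -- derivatives with a parameter applies.
  let t : TopologicalSpace X := TopologicalSpace.induced Φ inferInstance
  have : OpensMeasurableSpace X := ⟨by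
    refine MeasurableSpace.generateFrom_le ?_
    rintro s ⟨o, ho, rfl⟩
    exact hΦm ho.measurableSet⟩
  have hΦc : Continuous Φ := continuous_induced_dom
  have h1 : Continuous fun p : ℝ × X => g p.2 p.1 := by
    refine continuous_prod_of_dense_continuous_lipschitzWith _ C Rat.denseRange_cast ?_ hl
    rintro _ ⟨q, rfl⟩
    exact (continuous_apply q).comp hΦc
  have h2 : Continuous (Function.uncurry g) := h1.comp continuous_swap
  exact ⟨measurable_deriv_with_param h2, measurableSet_of_differentiableAt_with_param ℝ h2⟩

/-- Each g x is differentiable at almost every time by Rademacher's theorem; Fubini exchanges the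
quantifiers. -/
theorem ae_ae_differentiableAt [SigmaFinite m] {g : X → ℝ → ℝ} {C : NNReal}
    (hm : ∀ r, Measurable (g · r)) (hl : ∀ x, LipschitzWith C (g x)) :
    ∀ᵐ r : ℝ, ∀ᵐ x ∂m, DifferentiableAt ℝ (g x) r :=
  (Measure.ae_ae_comm (measurable_deriv_of_lipschitz hm hl).2).1
    (Eventually.of_forall fun x => (hl x).ae_differentiableAt_real)

end Parameter

/-! ### The time derivative of the density, and the evolution family of the forms. -/

namespace TimeDependentForm

variable {Γ₀ : E.Dom →ₗ[ℝ] E.Dom →ₗ[ℝ] Lp ℝ 1 m} {T : ℝ} {D : TimeDependentForm E Γ₀ T} {L : ℝ}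

/-- The time derivative of `f`. -/
def derivF (D : TimeDependentForm E Γ₀ T) (t : ℝ) (x : X) : ℝ := deriv (fun r => D.f r x) t

/-- Freezing time outside [a, b] gives a globally Lipschitz family with the same germs at interior
times. -/
theorem exists_extension (hL : D.IsLogLipschitz L) (hL0 : 0 ≤ L) {a b : ℝ} (hab : a ≤ b)
    (ha : 0 < a) (hb : b < T) : ∃ g : X → ℝ → ℝ, (∀ r, Measurable (g · r)) ∧
      (∀ x, LipschitzWith (Real.toNNReal L) (g x)) ∧
      ∀ x, ∀ t ∈ Ioo a b, g x =ᶠ[𝓝 t] fun r => D.f r x := by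
  have hI : ∀ r, max a (min b r) ∈ Ioo 0 T := fun r =>
    ⟨ha.trans_le (le_max_left _ _), max_lt (hab.trans_lt hb) ((min_le_left _ _).trans_lt hb)⟩
  refine ⟨fun x r => D.f (max a (min b r)) x, fun r => D.measurable_f (hI r), fun x => ?_,
    fun x t ht => ?_⟩
  · refine LipschitzWith.of_dist_le_mul fun r s => ?_
    rw [Real.dist_eq, Real.dist_eq, Real.coe_toNNReal _ hL0]
    refine (hL.density _ (hI s) _ (hI r) x).trans (mul_le_mul_of_nonneg_left ?_ hL0)
    exact (abs_max_sub_max_le_max _ _ _ _).trans (max_le (by simp)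
      ((abs_min_sub_min_le_max _ _ _ _).trans (max_le (by simp) le_rfl)))
  · filter_upwards [Ioo_mem_nhds ht.1 ht.2] with r hr
    rw [min_eq_right hr.2.le, max_eq_right hr.1.le]

theorem IsLogLipschitz.measurable_derivF (hL : D.IsLogLipschitz L) (hL0 : 0 ≤ L) {t : ℝ}
    (ht : t ∈ Ioo 0 T) : Measurable (D.derivF t) := by
  obtain ⟨a, ha, hat⟩ := exists_between ht.1
  obtain ⟨b, htb, hb⟩ := exists_between ht.2
  obtain ⟨g, hgm, hgl, hg⟩ := exists_extension hL hL0 (hat.trans htb).le ha hb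
  have h1 : D.derivF t = fun x => deriv (g x) t := funext fun x => (hg x t ⟨hat, htb⟩).deriv_eq.symm
  rw [h1]
  exact (measurable_deriv_of_lipschitz hgm hgl).1.comp (measurable_id.prodMk measurable_const)

theorem IsLogLipschitz.abs_derivF_le (hL : D.IsLogLipschitz L) (hL0 : 0 ≤ L) {t : ℝ}
    (ht : t ∈ Ioo 0 T) (x : X) : |D.derivF t x| ≤ L := by
  refine norm_deriv_le_of_lip' (f := fun r => D.f r x) (x₀ := t) hL0 ?_
  filter_upwards [Ioo_mem_nhds ht.1 ht.2] with r hr using hL.density t ht r hr x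

theorem IsLogLipschitz.memLp_derivF (hL : D.IsLogLipschitz L) (hL0 : 0 ≤ L) {t : ℝ}
    (ht : t ∈ Ioo 0 T) : MemLp (D.derivF t) ⊤ m :=
  memLp_top_of_bound (hL.measurable_derivF hL0 ht).aestronglyMeasurable L
    (Eventually.of_forall fun x => hL.abs_derivF_le hL0 ht x)

theorem IsLogLipschitz.ae_differentiableAt [SigmaFinite m] (hL : D.IsLogLipschitz L) (hL0 : 0 ≤ L)
    {a b : ℝ} (hab : a ≤ b) (ha : 0 < a) (hb : b < T) : ∀ᵐ t ∂volume.restrict (Ioo a b),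
      ∀ᵐ x ∂m, DifferentiableAt ℝ (fun r => D.f r x) t := by
  obtain ⟨g, hgm, hgl, hg⟩ := exists_extension hL hL0 hab ha hb
  filter_upwards [ae_restrict_of_ae (ae_ae_differentiableAt (m := m) hgm hgl),
    ae_restrict_mem measurableSet_Ioo] with t h1 ht
  filter_upwards [h1] with x hx
  exact ((hg x t ht).differentiableAt_iff).1 hx

/-- The strong time derivative of multiplication by `e^{-f_t}`. -/
theorem IsLogLipschitz.tendsto_quotient (hL : D.IsLogLipschitz L) (hL0 : 0 ≤ L) {t : ℝ}
    (ht : t ∈ Ioo 0 T) (hd : ∀ᵐ x ∂m, DifferentiableAt ℝ (fun r => D.f r x) t) (g : Lp ℝ 2 m) :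
    Tendsto (fun k : ℝ => k⁻¹ • (mulL2 m (D.dens (t + k)) g - mulL2 m (D.dens t) g)) (𝓝[≠] 0)
      (𝓝 (-mulL2 m (D.dens t) (mulL2 m (D.derivF t) g))) := by
  obtain ⟨c, hc0, hc, -⟩ := D.exists_dens_bound
  obtain ⟨b, hb⟩ := D.f_bounded
  refine tendsto_iff_norm_sub_tendsto_zero.2 ?_
  set q : ℝ → X → ℝ := fun k x => k⁻¹ * (D.dens (t + k) x - D.dens t x) + D.dens t x * D.derivF t x
    with hq
  have hnear : ∀ᶠ k : ℝ in 𝓝[≠] 0, t + k ∈ Ioo 0 T := by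
    have h1 : Tendsto (fun k : ℝ => t + k) (𝓝[≠] 0) (𝓝 t) := by
      have : Continuous fun k : ℝ => t + k := by fun_prop
      simpa using (this.tendsto 0).mono_left nhdsWithin_le_nhds
    exact h1.eventually (Ioo_mem_nhds ht.1 ht.2)
  have hcoe : ∀ k : ℝ, t + k ∈ Ioo 0 T →
      (k⁻¹ • (mulL2 m (D.dens (t + k)) g - mulL2 m (D.dens t) g) -
        -mulL2 m (D.dens t) (mulL2 m (D.derivF t) g) : Lp ℝ 2 m) =ᵐ[m] fun x => q k x * g x := by
    intro k hk
    rw [sub_neg_eq_add]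
    filter_upwards [Lp.coeFn_add (k⁻¹ • (mulL2 m (D.dens (t + k)) g - mulL2 m (D.dens t) g))
      (mulL2 m (D.dens t) (mulL2 m (D.derivF t) g)),
      Lp.coeFn_smul k⁻¹ (mulL2 m (D.dens (t + k)) g - mulL2 m (D.dens t) g),
      Lp.coeFn_sub (mulL2 m (D.dens (t + k)) g) (mulL2 m (D.dens t) g),
      coeFn_mulL2 (D.memLp_dens ht) g, coeFn_mulL2 (D.memLp_dens hk) g,
      coeFn_mulL2 (D.memLp_dens ht) (mulL2 m (D.derivF t) g),
      coeFn_mulL2 (hL.memLp_derivF hL0 ht) g] with x h1 h2 h3 h4 h5 h6 h7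
    rw [h1, Pi.add_apply, h2, Pi.smul_apply, h3, Pi.sub_apply, h4, h5, h6, h7, hq, smul_eq_mul]
    ring
  have hbd : ∀ k : ℝ, t + k ∈ Ioo 0 T → ∀ x, |q k x| ≤ Real.exp b * L + c * L := by
    intro k hk x
    refine (abs_add_le _ _).trans (add_le_add ?_ ?_)
    · rcases eq_or_ne k 0 with rfl | hk0
      · simp only [inv_zero, zero_mul, abs_zero]
        positivity
      rw [abs_mul, abs_inv, inv_mul_le_iff₀ (abs_pos.2 hk0)]
      refine (abs_exp_neg_sub_le (hb _ hk x) (hb t ht x)).trans ?_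
      have h1 := mul_le_mul_of_nonneg_left (hL.density t ht _ hk x) (Real.exp_pos b).le
      rw [add_sub_cancel_left] at h1
      linarith
    · rw [abs_mul, abs_of_pos (D.dens_pos t x)]
      exact mul_le_mul (hc t ht x) (hL.abs_derivF_le hL0 ht x) (abs_nonneg _) hc0.le
  -- The quotients q are bounded by the Lipschitz condition and tend to zero wherever f is
  -- differentiable in time, so dominated convergence gives the limit in L².
  have hlim : Tendsto (fun k => ∫ x, (q k x * g x) ^ 2 ∂m) (𝓝[≠] 0) (𝓝 0) := by
    suffices h : Tendsto (fun k => ∫ x, (q k x * g x) ^ 2 ∂m) (𝓝[≠] 0) (𝓝 (∫ _ : X, (0 : ℝ) ∂m)) by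
      simpa using h
    refine tendsto_integral_filter_of_dominated_convergence
      (fun x => (Real.exp b * L + c * L) ^ 2 * g x ^ 2) ?_ ?_
      ((Lp.memLp g).integrable_sq.const_mul _) ?_
    · filter_upwards [hnear] with k hk
      refine ((Measurable.aestronglyMeasurable ?_).mul (Lp.aestronglyMeasurable g)).pow 2
      exact (((D.measurable_dens hk).sub (D.measurable_dens ht)).const_mul _).add
        ((D.measurable_dens ht).mul (hL.measurable_derivF hL0 ht))
    · filter_upwards [hnear] with k hk
      refine Eventually.of_forall fun x => ?_
      rw [Real.norm_eq_abs, abs_of_nonneg (sq_nonneg _), mul_pow]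
      exact mul_le_mul_of_nonneg_right (sq_le_sq' (by linarith [(abs_le.1 (hbd k hk x)).1])
        (abs_le.1 (hbd k hk x)).2) (sq_nonneg _)
    · filter_upwards [hd] with x hx
      have h1 : HasDerivAt (fun r => D.dens r x) (-(D.dens t x * D.derivF t x)) t := by
        have h2 := hx.hasDerivAt.neg.exp
        rw [mul_neg] at h2
        exact h2
      have h3 := hasDerivAt_iff_tendsto_slope_zero.1 h1
      have h4 : Tendsto (fun k => q k x) (𝓝[≠] 0) (𝓝 0) := by
        simpa [hq] using h3.add_const (D.dens t x * D.derivF t x)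
      simpa using (h4.mul_const (g x)).pow 2
  have hs := hlim.sqrt
  rw [Real.sqrt_zero] at hs
  refine hs.congr' ?_
  filter_upwards [hnear] with k hk
  have : ∫ x, (q k x * g x) ^ 2 ∂m = ‖k⁻¹ • (mulL2 m (D.dens (t + k)) g - mulL2 m (D.dens t) g) -
        -mulL2 m (D.dens t) (mulL2 m (D.derivF t) g)‖ ^ 2 := by
    rw [norm_sq_eq_integral]
    refine integral_congr_ae ?_
    filter_upwards [hcoe k hk] with x hx
    rw [hx]
  rw [this, Real.sqrt_sq (norm_nonneg _)]

theorem IsLogLipschitz.continuousOn_mulL2 (hL : D.IsLogLipschitz L) :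
    ContinuousOn (fun t => mulL2 m (D.dens t)) (Ioo 0 T) := by
  obtain ⟨c, hc⟩ := hL.exists_norm_mulL2_sub_le
  have : LipschitzOnWith (Real.toNNReal c) (fun t => mulL2 m (D.dens t)) (Ioo 0 T) :=
    LipschitzOnWith.of_dist_le_mul fun t ht s hs => by
      rw [dist_eq_norm, Real.dist_eq]
      exact (hc s hs t ht).trans
        (mul_le_mul_of_nonneg_right (Real.le_coe_toNNReal c) (abs_nonneg _))
  exact this.continuousOn

/-- The term `∂_t f · v e^{-f_t}` belongs to `L²(H)`. -/
theorem IsLogLipschitz.memLp_source [SigmaFinite m] (hL : D.IsLogLipschitz L) (hL0 : 0 ≤ L)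
    {a b : ℝ} (hab : a ≤ b) (ha : 0 < a) (hb : b < T) {v : ℝ → Lp ℝ 2 m}
    (hv : ContinuousOn v (Icc a b)) :
    MemLp (fun t => mulL2 m (D.dens t) (mulL2 m (D.derivF t) (v t))) 2
      (volume.restrict (Ioo a b)) := by
  obtain ⟨c, hc0, hc, -⟩ := D.exists_dens_bound
  have hI : ∀ t ∈ Icc a b, t ∈ Ioo 0 T := fun t ht => ⟨ha.trans_le ht.1, ht.2.trans_lt hb⟩
  have hmeas : AEStronglyMeasurable (fun t => -mulL2 m (D.dens t) (mulL2 m (D.derivF t) (v t)))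
      (volume.restrict (Ioo a b)) := by
    -- Measurability in t comes from writing the source as an almost everywhere limit of forward
    -- difference quotients; the minimum with b keeps the shifted time inside [a, b].
    refine aestronglyMeasurable_of_tendsto_ae atTop
      (f := fun (n : ℕ) t => (1 / ((n : ℝ) + 1))⁻¹ •
        (mulL2 m (D.dens (min (t + 1 / ((n : ℝ) + 1)) b)) (v t) - mulL2 m (D.dens t) (v t)))
      (fun n => ?_) ?_
    · have hp : (0 : ℝ) < 1 / ((n : ℝ) + 1) := Nat.one_div_pos_of_nat
      have h1 : ContinuousOn (fun t => mulL2 m (D.dens (min (t + 1 / ((n : ℝ) + 1)) b)) (v t))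
          (Icc a b) := by
        refine ContinuousOn.clm_apply (hL.continuousOn_mulL2.comp
          (by fun_prop : Continuous fun t : ℝ => min (t + 1 / ((n : ℝ) + 1)) b).continuousOn
          fun t ht => hI _ ⟨le_min (by linarith [ht.1]) hab, min_le_right _ _⟩) hv
      have h2 : ContinuousOn (fun t => mulL2 m (D.dens t) (v t)) (Icc a b) :=
        (hL.continuousOn_mulL2.mono hI).clm_apply hv
      exact (((h1.sub h2).const_smul ((1 / ((n : ℝ) + 1))⁻¹)).mono Ioo_subset_Icc_self).aestronglyMeasurable
        measurableSet_Ioo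
    · filter_upwards [hL.ae_differentiableAt hL0 hab ha hb, ae_restrict_mem measurableSet_Ioo]
        with t h1 ht
      have h2 := hL.tendsto_quotient hL0 (hI t (Ioo_subset_Icc_self ht)) h1 (v t)
      have h3 : Tendsto (fun n : ℕ => 1 / ((n : ℝ) + 1)) atTop (𝓝[≠] 0) :=
        tendsto_nhdsWithin_iff.2 ⟨tendsto_one_div_add_atTop_nhds_zero_nat,
          Eventually.of_forall fun n => (Nat.one_div_pos_of_nat (α := ℝ)).ne'⟩
      refine (h2.comp h3).congr' ?_
      have h4 : ∀ᶠ n : ℕ in atTop, 1 / ((n : ℝ) + 1) < b - t :=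
        tendsto_one_div_add_atTop_nhds_zero_nat.eventually (Iio_mem_nhds (sub_pos.2 ht.2))
      filter_upwards [h4] with n hn
      simp only [Function.comp_apply]
      rw [min_eq_left (by linarith)]
  refine (memLp_of_continuousOn hv).of_le_mul (c := c * L) 
    (hmeas.neg.congr (Eventually.of_forall fun t => neg_neg _)) ?_
  filter_upwards [ae_restrict_mem measurableSet_Ioo] with t ht
  have htI := hI t (Ioo_subset_Icc_self ht)
  rw [mul_assoc]
  refine (norm_mulL2_apply_le (D.memLp_dens htI) (Eventually.of_forall fun x => ?_) _).trans
    (mul_le_mul_of_nonneg_left (norm_mulL2_apply_le (hL.memLp_derivF hL0 htI)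
      (Eventually.of_forall fun x => hL.abs_derivF_le hL0 htI x) _) hc0.le)
  rw [abs_of_pos (D.dens_pos t x)]
  exact hc t htI x

/-- The forms `E_t` and the weights `e^{-f_t}`, run through with speed at most one and scaled by an
exponential factor. -/
theorem IsLogLipschitz.evolutionFamily (hL : D.IsLogLipschitz L) (hΓ₀ : E.IsSquareField Γ₀)
    (hL0 : 0 ≤ L) {θ : ℝ → ℝ} {a b κ : ℝ} (hθ : LipschitzWith 1 θ)
    (hI : ∀ t ∈ Icc a b, θ t ∈ Ioo 0 T) (hκ : 3 * L ≤ κ) :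
    EvolutionFamily E.toL2 a b (fun t => Real.exp (-(κ * t)) • D.formL (θ t))
      (fun t => Real.exp (-(κ * t)) • mulL2 m (D.dens (θ t)))
      (fun t w => Real.exp (-(κ * t)) • D.mulDensity (θ t) w) := by
  have hκ0 : 0 ≤ κ := by linarith
  have hexp : Continuous fun t : ℝ => Real.exp (-(κ * t)) := by fun_prop
  have hθ' : ∀ s t, |θ t - θ s| ≤ |t - s| := fun s t => by
    simpa [Real.dist_eq] using hθ.dist_le_mul t s
  -- The factor e^{-κt} absorbs growth at any rate μ ≤ κ. It is used with μ = 3L for the forms and μ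
  -- = L for the density.
  have hcomb : ∀ s t, s ≤ t → ∀ μ, 0 ≤ μ → μ ≤ κ →
      Real.exp (-(κ * t)) * Real.exp (μ * |θ t - θ s|) ≤ Real.exp (-(κ * s)) := by
    intro s t hst μ hμ hμκ
    rw [← Real.exp_add, Real.exp_le_exp]
    have h1 := hθ' s t
    rw [abs_of_nonneg (sub_nonneg.2 hst)] at h1
    have h2 : μ * |θ t - θ s| ≤ κ * (t - s) := mul_le_mul hμκ h1 (abs_nonneg _) hκ0
    linarith
  obtain ⟨d, hd0, hd, hd1⟩ := D.exists_dens_bound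
  obtain ⟨c, hc0, hc⟩ := D.exists_norm_mulDensity_le hΓ₀
  refine ⟨?_, ?_, ?_, ?_, ?_, ?_, ?_, ?_, ?_, ?_⟩
  · exact hexp.continuousOn.smul ((hL.continuousOn_formL hΓ₀ hL0).comp
      hθ.continuous.continuousOn hI)
  · intro t ht u v
    simp only [_root_.smul_apply, D.formL_apply hΓ₀ (hI t ht), D.form_symm (hI t ht) u]
  · intro t ht u
    simp only [_root_.smul_apply, D.formL_apply hΓ₀ (hI t ht), smul_eq_mul]
    exact mul_nonneg (Real.exp_pos _).le (D.form_nonneg (hI t ht) u)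
  · intro s hs t ht hst u
    simp only [_root_.smul_apply, D.formL_apply hΓ₀ (hI t ht), D.formL_apply hΓ₀ (hI s hs),
      smul_eq_mul]
    refine (mul_le_mul_of_nonneg_left (hL.form_le hΓ₀ hL0 (hI s hs) (hI t ht) u)
      (Real.exp_pos _).le).trans ?_
    rw [← mul_assoc]
    exact mul_le_mul_of_nonneg_right (hcomb s t hst _ (by positivity) hκ)
      (D.form_nonneg (hI s hs) u)
  · exact hexp.continuousOn.smul (hL.continuousOn_mulL2.comp hθ.continuous.continuousOn hI)
  · intro t ht x y
    simp only [_root_.smul_apply, real_inner_smul_left, inner_mulL2 (D.memLp_dens (hI t ht))]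
    congr 2
    ext z
    ring
  · intro s hs t ht hst x
    simp only [_root_.smul_apply, real_inner_smul_left, inner_mulL2 (D.memLp_dens (hI t ht)),
      inner_mulL2 (D.memLp_dens (hI s hs))]
    rw [← integral_const_mul, ← integral_const_mul]
    refine integral_mono ((integrable_mul_L2 (D.memLp_dens (hI t ht)) x x).const_mul _)
      ((integrable_mul_L2 (D.memLp_dens (hI s hs)) x x).const_mul _) fun z => ?_
    have h1 := mul_le_mul_of_nonneg_left (hL.dens_le (hI s hs) (hI t ht) z)
      (Real.exp_pos (-(κ * t))).le
    have h2 := mul_le_mul_of_nonneg_right (hcomb s t hst L hL0 (by linarith))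
      (D.dens_pos (θ s) z).le
    have h3 := mul_le_mul_of_nonneg_right (h1.trans ((mul_assoc _ _ _).symm.le.trans h2))
      (mul_self_nonneg (x z))
    simp only
    linarith
  · refine ⟨Real.exp (-(κ * b)) * d⁻¹, by positivity, fun t ht x => ?_⟩
    simp only [_root_.smul_apply, real_inner_smul_left]
    rw [mul_assoc]
    refine mul_le_mul (Real.exp_le_exp.2 ?_) ?_ (by positivity) (Real.exp_pos _).le
    · linarith [mul_le_mul_of_nonneg_left ht.2 hκ0]
    · rw [inner_mulL2 (D.memLp_dens (hI t ht)), norm_sq_eq_integral, ← integral_const_mul]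
      refine integral_mono ((Lp.memLp x).integrable_sq.const_mul _)
        (integrable_mul_L2 (D.memLp_dens (hI t ht)) x x) fun z => ?_
      have h1 : d⁻¹ ≤ D.dens (θ t) z := by
        rw [inv_le_iff_one_le_mul₀' hd0]
        exact hd1 _ (hI t ht) z
      have h2 := mul_le_mul_of_nonneg_right h1 (sq_nonneg (x z))
      simp only
      linarith
  · intro t ht w
    rw [map_smul, D.toL2_mulDensity hΓ₀ (hI t ht)]
    rfl
  · refine ⟨Real.exp (-(κ * a)) * c, fun t ht w => ?_⟩
    rw [norm_smul, Real.norm_eq_abs, abs_of_pos (Real.exp_pos _), mul_assoc]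
    refine mul_le_mul (Real.exp_le_exp.2 ?_) (hc _ (hI t ht) w) (norm_nonneg _) (Real.exp_pos _).le
    linarith [mul_le_mul_of_nonneg_left ht.1 hκ0]

theorem exists_coercive (D : TimeDependentForm E Γ₀ T) (hΓ₀ : E.IsSquareField Γ₀) {t : ℝ}
    (ht : t ∈ Ioo 0 T) {e : ℝ} (he : 0 < e) :
    ∃ κ : ℝ, 0 < κ ∧ ∀ w, κ * ‖w‖ ^ 2 ≤ (e • D.formL t) w w + ‖E.toL2 w‖ ^ 2 := by
  obtain ⟨c, hc0, -, hc, -⟩ := D.exists_form_bounds hΓ₀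
  refine ⟨min 1 (e / c), lt_min one_pos (div_pos he hc0), fun w => ?_⟩
  simp only [_root_.smul_apply, D.formL_apply hΓ₀ ht, smul_eq_mul]
  rw [E.norm_sq_eq, mul_add]
  refine add_le_add ?_ ?_
  · calc min 1 (e / c) * E.bilin w w ≤ e / c * (c * D.form t w w) :=
          mul_le_mul (min_le_right _ _) (hc t ht w) (E.bilin_nonneg w) (div_pos he hc0).le
      _ = e * D.form t w w := by field_simp
  · exact (mul_le_mul_of_nonneg_right (min_le_left _ _) (sq_nonneg _)).trans (one_mul _).le

end TimeDependentForm

/-! ### Localisation in time. -/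

theorem setIntegral_Ioo_eq_of_support {V : Type*} [NormedAddCommGroup V] [NormedSpace ℝ V]
    {s τ a b : ℝ} (hsa : s ≤ a) (hbτ : b ≤ τ) {f : ℝ → V}
    (hf : ∀ t ∈ Ioo s τ, t ∉ Ioo a b → f t = 0) : ∫ t in Ioo s τ, f t = ∫ t in Ioo a b, f t :=
  setIntegral_eq_of_subset_of_forall_sdiff_eq_zero measurableSet_Ioo (Ioo_subset_Ioo hsa hbτ)
    fun t ht => hf t ht.1 ht.2

theorem eq_zero_of_tsupport_subset {φ : ℝ → ℝ} {S : Set ℝ} (h : tsupport φ ⊆ S) {t : ℝ}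
    (ht : t ∉ S) : φ t = 0 := image_eq_zero_of_notMem_tsupport fun h' => ht (h h')

theorem deriv_eq_zero_of_tsupport_subset {φ : ℝ → ℝ} {S : Set ℝ} (h : tsupport φ ⊆ S) {t : ℝ}
    (ht : t ∉ S) : deriv φ t = 0 :=
  image_eq_zero_of_notMem_tsupport fun h' => ht (h (tsupport_deriv_subset h'))

/-- Exhaustion by countably many inner intervals. It allows working away from the end points, which
may be 0 or T. -/
theorem ae_restrict_Ioo_of_forall {σ τ : ℝ} {P : ℝ → Prop}
    (h : ∀ a b, σ < a → a < b → b < τ → ∀ᵐ t ∂volume.restrict (Ioo a b), P t) :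
    ∀ᵐ t ∂volume.restrict (Ioo σ τ), P t := by
  rcases le_or_gt τ σ with hστ | hστ
  · simp [Ioo_eq_empty_of_le hστ]
  set c : ℝ := (σ + τ) / 2 with hc
  obtain ⟨a, -, ha, hat⟩ := exists_seq_strictAnti_tendsto' (show σ < c by linarith)
  obtain ⟨b, -, hb, hbt⟩ := exists_seq_strictMono_tendsto' (show c < τ by linarith)
  have hU : Ioo σ τ = ⋃ n, Ioo (a n) (b n) := by
    ext t
    simp only [mem_iUnion]
    constructor
    · intro ht
      obtain ⟨n, h1, h2⟩ := ((hat.eventually (Iio_mem_nhds ht.1)).and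
        (hbt.eventually (Ioi_mem_nhds ht.2))).exists
      exact ⟨n, h1, h2⟩
    · rintro ⟨n, h1, h2⟩
      exact ⟨(ha n).1.trans h1, h2.trans (hb n).2⟩
  rw [hU, ae_restrict_iUnion_iff]
  exact fun n => h _ _ (ha n).1 ((ha n).2.trans (hb n).1) (hb n).2

/-- The exceptional set of times depends on w, so w is first restricted to a countable dense set and
then freed by continuity. -/
theorem ae_forall_eq_zero {F : Type*} [TopologicalSpace F] [TopologicalSpace.SeparableSpace F]
    {ℓ : ℝ → F → ℝ} {a b : ℝ} (hi : ∀ w, IntegrableOn (fun t => ℓ t w) (Ioo a b))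
    (hc : ∀ t ∈ Ioo a b, Continuous (ℓ t))
    (h : ∀ w, ∀ η : ℝ → ℝ, ContDiff ℝ ∞ η → HasCompactSupport η → tsupport η ⊆ Ioo a b →
      ∫ t in Ioo a b, η t * ℓ t w = 0) :
    ∀ᵐ t ∂volume.restrict (Ioo a b), ∀ w, ℓ t w = 0 := by
  obtain ⟨S, hSc, hSd⟩ := TopologicalSpace.exists_countable_dense F
  have h1 : ∀ w ∈ S, ∀ᵐ t ∂volume.restrict (Ioo a b), ℓ t w = 0 := fun w _ => by
    have h2 := isOpen_Ioo.ae_eq_zero_of_integral_contDiff_smul_eq_zero (μ := volume)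
      (hi w).locallyIntegrableOn (fun η hη hηc hηs => by
        rw [← h w η hη hηc hηs]
        refine (setIntegral_eq_integral_of_forall_compl_eq_zero fun t ht => ?_).symm
        rw [eq_zero_of_tsupport_subset hηs ht, zero_smul])
    exact (ae_restrict_iff' measurableSet_Ioo).2 h2
  filter_upwards [(ae_ball_iff hSc).2 h1, ae_restrict_mem measurableSet_Ioo] with t ht htI
  exact congrFun (Continuous.ext_on hSd (hc t htI) continuous_const ht)

/-! ### Parabolic function spaces. -/

section Parabolic

variable {H F : Type*} [NormedAddCommGroup H] [InnerProductSpace ℝ H] [NormedAddCommGroup F]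
  [InnerProductSpace ℝ F]

/-- The space `L²((s, τ) → F) ∩ H¹((s, τ) → F*)` for an embedding `j : F → H`. -/
structure IsParabolic (j : F →L[ℝ] H) (s τ : ℝ) (u : ℝ → H) (U : ℝ → F)
    (dU : ℝ → StrongDual ℝ F) : Prop where
  continuousOn : ContinuousOn u (Icc s τ)
  ae_eq : ∀ᵐ t ∂volume.restrict (Ioo s τ), j (U t) = u t
  memLp : MemLp U 2 (volume.restrict (Ioo s τ))
  memLp_deriv : MemLp dU 2 (volume.restrict (Ioo s τ))
  weakDeriv : HasWeakDerivOn s τ (fun t => dualMap j (u t)) dU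

theorem integrable_dual_apply {Ω : Type*} [MeasurableSpace Ω] {μ : Measure Ω}
    {dU : Ω → StrongDual ℝ F} {y : Ω → F} (hdU : MemLp dU 2 μ) (hy : MemLp y 2 μ) :
    Integrable (fun t => dU t (y t)) μ :=
  integrable_bilin (ContinuousLinearMap.id ℝ (StrongDual ℝ F)) hdU hy

theorem integrable_form_apply {a b : ℝ} {A : ℝ → ContinuousForm F} (hA : ContinuousOn A (Icc a b))
    {U : ℝ → F} (hU : MemLp U 2 (volume.restrict (Ioo a b))) (w : F) :
    IntegrableOn (fun t => A t (U t) w) (Ioo a b) :=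
  ((ContinuousLinearMap.apply ℝ ℝ w).comp_memLp' (memLp_clm_apply hA hU)).integrable (by norm_num)

variable {j : F →L[ℝ] H} {s τ a b : ℝ} {u : ℝ → H} {U : ℝ → F} {dU : ℝ → StrongDual ℝ F}

theorem IsParabolic.mono (h : IsParabolic j s τ u U dU) (hsa : s ≤ a) (hbτ : b ≤ τ) :
    IsParabolic j a b u U dU := by
  have hsub := Ioo_subset_Ioo hsa hbτ
  have hle : volume.restrict (Ioo a b) ≤ volume.restrict (Ioo s τ) :=
    Measure.restrict_mono hsub le_rfl
  refine ⟨h.continuousOn.mono (Icc_subset_Icc hsa hbτ), ae_restrict_of_ae_restrict_of_subset hsub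
    h.ae_eq, h.memLp.mono_measure hle, h.memLp_deriv.mono_measure hle, fun φ hφ hφc hφs => ?_⟩
  rw [← setIntegral_Ioo_eq_of_support hsa hbτ fun t _ ht => by
      rw [deriv_eq_zero_of_tsupport_subset hφs ht, zero_smul],
    ← setIntegral_Ioo_eq_of_support hsa hbτ fun t _ ht => by
      rw [eq_zero_of_tsupport_subset hφs ht, zero_smul]]
  exact h.weakDeriv φ hφ hφc (hφs.trans hsub)

theorem IsParabolic.sub_eq_integral (h : IsParabolic j s τ u U dU) (hsτ : s < τ) {t : ℝ}
    (ht : t ∈ Icc s τ) : dualMap j (u t) - dualMap j (u s) = ∫ r in s..t, dU r :=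
  h.weakDeriv.sub_eq_integral hsτ ((dualMap j).continuous.comp_continuousOn h.continuousOn)
    (h.memLp_deriv.integrable (by norm_num)) ht

/-- Products η(t)w are admissible test functions; they suffice to read the weak equation at almost
every time. -/
theorem isParabolic_smul (j : F →L[ℝ] H) (hsτ : s < τ) {η : ℝ → ℝ} (hη : ContDiff ℝ ∞ η)
    (hηs : tsupport η ⊆ Ioo s τ) (w : F) :
    IsParabolic j s τ (fun t => η t • j w) (fun t => η t • w)
      (fun t => deriv η t • dualMap j (j w)) := by
  have hη1 : ContDiff ℝ 1 η := hη.of_le (by exact_mod_cast le_top)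
  have hηd : Continuous (deriv η) := hη1.continuous_deriv le_rfl
  refine ⟨(hη.continuous.smul continuous_const).continuousOn, Eventually.of_forall fun t => by simp,
    memLp_of_continuousOn (hη.continuous.smul continuous_const).continuousOn,
    memLp_of_continuousOn (hηd.smul continuous_const).continuousOn, fun φ hφ _ hφs => ?_⟩
  have key := integral_deriv_smul_primitive (a := s) (b := τ)
    (d := fun t => deriv η t • dualMap j (j w))
    ((hηd.smul continuous_const).intervalIntegrable _ _) (hφ.of_le (by exact_mod_cast le_top))
    (eq_zero_of_tsupport_subset hφs (by simp)) (eq_zero_of_tsupport_subset hφs (by simp))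
  have hprim : ∀ t, ∫ r in s..t, deriv η r • dualMap j (j w) = dualMap j (η t • j w) := by
    intro t
    rw [intervalIntegral.integral_smul_const, intervalIntegral.integral_deriv_eq_sub
      (fun x _ => hη1.differentiable one_ne_zero x) (hηd.intervalIntegrable _ _),
      eq_zero_of_tsupport_subset hηs (by simp : s ∉ Ioo s τ), sub_zero, map_smul]
  simp only [hprim] at key
  rwa [intervalIntegral.integral_of_le hsτ.le, intervalIntegral.integral_of_le hsτ.le,
    integral_Ioc_eq_integral_Ioo, integral_Ioc_eq_integral_Ioo] at key

end Parabolic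

theorem memParabolic_iff {s τ : ℝ} {u : ℝ → Lp ℝ 2 m} {U : ℝ → E.Dom}
    {dU : ℝ → StrongDual ℝ E.Dom} :
    MemParabolic E s τ u U dU ↔ IsParabolic E.toL2 s τ u U dU :=
  ⟨fun h => ⟨h.continuousOn, h.ae_eq, h.memLp, h.memLp_deriv, h.weakDeriv⟩,
    fun h => ⟨h.continuousOn, h.ae_eq, h.memLp, h.memLp_deriv, h.weakDeriv⟩⟩

/-! ### The heat equation and its adjoint in F* at almost every time. -/

namespace TimeDependentForm

variable {Γ₀ : E.Dom →ₗ[ℝ] E.Dom →ₗ[ℝ] Lp ℝ 1 m} {T : ℝ} {D : TimeDependentForm E Γ₀ T} {L : ℝ}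

/-- The term `∂_t f · v e^{-f_t}`. -/
def source (D : TimeDependentForm E Γ₀ T) (v : ℝ → Lp ℝ 2 m) (t : ℝ) : Lp ℝ 2 m :=
  mulL2 m (D.dens t) (mulL2 m (D.derivF t) (v t))

theorem IsLogLipschitz.inner_source (hL : D.IsLogLipschitz L) (hL0 : 0 ≤ L) {t : ℝ}
    (ht : t ∈ Ioo 0 T) (v : ℝ → Lp ℝ 2 m) (g : Lp ℝ 2 m) :
    ∫ x, v t x * g x * deriv (fun r => D.f r x) t ∂D.meas t = inner ℝ (D.source v t) g := by
  rw [source, inner_mulL2 (D.memLp_dens ht), D.integral_meas ht]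
  refine integral_congr_ae ?_
  filter_upwards [coeFn_mulL2 (hL.memLp_derivF hL0 ht) (v t)] with x hx
  rw [hx, derivF]
  ring

theorem continuous_mulDensity (D : TimeDependentForm E Γ₀ T) (hΓ₀ : E.IsSquareField Γ₀) {t : ℝ}
    (ht : t ∈ Ioo 0 T) : Continuous (D.mulDensity t) := by
  obtain ⟨c, hc0, hc⟩ := D.exists_norm_mulDensity_le hΓ₀
  refine (LipschitzWith.of_dist_le_mul (K := Real.toNNReal c) fun v w => ?_).continuous
  rw [dist_eq_norm, dist_eq_norm, ← D.mulDensity_sub hΓ₀ ht, Real.coe_toNNReal _ hc0]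
  exact hc t ht _

theorem IsLogLipschitz.memLp_mulDensity [SecondCountableTopology E.Dom] (hL : D.IsLogLipschitz L)
    (hΓ₀ : E.IsSquareField Γ₀) {a b : ℝ} (hI : Icc a b ⊆ Ioo 0 T) (w : E.Dom) :
    MemLp (fun t => D.mulDensity t w) 2 (volume.restrict (Ioo a b)) := by
  obtain ⟨c, hc0, hc⟩ := D.exists_norm_mulDensity_le hΓ₀
  refine MemLp.of_bound (aestronglyMeasurable_of_map E.toL2 E.toL2_injective ?_) (c * ‖w‖) ?_
  · have h1 : ContinuousOn (fun t => mulL2 m (D.dens t) (E.toL2 w)) (Icc a b) :=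
      (hL.continuousOn_mulL2.mono hI).clm_apply continuousOn_const
    refine ((h1.mono Ioo_subset_Icc_self).aestronglyMeasurable measurableSet_Ioo).congr ?_
    filter_upwards [ae_restrict_mem measurableSet_Ioo] with t ht
    exact (D.toL2_mulDensity hΓ₀ (hI (Ioo_subset_Icc_self ht)) w).symm
  · filter_upwards [ae_restrict_mem measurableSet_Ioo] with t ht
    exact hc t (hI (Ioo_subset_Icc_self ht)) w

section Equation

variable [SecondCountableTopology E.Dom] {s τ a b : ℝ} {u : ℝ → Lp ℝ 2 m} {U : ℝ → E.Dom}
  {dU : ℝ → StrongDual ℝ E.Dom}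

/-- The heat equation holds in `F*` at almost every time. -/
theorem IsHeatSolution.exists_ae_eq (h : D.IsHeatSolution s τ u) (hL : D.IsLogLipschitz L)
    (hΓ₀ : E.IsSquareField Γ₀) (hL0 : 0 ≤ L) (hs : 0 ≤ s) (hτ : τ ≤ T) :
    ∃ U dU, IsParabolic E.toL2 s τ u U dU ∧ ∀ a b, s ≤ a → a < b → b ≤ τ → 0 < a → b < T →
      ∀ᵐ t ∂volume.restrict (Ioo a b), ∀ w, dU t (D.mulDensity t w) = -D.formL t (U t) w := by
  obtain ⟨U, dU, hu', heq⟩ := h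
  have hu := memParabolic_iff.1 hu'
  refine ⟨U, dU, hu, fun a b hsa hab hbτ ha hb => ?_⟩
  have hI : Icc a b ⊆ Ioo 0 T := Icc_subset_Ioo ha hb
  have hI' : Ioo s τ ⊆ Ioo 0 T := Ioo_subset_Ioo hs hτ
  have hm := hu.mono hsa hbτ
  have h1 := fun w => integrable_dual_apply hm.memLp_deriv (hL.memLp_mulDensity hΓ₀ hI w)
  have h2 := integrable_form_apply ((hL.continuousOn_formL hΓ₀ hL0).mono hI) hm.memLp
  have key := ae_forall_eq_zero (ℓ := fun t w => dU t (D.mulDensity t w) + D.formL t (U t) w)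
    (fun w => (h1 w).add (h2 w)) (fun t ht => ?_) (fun w η hη hηc hηs => ?_)
  · filter_upwards [key] with t ht w
    linarith [ht w]
  · exact ((dU t).continuous.comp (D.continuous_mulDensity hΓ₀ (hI (Ioo_subset_Icc_self ht)))).add
      (D.formL t (U t)).continuous
  · have h3 := heq _ _ _ (memParabolic_iff.2 <| isParabolic_smul E.toL2 (hsa.trans_lt (hab.trans_le hbτ)) hη
      (hηs.trans (Ioo_subset_Ioo hsa hbτ)) w)
    have e1 : ∫ t in Ioo s τ, D.form t (U t) (η t • w) =
        ∫ t in Ioo a b, η t * D.formL t (U t) w := by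
      rw [setIntegral_congr_fun (g := fun t => η t * D.formL t (U t) w) measurableSet_Ioo fun t ht =>
        by simp only [← D.formL_apply hΓ₀ (hI' ht), map_smul, smul_eq_mul]]
      refine setIntegral_Ioo_eq_of_support hsa hbτ fun t _ ht => ?_
      rw [eq_zero_of_tsupport_subset hηs ht, zero_mul]
    have e2 : ∫ t in Ioo s τ, dU t (D.mulDensity t (η t • w)) =
        ∫ t in Ioo a b, η t * dU t (D.mulDensity t w) := by
      rw [setIntegral_congr_fun (g := fun t => η t * dU t (D.mulDensity t w)) measurableSet_Ioo
        fun t ht => by simp only [D.mulDensity_smul hΓ₀ (hI' ht), map_smul, smul_eq_mul]]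
      refine setIntegral_Ioo_eq_of_support hsa hbτ fun t _ ht => ?_
      rw [eq_zero_of_tsupport_subset hηs ht, zero_mul]
    rw [e1, e2] at h3
    have hη' : ∀ {f : ℝ → ℝ}, IntegrableOn f (Ioo a b) →
        IntegrableOn (fun t => η t * f t) (Ioo a b) := fun hf => by
      obtain ⟨C, hC⟩ := hηc.exists_bound_of_continuous hη.continuous
      exact Integrable.bdd_mul hf hη.continuous.aestronglyMeasurable (Eventually.of_forall hC)
    simp only [mul_add]
    rw [integral_add (hη' (h1 w)) (hη' (h2 w))]
    linarith

/-- The adjoint heat equation holds in `F*` at almost every time. -/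
theorem IsAdjointHeatSolution.exists_ae_eq [SigmaFinite m] (h : D.IsAdjointHeatSolution s τ u)
    (hL : D.IsLogLipschitz L) (hΓ₀ : E.IsSquareField Γ₀) (hL0 : 0 ≤ L) (hs : 0 ≤ s) (hτ : τ ≤ T) :
    ∃ U dU, IsParabolic E.toL2 s τ u U dU ∧ ∀ a b, s ≤ a → a < b → b ≤ τ → 0 < a → b < T →
      ∀ᵐ t ∂volume.restrict (Ioo a b), ∀ w,
        dU t (D.mulDensity t w) = D.formL t (U t) w + inner ℝ (D.source u t) (E.toL2 w) := by
  obtain ⟨U, dU, hu', heq⟩ := h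
  have hu := memParabolic_iff.1 hu'
  refine ⟨U, dU, hu, fun a b hsa hab hbτ ha hb => ?_⟩
  have hI : Icc a b ⊆ Ioo 0 T := Icc_subset_Ioo ha hb
  have hI' : Ioo s τ ⊆ Ioo 0 T := Ioo_subset_Ioo hs hτ
  have hm := hu.mono hsa hbτ
  have h1 := fun w => integrable_dual_apply hm.memLp_deriv (hL.memLp_mulDensity hΓ₀ hI w)
  have h2 := integrable_form_apply ((hL.continuousOn_formL hΓ₀ hL0).mono hI) hm.memLp
  have h4 : ∀ w : E.Dom,
      IntegrableOn (fun t => inner ℝ (D.source u t) (E.toL2 w)) (Ioo a b) := fun w =>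
    integrable_bilin (innerSL ℝ) (hL.memLp_source hL0 hab.le ha hb hm.continuousOn)
      (memLp_const (E.toL2 w))
  have key := ae_forall_eq_zero (ℓ := fun t w => dU t (D.mulDensity t w) -
      (D.formL t (U t) w + inner ℝ (D.source u t) (E.toL2 w)))
    (fun w => (h1 w).sub ((h2 w).add (h4 w))) (fun t ht => ?_) (fun w η hη hηc hηs => ?_)
  · filter_upwards [key] with t ht w
    linarith [ht w]
  · exact ((dU t).continuous.comp (D.continuous_mulDensity hΓ₀ (hI (Ioo_subset_Icc_self ht)))).sub
      ((D.formL t (U t)).continuous.add (continuous_const.inner E.toL2.continuous))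
  · have h3 := heq _ _ _ (memParabolic_iff.2 <| isParabolic_smul E.toL2 (hsa.trans_lt (hab.trans_le hbτ)) hη
      (hηs.trans (Ioo_subset_Ioo hsa hbτ)) w)
    have e1 : ∫ t in Ioo s τ, D.form t (U t) (η t • w) =
        ∫ t in Ioo a b, η t * D.formL t (U t) w := by
      rw [setIntegral_congr_fun (g := fun t => η t * D.formL t (U t) w) measurableSet_Ioo fun t ht =>
        by simp only [← D.formL_apply hΓ₀ (hI' ht), map_smul, smul_eq_mul]]
      refine setIntegral_Ioo_eq_of_support hsa hbτ fun t _ ht => ?_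
      rw [eq_zero_of_tsupport_subset hηs ht, zero_mul]
    have e2 : ∫ t in Ioo s τ, dU t (D.mulDensity t (η t • w)) =
        ∫ t in Ioo a b, η t * dU t (D.mulDensity t w) := by
      rw [setIntegral_congr_fun (g := fun t => η t * dU t (D.mulDensity t w)) measurableSet_Ioo
        fun t ht => by simp only [D.mulDensity_smul hΓ₀ (hI' ht), map_smul, smul_eq_mul]]
      refine setIntegral_Ioo_eq_of_support hsa hbτ fun t _ ht => ?_
      rw [eq_zero_of_tsupport_subset hηs ht, zero_mul]
    have e3 : ∫ t in Ioo s τ, ∫ x, u t x * (η t • E.toL2 w) x * deriv (fun r => D.f r x) t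
          ∂D.meas t = ∫ t in Ioo a b, η t * inner ℝ (D.source u t) (E.toL2 w) := by
      rw [setIntegral_congr_fun (g := fun t => η t * inner ℝ (D.source u t) (E.toL2 w))
        measurableSet_Ioo fun t ht => by
          simp only [hL.inner_source hL0 (hI' ht), real_inner_smul_right]]
      refine setIntegral_Ioo_eq_of_support hsa hbτ fun t _ ht => ?_
      rw [eq_zero_of_tsupport_subset hηs ht, zero_mul]
    rw [e1, e2, e3] at h3
    have hη' : ∀ {f : ℝ → ℝ}, IntegrableOn f (Ioo a b) →
        IntegrableOn (fun t => η t * f t) (Ioo a b) := fun hf => by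
      obtain ⟨C, hC⟩ := hηc.exists_bound_of_continuous hη.continuous
      exact Integrable.bdd_mul hf hη.continuous.aestronglyMeasurable (Eventually.of_forall hC)
    simp only [mul_sub, mul_add]
    have h5 := integral_add (hη' (h2 w)) (hη' (h4 w))
    have h6 := integral_sub (hη' (h1 w)) ((hη' (h2 w)).add (hη' (h4 w)))
    simp only [Pi.add_apply] at h5 h6
    linarith

end Equation

end TimeDependentForm

/-! ### Time reversal. -/

section Reversal

theorem measurePreserving_neg_Ioo (a b : ℝ) : MeasurePreserving (fun r : ℝ => -r)
    (volume.restrict (Ioo (-b) (-a))) (volume.restrict (Ioo a b)) := by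
  have h := (Measure.measurePreserving_neg (volume : Measure ℝ)).restrict_preimage
    (measurableSet_Ioo (a := a) (b := b))
  have e : (Neg.neg ⁻¹' Ioo a b : Set ℝ) = Ioo (-b) (-a) := by
    ext t
    simp only [mem_preimage, mem_Ioo]
    constructor <;> intro h <;> constructor <;> linarith [h.1, h.2]
  rwa [e] at h

theorem memLp_comp_neg {V : Type*} [NormedAddCommGroup V] {a b : ℝ} {f : ℝ → V}
    (hf : MemLp f 2 (volume.restrict (Ioo a b))) :
    MemLp (fun r => f (-r)) 2 (volume.restrict (Ioo (-b) (-a))) :=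
  hf.comp_measurePreserving (measurePreserving_neg_Ioo a b)

theorem ae_comp_neg {a b : ℝ} {P : ℝ → Prop} (h : ∀ᵐ t ∂volume.restrict (Ioo a b), P t) :
    ∀ᵐ r ∂volume.restrict (Ioo (-b) (-a)), P (-r) :=
  (measurePreserving_neg_Ioo a b).quasiMeasurePreserving.ae h

theorem exists_mem_Ioo_of_ae {a b : ℝ} (hab : a < b) {P : ℝ → Prop}
    (h : ∀ᵐ t ∂volume.restrict (Ioo a b), P t) : ∃ t ∈ Ioo a b, P t := by
  have : NeZero (volume.restrict (Ioo a b)) := ⟨by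
    rw [Ne, Measure.restrict_eq_zero]
    simp [hab]⟩
  obtain ⟨t, ht, h'⟩ := ((ae_restrict_mem measurableSet_Ioo).and h).exists
  exact ⟨t, ht, h'⟩

variable {H F : Type*} [NormedAddCommGroup H] [InnerProductSpace ℝ H] [NormedAddCommGroup F]
  [InnerProductSpace ℝ F] {j : F →L[ℝ] H} {a b : ℝ} {u : ℝ → H} {U : ℝ → F}
  {dU : ℝ → StrongDual ℝ F}

theorem memLp_exp_smul {κ : ℝ} {x : ℝ → H} (hx : MemLp x 2 (volume.restrict (Ioo a b))) :
    MemLp (fun t => Real.exp (-(κ * t)) • x t) 2 (volume.restrict (Ioo a b)) := by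
  have hc : Continuous fun t : ℝ => Real.exp (-(κ * t)) • ContinuousLinearMap.id ℝ H := by fun_prop
  exact memLp_clm_apply hc.continuousOn hx

theorem IsParabolic.reverse_sub_eq (h : IsParabolic j a b u U dU) (hab : a < b) {r : ℝ}
    (hr : r ∈ Icc (-b) (-a)) :
    dualMap j (u (-r)) - dualMap j (u (- -b)) = ∫ x in (-b)..r, -dU (-x) := by
  have hr' : -r ∈ Icc a b := ⟨by linarith [hr.2], by linarith [hr.1]⟩
  have h1 := h.sub_eq_integral hab hr'
  have h2 := h.sub_eq_integral hab (right_mem_Icc.2 hab.le)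
  have h3 := intervalIntegral.integral_interval_sub_left
    (intervalIntegrable_of_memLp hab.le h.memLp_deriv hr')
    (intervalIntegrable_of_memLp hab.le h.memLp_deriv (right_mem_Icc.2 hab.le))
  rw [intervalIntegral.integral_comp_neg fun x => -dU x, intervalIntegral.integral_neg, neg_neg,
    intervalIntegral.integral_symm, neg_neg, ← h3, ← h1, ← h2]
  abel

/-- The regularity theorem for solutions of a backward equation. -/
theorem EvolutionFamily.exists_deriv_reverse [CompleteSpace H] [CompleteSpace F]
    [SecondCountableTopology F] {α : ℝ → ContinuousForm F} {R : ℝ → H →L[ℝ] H} {M : ℝ → F → F}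
    (hE : EvolutionFamily j (-b) (-a) α R M) (hab : a < b) (hj : Function.Injective j)
    (h : IsParabolic j a b u U dU) {x₀ : F} (hx₀ : j x₀ = u b) {p : ℝ → H}
    (hp : MemLp p 2 (volume.restrict (Ioo (-b) (-a))))
    (heq : ∀ᵐ r ∂volume.restrict (Ioo (-b) (-a)), ∀ w,
      (-dU (-r)) (M r w) = -α r (U (-r)) w - inner ℝ (p r) (j w)) :
    ∃ g : ℝ → H, MemLp g 2 (volume.restrict (Ioo (-b) (-a))) ∧
      (∀ r ∈ Icc (-b) (-a), u (-r) - u b = ∫ x in (-b)..r, g x) ∧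
      ∀ᵐ r ∂volume.restrict (Ioo (-b) (-a)), -dU (-r) = dualMap j (g r) := by
  have hmaps : MapsTo (fun r : ℝ => -r) (Icc (-b) (-a)) (Icc a b) := fun r hr =>
    ⟨by linarith [hr.2], by linarith [hr.1]⟩
  obtain ⟨g, hg, -, hgu, hgd⟩ := hE.exists_deriv (u := fun r => u (-r)) (U := fun r => U (-r))
    (dU := fun r => -dU (-r)) (by linarith) hj (h.continuousOn.comp continuousOn_neg hmaps)
    (by rw [hx₀, neg_neg]) (memLp_comp_neg h.memLp) (ae_comp_neg h.ae_eq)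
    (memLp_comp_neg h.memLp_deriv).neg (fun r hr => h.reverse_sub_eq hab hr) hp heq
  exact ⟨g, hg, by simpa only [neg_neg] using hgu, hgd⟩

/-- The regularity theorem for solutions of a forward equation without source. -/
theorem EvolutionFamily.exists_deriv_forward [CompleteSpace H] [CompleteSpace F]
    [SecondCountableTopology F] {α : ℝ → ContinuousForm F} {R : ℝ → H →L[ℝ] H} {M : ℝ → F → F}
    (hE : EvolutionFamily j a b α R M) (hab : a < b) (hj : Function.Injective j)
    (h : IsParabolic j a b u U dU) {x₀ : F} (hx₀ : j x₀ = u a)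
    (heq : ∀ᵐ t ∂volume.restrict (Ioo a b), ∀ w, dU t (M t w) = -α t (U t) w) :
    ∃ g : ℝ → H, MemLp g 2 (volume.restrict (Ioo a b)) ∧ HasWeakDerivOn a b u g ∧
      (∀ t ∈ Icc a b, u t - u a = ∫ x in a..t, g x) ∧
      ∀ᵐ t ∂volume.restrict (Ioo a b), dU t = dualMap j (g t) :=
  hE.exists_deriv hab hj h.continuousOn hx₀ h.memLp h.ae_eq h.memLp_deriv
    (fun _ ht => h.sub_eq_integral hab ht) (p := fun _ => 0) (memLp_const 0)
    (by simpa only [inner_zero_left, sub_zero] using heq)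

end Reversal

theorem inner_mulL2_comm {ρ : X → ℝ} (h : MemLp ρ ⊤ m) (f g : Lp ℝ 2 m) :
    inner ℝ f (mulL2 m ρ g) = inner ℝ (mulL2 m ρ f) g := by
  rw [real_inner_comm, inner_mulL2 h, inner_mulL2 h]
  congr 1
  ext x
  ring

/-! ### Generators, and regularity of solutions. -/

namespace TimeDependentForm

variable {Γ₀ : E.Dom →ₗ[ℝ] E.Dom →ₗ[ℝ] Lp ℝ 1 m} {T : ℝ} {D : TimeDependentForm E Γ₀ T} {L : ℝ}

theorem inner_dens (D : TimeDependentForm E Γ₀ T) {t : ℝ} (ht : t ∈ Ioo 0 T) (f g : Lp ℝ 2 m) :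
    inner ℝ (mulL2 m (D.dens t) f) g = ∫ x, f x * g x ∂D.meas t := by
  rw [inner_mulL2 (D.memLp_dens ht), D.integral_meas ht]
  simp only [mul_assoc]

theorem inner_dens_self (D : TimeDependentForm E Γ₀ T) {t : ℝ} (ht : t ∈ Ioo 0 T)
    (f : Lp ℝ 2 m) : inner ℝ (mulL2 m (D.dens t) f) f = ∫ x, |f x| ^ 2 ∂D.meas t := by
  rw [D.inner_dens ht]
  simp only [sq, abs_mul_abs_self]

theorem isGenerator_of_formL (hΓ₀ : E.IsSquareField Γ₀) {t : ℝ} (ht : t ∈ Ioo 0 T)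
    {u g : Lp ℝ 2 m} {u' : E.Dom} (hu : E.toL2 u' = u)
    (h : ∀ w, D.formL t u' w = -inner ℝ (mulL2 m (D.dens t) g) (E.toL2 w)) :
    D.IsGenerator t u g :=
  ⟨u', hu, fun v => by rw [← D.formL_apply hΓ₀ ht, h, D.inner_dens ht]⟩

/-- F is dense in L² and the density is strictly positive. -/
theorem IsGenerator.unique {t : ℝ} (ht : t ∈ Ioo 0 T) {u g g' : Lp ℝ 2 m}
    (h : D.IsGenerator t u g) (h' : D.IsGenerator t u g') : g = g' := by
  obtain ⟨x, hx, hxg⟩ := h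
  obtain ⟨y, hy, hyg⟩ := h'
  obtain rfl : x = y := E.toL2_injective (hx.trans hy.symm)
  have h1 : ∀ v : E.Dom, inner ℝ (mulL2 m (D.dens t) (g - g')) (E.toL2 v) = 0 := fun v => by
    have h2 := (hxg v).symm.trans (hyg v)
    rw [← D.inner_dens ht, ← D.inner_dens ht] at h2
    rw [map_sub, inner_sub_left]
    linarith
  have h3 : mulL2 m (D.dens t) (g - g') = 0 := by
    have h4 := E.denseRange_toL2.induction_on
      (p := fun z => inner ℝ (mulL2 m (D.dens t) (g - g')) z = 0)
      (mulL2 m (D.dens t) (g - g'))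
      (isClosed_eq (continuous_const.inner continuous_id) continuous_const) h1
    exact inner_self_eq_zero.1 h4
  rw [← sub_eq_zero]
  refine Lp.ext ?_
  have h5 := coeFn_mulL2 (D.memLp_dens ht) (g - g')
  rw [h3] at h5
  filter_upwards [h5, Lp.coeFn_zero ℝ 2 m] with x h6 h7
  rw [h7] at h6 ⊢
  exact (mul_eq_zero.1 h6.symm).resolve_left (D.dens_pos t x).ne'

theorem IsGenerator.A_eq {t : ℝ} (ht : t ∈ Ioo 0 T) {u g : Lp ℝ 2 m} (h : D.IsGenerator t u g) :
    D.A t u = g :=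
  (D.isGenerator_A ⟨g, h⟩).unique ht h

section Regularity

variable [SecondCountableTopology E.Dom] {a b κ : ℝ} {u : ℝ → Lp ℝ 2 m} {U : ℝ → E.Dom}
  {dU : ℝ → StrongDual ℝ E.Dom}

/-- The factor e^{-3Lt} makes the forms monotone and cancels from the equation. Once ∂_t u is in H,
its pairing with w e^{-f_t} is an integral against m_t, so g_t takes the place of A_t u_t. -/
theorem IsLogLipschitz.exists_deriv_forward (hL : D.IsLogLipschitz L) (hΓ₀ : E.IsSquareField Γ₀)
    (hL0 : 0 ≤ L) (ha : 0 < a) (hab : a < b) (hb : b < T) (hu : IsParabolic E.toL2 a b u U dU)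
    (heq : ∀ᵐ t ∂volume.restrict (Ioo a b), ∀ w,
      dU t (D.mulDensity t w) = -D.formL t (U t) w) {x₀ : E.Dom} (hx₀ : E.toL2 x₀ = u a) :
    ∃ g : ℝ → Lp ℝ 2 m, MemLp g 2 (volume.restrict (Ioo a b)) ∧ HasWeakDerivOn a b u g ∧
      (∀ t ∈ Icc a b, u t - u a = ∫ x in a..t, g x) ∧
      ∀ᵐ t ∂volume.restrict (Ioo a b), ∀ w,
        D.formL t (U t) w = -inner ℝ (mulL2 m (D.dens t) (g t)) (E.toL2 w) := by
  have hI : Icc a b ⊆ Ioo 0 T := Icc_subset_Ioo ha hb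
  obtain ⟨g, hg, hgw, hgu, hgd⟩ := (hL.evolutionFamily hΓ₀ hL0 (θ := fun t => t) LipschitzWith.id hI
    le_rfl).exists_deriv_forward hab E.toL2_injective hu hx₀ (by
      filter_upwards [heq] with t ht w
      rw [map_smul, ht w]
      simp)
  refine ⟨g, hg, hgw, hgu, ?_⟩
  filter_upwards [hgd, heq, ae_restrict_mem measurableSet_Ioo] with t h1 h2 ht w
  have htI := hI (Ioo_subset_Icc_self ht)
  have h3 := h2 w
  rw [h1, dualMap_apply, D.toL2_mulDensity hΓ₀ htI, inner_mulL2_comm (D.memLp_dens htI)] at h3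
  linarith

/-- In reversed time r = -t the adjoint equation is a forward equation with source ∂_t f · v
e^{-f_t}. Here g is the derivative in r, that is, -∂_t v. -/
theorem IsLogLipschitz.exists_deriv_reverse [SigmaFinite m] (hL : D.IsLogLipschitz L)
    (hΓ₀ : E.IsSquareField Γ₀) (hL0 : 0 ≤ L) (ha : 0 < a) (hab : a < b) (hb : b < T)
    (hu : IsParabolic E.toL2 a b u U dU)
    (heq : ∀ᵐ t ∂volume.restrict (Ioo a b), ∀ w,
      dU t (D.mulDensity t w) = D.formL t (U t) w + inner ℝ (D.source u t) (E.toL2 w))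
    {x₀ : E.Dom} (hx₀ : E.toL2 x₀ = u b) :
    ∃ g : ℝ → Lp ℝ 2 m, MemLp g 2 (volume.restrict (Ioo (-b) (-a))) ∧
      (∀ r ∈ Icc (-b) (-a), u (-r) - u b = ∫ x in (-b)..r, g x) ∧
      ∀ᵐ r ∂volume.restrict (Ioo (-b) (-a)), ∀ w, D.formL (-r) (U (-r)) w =
        -inner ℝ (mulL2 m (D.dens (-r)) (g r) + D.source u (-r)) (E.toL2 w) := by
  have hI : ∀ r ∈ Icc (-b) (-a), -r ∈ Ioo 0 T := fun r hr =>
    ⟨by linarith [hr.2], by linarith [hr.1]⟩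
  have hsrc := memLp_comp_neg (hL.memLp_source hL0 hab.le ha hb hu.continuousOn)
  obtain ⟨g, hg, hgu, hgd⟩ := (hL.evolutionFamily hΓ₀ hL0 (θ := fun t => -t) LipschitzWith.id.neg hI
    le_rfl).exists_deriv_reverse hab E.toL2_injective hu hx₀ (memLp_exp_smul (κ := 3 * L) hsrc) (by
      filter_upwards [ae_comp_neg heq] with r hr w
      rw [map_smul, _root_.neg_apply, hr w, real_inner_smul_left]
      simp only [_root_.smul_apply, smul_eq_mul, source]
      ring)
  refine ⟨g, hg, hgu, ?_⟩
  filter_upwards [hgd, ae_comp_neg heq, ae_restrict_mem measurableSet_Ioo] with r h1 h2 hr w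
  have hrI := hI r (Ioo_subset_Icc_self hr)
  have h3 := h2 w
  rw [neg_eq_iff_eq_neg.1 h1, _root_.neg_apply, dualMap_apply, D.toL2_mulDensity hΓ₀ hrI,
    inner_mulL2_comm (D.memLp_dens hrI)] at h3
  rw [inner_add_left]
  linarith

/-- Solutions of the heat equation are in the domain of the generators. -/
theorem IsHeatSolution.ae_mem_domA {s τ : ℝ} (h : D.IsHeatSolution s τ u) (hL : D.IsLogLipschitz L)
    (hΓ₀ : E.IsSquareField Γ₀) (hL0 : 0 ≤ L) (hs : 0 ≤ s) (hτ : τ ≤ T) :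
    ∀ᵐ t ∂volume.restrict (Ioo s τ), u t ∈ D.domA t := by
  obtain ⟨U, dU, hu, heq⟩ := h.exists_ae_eq hL hΓ₀ hL0 hs hτ
  refine ae_restrict_Ioo_of_forall fun a b hsa hab hbτ => ?_
  -- Almost every time has u in F, so the regularity theorem can be started from some a' between s
  -- and a.
  obtain ⟨a', ha', hUa⟩ := exists_mem_Ioo_of_ae hsa (ae_restrict_of_ae_restrict_of_subset
    (Ioo_subset_Ioo le_rfl (hab.trans hbτ).le) hu.ae_eq)
  have ha0 : 0 < a' := hs.trans_lt ha'.1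
  have hab' : a' < b := ha'.2.trans hab
  have hm := hu.mono ha'.1.le hbτ.le
  obtain ⟨g, -, -, -, hg⟩ := hL.exists_deriv_forward hΓ₀ hL0 ha0 hab' (hbτ.trans_le hτ) hm
    (heq a' b ha'.1.le hab' hbτ.le ha0 (hbτ.trans_le hτ)) hUa
  refine ae_restrict_of_ae_restrict_of_subset (Ioo_subset_Ioo ha'.2.le le_rfl) ?_
  filter_upwards [hg, hm.ae_eq, ae_restrict_mem measurableSet_Ioo] with t h1 h2 ht
  exact ⟨g t, isGenerator_of_formL hΓ₀ ⟨ha0.trans ht.1, ht.2.trans (hbτ.trans_le hτ)⟩ h2 h1⟩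

/-- Solutions of the adjoint heat equation are in the domain of the generators. -/
theorem IsAdjointHeatSolution.ae_mem_domA [SigmaFinite m] {s τ : ℝ}
    (h : D.IsAdjointHeatSolution s τ u) (hL : D.IsLogLipschitz L)
    (hΓ₀ : E.IsSquareField Γ₀) (hL0 : 0 ≤ L) (hs : 0 ≤ s) (hτ : τ ≤ T) :
    ∀ᵐ t ∂volume.restrict (Ioo s τ), u t ∈ D.domA t := by
  obtain ⟨U, dU, hu, heq⟩ := h.exists_ae_eq hL hΓ₀ hL0 hs hτ
  refine ae_restrict_Ioo_of_forall fun a b hsa hab hbτ => ?_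
  -- The adjoint equation runs backwards, so its starting time b' with value in F is chosen to the
  -- right of b.
  obtain ⟨b', hb', hUb⟩ := exists_mem_Ioo_of_ae hbτ (ae_restrict_of_ae_restrict_of_subset
    (Ioo_subset_Ioo (hsa.trans hab).le le_rfl) hu.ae_eq)
  have ha0 : 0 < a := hs.trans_lt hsa
  have hbT : b' < T := hb'.2.trans_le hτ
  have hab' : a < b' := hab.trans hb'.1
  have hm := hu.mono hsa.le hb'.2.le
  obtain ⟨g, -, -, hg⟩ := hL.exists_deriv_reverse hΓ₀ hL0 ha0 hab' hbT hm
    (heq a b' hsa.le hab' hb'.2.le ha0 hbT) hUb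
  refine ae_restrict_of_ae_restrict_of_subset (Ioo_subset_Ioo le_rfl hb'.1.le) ?_
  have hg' := ae_comp_neg hg
  rw [neg_neg, neg_neg] at hg'
  filter_upwards [hg', hm.ae_eq, ae_restrict_mem measurableSet_Ioo] with t h1 h2 ht
  -- The adjoint equation reads A_t v = -∂_t v + ∂_t f · v, and g(-t) is -∂_t v.
  refine ⟨g (-t) + mulL2 m (D.derivF t) (u t),
    isGenerator_of_formL hΓ₀ ⟨ha0.trans ht.1, ht.2.trans hbT⟩ h2 fun w => ?_⟩
  have h3 := h1 w
  rw [neg_neg] at h3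
  rw [h3, map_add]
  rfl

end Regularity

end TimeDependentForm

/-! ### Energy estimates for the two equations. -/

namespace TimeDependentForm

variable {Γ₀ : E.Dom →ₗ[ℝ] E.Dom →ₗ[ℝ] Lp ℝ 1 m} {T : ℝ} {D : TimeDependentForm E Γ₀ T} {L : ℝ}

section Energy

variable {a b : ℝ} {u g : ℝ → Lp ℝ 2 m} {U : ℝ → E.Dom} {dU : ℝ → StrongDual ℝ E.Dom}

theorem IsLogLipschitz.memLp_dens_apply (hL : D.IsLogLipschitz L) {θ : ℝ → ℝ} (hθ : Continuous θ)
    (hI : ∀ t ∈ Icc a b, θ t ∈ Ioo 0 T) (hg : MemLp g 2 (volume.restrict (Ioo a b))) :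
    MemLp (fun t => mulL2 m (D.dens (θ t)) (g t)) 2 (volume.restrict (Ioo a b)) :=
  memLp_clm_apply (hL.continuousOn_mulL2.comp hθ.continuousOn hI) hg

/-- The energy estimate for the heat equation. -/
theorem IsLogLipschitz.exists_energy_le_forward (hL : D.IsLogLipschitz L)
    (hΓ₀ : E.IsSquareField Γ₀) (hL0 : 0 ≤ L) (ha : 0 < a) (hab : a < b) (hb : b < T)
    (hu : IsParabolic E.toL2 a b u U dU) {x₀ : E.Dom} (hx₀ : E.toL2 x₀ = u a)
    (hg : MemLp g 2 (volume.restrict (Ioo a b)))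
    (hgu : ∀ t ∈ Icc a b, u t - u a = ∫ x in a..t, g x)
    (hgen : ∀ᵐ t ∂volume.restrict (Ioo a b), ∀ w,
      D.formL t (U t) w = -inner ℝ (mulL2 m (D.dens t) (g t)) (E.toL2 w)) :
    IntegrableOn (fun t => Real.exp (-(3 * L * t)) * ∫ x, |g t x| ^ 2 ∂D.meas t) (Ioo a b) ∧
    ∃ x : E.Dom, E.toL2 x = u b ∧ Real.exp (-(3 * L * b)) * D.form b x x +
        2 * ∫ t in Ioo a b, Real.exp (-(3 * L * t)) * ∫ x, |g t x| ^ 2 ∂D.meas t ≤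
      Real.exp (-(3 * L * a)) * D.form a x₀ x₀ := by
  have hI : Icc a b ⊆ Ioo 0 T := Icc_subset_Ioo ha hb
  have hE := hL.evolutionFamily hΓ₀ hL0 (θ := fun t => t) LipschitzWith.id hI le_rfl
  obtain ⟨κ, hκ, hκα⟩ := D.exists_coercive hΓ₀ (hI (right_mem_Icc.2 hab.le))
    (Real.exp_pos (-(3 * L * b)))
  have hG := memLp_exp_smul (κ := 3 * L) (hL.memLp_dens_apply continuous_id hI hg)
  have hint : ∀ᵐ t ∂volume.restrict (Ioo a b),
      inner ℝ (g t) (Real.exp (-(3 * L * t)) • mulL2 m (D.dens t) (g t)) =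
        Real.exp (-(3 * L * t)) * ∫ x, |g t x| ^ 2 ∂D.meas t := by
    filter_upwards [ae_restrict_mem measurableSet_Ioo] with t ht
    rw [real_inner_smul_right, real_inner_comm, D.inner_dens_self (hI (Ioo_subset_Icc_self ht))]
  refine ⟨(integrable_bilin (innerSL ℝ) hg hG).congr hint, ?_⟩
  -- No L² term is needed, so N = 0. The integrand 2⟨g, -G⟩ is then -2e^{-3Lt}∫ g² dm_t.
  obtain ⟨x, hx, hle⟩ := exists_energy_le hab hE.form_cont hE.form_symm hE.form_nonneg hE.form_anti
    hκ hκα (Λ := 0) (N := fun _ => 0) (by simp) (by simp) (by simp) hg hgu hu.continuousOn hx₀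
    hu.memLp hu.ae_eq hG (by
      filter_upwards [hgen] with t ht w
      simp only [_root_.smul_apply, ht w, smul_eq_mul, id_eq, real_inner_smul_left]
      ring) (n := fun _ => 0) (by simp)
  refine ⟨x, hx, ?_⟩
  have h1 : ∫ t in Ioo a b, inner ℝ (g t) ((2 : ℝ) • ((0 : Lp ℝ 2 m →L[ℝ] Lp ℝ 2 m) (u t) -
      Real.exp (-(3 * L * t)) • mulL2 m (D.dens t) (g t))) =
      -(2 * ∫ t in Ioo a b, Real.exp (-(3 * L * t)) * ∫ x, |g t x| ^ 2 ∂D.meas t) := by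
    rw [← integral_const_mul, ← integral_neg]
    refine integral_congr_ae ?_
    filter_upwards [hint] with t ht
    rw [_root_.zero_apply, zero_sub, smul_neg, inner_neg_right, real_inner_smul_right, ht]
  simp only [id_eq] at hle
  rw [h1] at hle
  simp only [_root_.smul_apply, D.formL_apply hΓ₀ (hI (right_mem_Icc.2 hab.le)),
    D.formL_apply hΓ₀ (hI (left_mem_Icc.2 hab.le)), smul_eq_mul, _root_.zero_apply, inner_zero_left,
    integral_zero, add_zero] at hle
  linarith

theorem IsLogLipschitz.exists_norm_exp_smul_sub_le (hL : D.IsLogLipschitz L) {κ : ℝ}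
    (hκ : 0 ≤ κ) (hI : ∀ t ∈ Icc a b, -t ∈ Ioo 0 T) : ∃ Λ : ℝ, ∀ s ∈ Icc a b, ∀ t ∈ Icc a b,
    ‖Real.exp (-(κ * t)) • mulL2 m (D.dens (-t)) -
      Real.exp (-(κ * s)) • mulL2 m (D.dens (-s))‖ ≤ Λ * |t - s| := by
  obtain ⟨c, hc⟩ := hL.exists_norm_mulL2_sub_le
  obtain ⟨d, hd0, hd, -⟩ := D.exists_dens_bound
  set q : ℝ := κ * (|a| + |b|) with hq
  have hbd : ∀ t ∈ Icc a b, |κ * t| ≤ q := fun t ht => by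
    rw [abs_mul, abs_of_nonneg hκ]
    refine mul_le_mul_of_nonneg_left (abs_le.2 ⟨?_, ?_⟩) hκ
    · linarith [neg_abs_le a, abs_nonneg b, ht.1]
    · linarith [le_abs_self b, abs_nonneg a, ht.2]
  refine ⟨Real.exp q * κ * d + Real.exp q * |c|, fun s hs t ht => ?_⟩
  have e : Real.exp (-(κ * t)) • mulL2 m (D.dens (-t)) -
      Real.exp (-(κ * s)) • mulL2 m (D.dens (-s)) =
      (Real.exp (-(κ * t)) - Real.exp (-(κ * s))) • mulL2 m (D.dens (-t)) +
        Real.exp (-(κ * s)) • (mulL2 m (D.dens (-t)) - mulL2 m (D.dens (-s))) := by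
    rw [sub_smul, smul_sub]
    abel
  have h1 : ‖mulL2 m (D.dens (-t))‖ ≤ d := by
    refine ContinuousLinearMap.opNorm_le_bound _ hd0.le fun f =>
      norm_mulL2_apply_le (D.memLp_dens (hI t ht)) (Eventually.of_forall fun x => ?_) f
    rw [abs_of_pos (D.dens_pos _ x)]
    exact hd _ (hI t ht) x
  have h2 : |Real.exp (-(κ * t)) - Real.exp (-(κ * s))| ≤ Real.exp q * κ * |t - s| := by
    refine (abs_exp_neg_sub_le (hbd t ht) (hbd s hs)).trans (le_of_eq ?_)
    rw [← mul_sub, abs_mul, abs_of_nonneg hκ, mul_assoc]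
  have h3 : ‖mulL2 m (D.dens (-t)) - mulL2 m (D.dens (-s))‖ ≤ |c| * |t - s| := by
    refine (hc _ (hI s hs) _ (hI t ht)).trans ?_
    rw [show -t - -s = -(t - s) by ring, abs_neg]
    exact mul_le_mul_of_nonneg_right (le_abs_self c) (abs_nonneg _)
  have h4 : Real.exp (-(κ * s)) ≤ Real.exp q :=
    Real.exp_le_exp.2 (by linarith [(abs_le.1 (hbd s hs)).1])
  rw [e]
  refine (norm_add_le _ _).trans ?_
  rw [norm_smul, norm_smul, Real.norm_eq_abs, Real.norm_eq_abs, abs_of_pos (Real.exp_pos _)]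
  have h5 := mul_le_mul h2 h1 (norm_nonneg _) (by positivity)
  have h6 := mul_le_mul h4 h3 (norm_nonneg _) (Real.exp_pos _).le
  linarith

/-- The left time derivative of the scaled weights in reversed time. -/
theorem IsLogLipschitz.tendsto_exp_quotient (hL : D.IsLogLipschitz L) (hL0 : 0 ≤ L) {κ r : ℝ}
    (hr : -r ∈ Ioo 0 T) (hd : ∀ᵐ x ∂m, DifferentiableAt ℝ (fun t => D.f t x) (-r))
    (v : ℝ → Lp ℝ 2 m) :
    Tendsto (fun k => k⁻¹ * inner ℝ ((Real.exp (-(κ * r)) • mulL2 m (D.dens (-r)) -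
        Real.exp (-(κ * (r - k))) • mulL2 m (D.dens (-(r - k)))) (v (-r))) (v (-r))) (𝓝[>] 0)
      (𝓝 (inner ℝ (Real.exp (-(κ * r)) • D.source v (-r)) (v (-r)) -
        κ * inner ℝ (Real.exp (-(κ * r)) • mulL2 m (D.dens (-r)) (v (-r))) (v (-r)))) := by
  set u := v (-r) with hu
  -- Reversed time r - k is original time -r + k, so the left quotient in r is minus the right
  -- quotient at -r in the original time.
  set ψ : ℝ → ℝ := fun k => inner ℝ (mulL2 m (D.dens (-r + k)) u) u with hψ
  have h1 : HasDerivAt ψ (-inner ℝ (D.source v (-r)) u) 0 := by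
    rw [hasDerivAt_iff_tendsto_slope_zero]
    have h2 := (hL.tendsto_quotient hL0 hr hd u).inner (𝕜 := ℝ) (tendsto_const_nhds (x := u))
    rw [inner_neg_left] at h2
    refine h2.congr fun k => ?_
    simp only [hψ, zero_add, add_zero, real_inner_smul_left, inner_sub_left, smul_eq_mul]
  have h3 : HasDerivAt (fun k : ℝ => Real.exp (-(κ * (r - k)))) (Real.exp (-(κ * r)) * κ) 0 := by
    have h4 : HasDerivAt (fun k : ℝ => -(κ * (r - k))) κ 0 := by
      have := (((hasDerivAt_id (0 : ℝ)).const_sub r).const_mul κ).neg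
      exact this.congr_deriv (by simp)
    simpa using h4.exp
  have h5 := (hasDerivAt_iff_tendsto_slope_zero.1 (h3.mul h1)).neg.mono_left
    (nhdsWithin_mono (0 : ℝ) fun k (hk : 0 < k) => hk.ne')
  refine (h5.congr fun k => ?_).trans (le_of_eq ?_)
  · have e : -(r - k) = -r + k := by ring
    simp only [hψ, zero_add, add_zero, sub_zero, Pi.mul_apply, smul_eq_mul, e, _root_.sub_apply,
      _root_.smul_apply, inner_sub_left, real_inner_smul_left]
    ring
  · congr 1
    simp only [hψ, add_zero, sub_zero, real_inner_smul_left]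
    ring

/-- With d = ∂_t f the integrand is 2g² + 2dgv + (d + κ)v². Completing the square to 2(g + dv/2)²
costs d²v²/2 ≤ L²v²/2, and d ≥ -L, whence the threshold L + L²/2. -/
theorem IsLogLipschitz.quadratic_nonneg (hL : D.IsLogLipschitz L) (hL0 : 0 ≤ L) {κ t : ℝ}
    (hκ : L + L ^ 2 / 2 ≤ κ) (ht : t ∈ Ioo 0 T) (v : ℝ → Lp ℝ 2 m) (g : Lp ℝ 2 m) :
    0 ≤ 2 * inner ℝ (mulL2 m (D.dens t) g) g + 2 * inner ℝ (D.source v t) g +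
      inner ℝ (D.source v t) (v t) + κ * inner ℝ (mulL2 m (D.dens t) (v t)) (v t) := by
  have hρ := D.memLp_dens (m := m) ht
  set w := mulL2 m (D.derivF t) (v t) with hw
  have hs : D.source v t = mulL2 m (D.dens t) w := rfl
  rw [hs, inner_mulL2 hρ, inner_mulL2 hρ, inner_mulL2 hρ, inner_mulL2 hρ, ← integral_const_mul,
    ← integral_const_mul, ← integral_const_mul]
  have i1 := (integrable_mul_L2 hρ g g).const_mul 2
  have i2 := (integrable_mul_L2 hρ w g).const_mul 2
  have i3 := integrable_mul_L2 hρ w (v t)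
  have i4 := (integrable_mul_L2 hρ (v t) (v t)).const_mul κ
  have e1 := integral_add i1 i2
  have e2 := integral_add (i1.add i2) i3
  have e3 := integral_add ((i1.add i2).add i3) i4
  simp only [Pi.add_apply] at e1 e2 e3
  rw [← e1, ← e2, ← e3]
  refine integral_nonneg_of_ae ?_
  filter_upwards [coeFn_mulL2 (hL.memLp_derivF hL0 ht) (v t)] with x hx
  have h1 := hL.abs_derivF_le hL0 ht x
  rw [← hw] at hx
  simp only [Pi.zero_apply, hx]
  set d := D.derivF t x
  have h2 : 0 ≤ L + d := by linarith [(abs_le.1 h1).1]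
  have h3 : 0 ≤ L ^ 2 - d ^ 2 := by
    have := sq_le_sq' (by linarith [(abs_le.1 h1).1]) (abs_le.1 h1).2
    linarith
  have h4 : 0 ≤ (2 * (g x + d * v t x / 2) ^ 2 + (L ^ 2 - d ^ 2) / 2 * v t x ^ 2 +
      (L + d) * v t x ^ 2 + (κ - (L + L ^ 2 / 2)) * v t x ^ 2) := by
    have h5 : 0 ≤ κ - (L + L ^ 2 / 2) := by linarith
    positivity
  have h6 := mul_nonneg (D.dens_pos t x).le h4
  refine h6.trans (le_of_eq ?_)
  ring

/-- The energy estimate for the adjoint heat equation. -/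
theorem IsLogLipschitz.exists_energy_le_reverse [SigmaFinite m] (hL : D.IsLogLipschitz L)
    (hΓ₀ : E.IsSquareField Γ₀) (hL0 : 0 ≤ L) {κ : ℝ} (hκ3 : 3 * L ≤ κ) (hκ : L + L ^ 2 / 2 ≤ κ)
    (ha : 0 < a) (hab : a < b) (hb : b < T)
    (hu : IsParabolic E.toL2 a b u U dU) {x₀ : E.Dom} (hx₀ : E.toL2 x₀ = u b)
    (hg : MemLp g 2 (volume.restrict (Ioo (-b) (-a))))
    (hgu : ∀ r ∈ Icc (-b) (-a), u (-r) - u b = ∫ x in (-b)..r, g x)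
    (hgen : ∀ᵐ r ∂volume.restrict (Ioo (-b) (-a)), ∀ w, D.formL (-r) (U (-r)) w =
      -inner ℝ (mulL2 m (D.dens (-r)) (g r) + D.source u (-r)) (E.toL2 w)) :
    ∃ x : E.Dom, E.toL2 x = u a ∧ D.form a x x + ∫ z, |u a z| ^ 2 ∂D.meas a ≤
      Real.exp (κ * (b - a)) * (D.form b x₀ x₀ + ∫ z, |u b z| ^ 2 ∂D.meas b) := by
  have hab' : -b < -a := by linarith
  have hI : ∀ r ∈ Icc (-b) (-a), -r ∈ Ioo 0 T := fun r hr =>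
    ⟨by linarith [hr.2], by linarith [hr.1]⟩
  have haI : a ∈ Ioo 0 T := ⟨ha, hab.trans hb⟩
  have hbI : b ∈ Ioo 0 T := ⟨ha.trans hab, hb⟩
  have hmaps : MapsTo (fun r : ℝ => -r) (Icc (-b) (-a)) (Icc a b) := fun r hr =>
    ⟨by linarith [hr.2], by linarith [hr.1]⟩
  have hE := hL.evolutionFamily hΓ₀ hL0 (θ := fun t => -t) LipschitzWith.id.neg hI hκ3
  obtain ⟨c, hc0, hcα⟩ := D.exists_coercive hΓ₀ (hI (-a) (right_mem_Icc.2 hab'.le))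
    (Real.exp_pos (-(κ * -a)))
  obtain ⟨Λ, hΛ⟩ := hL.exists_norm_exp_smul_sub_le (κ := κ) (by linarith) hI
  have hsrc : MemLp (fun r => D.source u (-r)) 2 (volume.restrict (Ioo (-b) (-a))) :=
    memLp_comp_neg (hL.memLp_source hL0 hab.le ha hb hu.continuousOn)
  have hG := memLp_exp_smul (κ := κ) ((hL.memLp_dens_apply continuous_neg hI hg).add hsrc)
  have huc : ContinuousOn (fun r => u (-r)) (Icc (-b) (-a)) :=
    hu.continuousOn.comp continuousOn_neg hmaps
  obtain ⟨cl, hcl0, hcl⟩ := hE.weight_lower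
  -- The family N consists of the scaled weights themselves, which produces the term ‖v‖² in
  -- L²(m_s).
  obtain ⟨x, hx, hle⟩ := exists_energy_le hab' hE.form_cont hE.form_symm hE.form_nonneg hE.form_anti
    hc0 hcα hΛ hE.weight_symm
    (fun t ht y => (mul_nonneg hcl0.le (sq_nonneg _)).trans (hcl t ht y)) hg
    (u := fun r => u (-r)) (by simpa only [neg_neg] using hgu) huc
    (x₀ := x₀) (by rw [hx₀, neg_neg]) (U := fun r => U (-r)) (memLp_comp_neg hu.memLp)
    (ae_comp_neg hu.ae_eq) hG (by
      filter_upwards [hgen] with r hr w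
      simp only [_root_.smul_apply, hr w, smul_eq_mul, Pi.add_apply, real_inner_smul_left]
      ring_nf) (n := fun r => inner ℝ (Real.exp (-(κ * r)) • D.source u (-r)) (u (-r)) -
        κ * inner ℝ (Real.exp (-(κ * r)) • mulL2 m (D.dens (-r)) (u (-r))) (u (-r))) (by
      filter_upwards [ae_comp_neg (hL.ae_differentiableAt (m := m) hL0 hab.le ha hb),
        ae_restrict_mem measurableSet_Ioo] with r h1 hr
      exact hL.tendsto_exp_quotient hL0 (hI r (Ioo_subset_Icc_self hr)) h1 u)
  rw [neg_neg] at hx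
  refine ⟨x, hx, ?_⟩
  have hu2 := memLp_of_continuousOn huc
  have hNu := memLp_exp_smul (κ := κ) (hL.memLp_dens_apply continuous_neg hI hu2)
  set f : ℝ → ℝ := fun r => inner ℝ (g r) ((2 : ℝ) •
    (Real.exp (-(κ * r)) • mulL2 m (D.dens (-r)) (u (-r)) -
      Real.exp (-(κ * r)) • (mulL2 m (D.dens (-r)) (g r) + D.source u (-r)))) with hf
  set n : ℝ → ℝ := fun r => inner ℝ (Real.exp (-(κ * r)) • D.source u (-r)) (u (-r)) -
    κ * inner ℝ (Real.exp (-(κ * r)) • mulL2 m (D.dens (-r)) (u (-r))) (u (-r)) with hn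
  have hfi : Integrable f (volume.restrict (Ioo (-b) (-a))) :=
    integrable_bilin (innerSL ℝ) hg ((hNu.sub hG).const_smul (2 : ℝ))
  have hni : Integrable n (volume.restrict (Ioo (-b) (-a))) :=
    (integrable_bilin (innerSL ℝ) (memLp_exp_smul (κ := κ) hsrc) hu2).sub
      ((integrable_bilin (innerSL ℝ) hNu hu2).const_mul κ)
  -- The cross terms of g and v are eliminated through E(v) = -⟨e^{-f}g + source, v⟩. The integrand
  -- becomes -e^{-κr} times 2E(v) plus the quadratic form of `quadratic_nonneg`.
  have hneg : (∫ r in Ioo (-b) (-a), f r) + ∫ r in Ioo (-b) (-a), n r ≤ 0 := by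
    rw [← integral_add hfi hni]
    refine integral_nonpos_of_ae ?_
    filter_upwards [hgen, ae_comp_neg hu.ae_eq, ae_restrict_mem measurableSet_Ioo] with r h1 h2 hr
    have hrI := hI r (Ioo_subset_Icc_self hr)
    have h3 := h1 (U (-r))
    rw [D.formL_apply hΓ₀ hrI, h2] at h3
    have h4 := D.form_nonneg hrI (U (-r))
    have h5 := hL.quadratic_nonneg hL0 hκ hrI u (g r)
    rw [h3, inner_add_left] at h4
    have h6 : f r + n r = -(Real.exp (-(κ * r)) * (2 * -(inner ℝ (mulL2 m (D.dens (-r)) (g r))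
        (u (-r)) + inner ℝ (D.source u (-r)) (u (-r))) +
        (2 * inner ℝ (mulL2 m (D.dens (-r)) (g r)) (g r) + 2 * inner ℝ (D.source u (-r)) (g r) +
        inner ℝ (D.source u (-r)) (u (-r)) +
        κ * inner ℝ (mulL2 m (D.dens (-r)) (u (-r))) (u (-r))))) := by
      simp only [hf, hn, real_inner_smul_right, real_inner_smul_left, inner_sub_right,
        inner_add_right, inner_mulL2_comm (D.memLp_dens hrI), real_inner_comm (D.source u (-r)) (g r)]
      ring
    change f r + n r ≤ 0
    rw [h6, neg_nonpos]
    exact mul_nonneg (Real.exp_pos _).le (by linarith)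
  simp only [_root_.smul_apply, neg_neg, D.formL_apply hΓ₀ haI, D.formL_apply hΓ₀ hbI, smul_eq_mul,
    real_inner_smul_left, D.inner_dens_self haI, D.inner_dens_self hbI] at hle
  have hle2 : Real.exp (κ * a) * (D.form a x x + ∫ z, |u a z| ^ 2 ∂D.meas a) ≤
      Real.exp (κ * b) * (D.form b x₀ x₀ + ∫ z, |u b z| ^ 2 ∂D.meas b) := by
    rw [mul_neg, mul_neg, neg_neg, neg_neg] at hle
    change _ ≤ _ + (∫ r in Ioo (-b) (-a), f r) + (∫ r in Ioo (-b) (-a), n r) at hle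
    linarith
  have hexp : Real.exp (κ * (b - a)) = Real.exp (-(κ * a)) * Real.exp (κ * b) := by
    rw [← Real.exp_add]
    ring_nf
  have hone : Real.exp (-(κ * a)) * Real.exp (κ * a) = 1 := by
    rw [← Real.exp_add, neg_add_cancel, Real.exp_zero]
  have h := mul_le_mul_of_nonneg_left hle2 (Real.exp_pos (-(κ * a))).le
  rwa [← mul_assoc, ← mul_assoc, hone, one_mul, ← hexp] at h

end Energy

end TimeDependentForm

/-! ### The sign of L, and the empty space. -/

namespace TimeDependentForm

variable {X : Type*} [MeasurableSpace X] {m : Measure X} {E : DirichletForm m}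
  {Γ₀ : E.Dom →ₗ[ℝ] E.Dom →ₗ[ℝ] Lp ℝ 1 m} {T : ℝ} {D : TimeDependentForm E Γ₀ T} {L : ℝ}

theorem IsLogLipschitz.nonneg [Nonempty X] (hL : D.IsLogLipschitz L) (hT : 0 < T) : 0 ≤ L := by
  obtain ⟨x⟩ := ‹Nonempty X›
  have h := hL.density (T / 3) ⟨by linarith, by linarith⟩ (T / 2) ⟨by linarith, by linarith⟩ x
  have h1 : 0 ≤ L * |T / 2 - T / 3| := (abs_nonneg _).trans h
  exact nonneg_of_mul_nonneg_left h1 (abs_pos.2 (by linarith))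

theorem mem_domA_of_isEmpty [IsEmpty X] (t : ℝ) (u : Lp ℝ 2 m) : u ∈ D.domA t :=
  ⟨0, 0, Lp.ext (ae_of_all _ fun x => isEmptyElim x), fun v => by
    rw [form, integral_of_isEmpty, integral_of_isEmpty, neg_zero]⟩

theorem subsingleton_Lp [IsEmpty X] : Subsingleton (Lp ℝ 2 m) :=
  ⟨fun _ _ => Lp.ext (ae_of_all _ fun x => isEmptyElim x)⟩

end TimeDependentForm

end HeatFlow

end

/-! ### The theorem. -/

theorem mainTheorem11 {X : Type*} [TopologicalSpace X] [PolishSpace X] [MeasurableSpace X]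
    [BorelSpace X] (m : Measure X) [SigmaFinite m] [m.IsOpenPosMeasure]
    (E : HeatFlow.DirichletForm m) (Γ₀ : E.Dom →ₗ[ℝ] E.Dom →ₗ[ℝ] Lp ℝ 1 m)
    (hΓ₀ : E.IsSquareField Γ₀) (T L : ℝ) (D : HeatFlow.TimeDependentForm E Γ₀ T)
    (hL : D.IsLogLipschitz L) :
    -- the heat equation
    (∀ s τ : ℝ, 0 < s → s < τ → τ < T → ∀ u : ℝ → Lp ℝ 2 m, D.IsHeatSolution s T u →
      (∀ᵐ t ∂volume.restrict (Ioo s τ), u t ∈ D.domA t) ∧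
      (∀ us : E.Dom, E.toL2 us = u s →
        -- `u ∈ L²((s,τ) → Dom(A_·))`
        MemLp u 2 (volume.restrict (Ioo s τ)) ∧
        MemLp (fun t => D.A t (u t)) 2 (volume.restrict (Ioo s τ)) ∧
        -- `u ∈ H¹((s,τ) → H)`
        (∃ du : ℝ → Lp ℝ 2 m, MemLp du 2 (volume.restrict (Ioo s τ)) ∧
          HeatFlow.HasWeakDerivOn s τ u du) ∧
        -- the energy estimate
        IntegrableOn (fun t => Real.exp (-3 * L * t) * ∫ x, |D.A t (u t) x| ^ 2 ∂D.meas t)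
          (Ioo s τ) ∧
        ∃ uτ : E.Dom, E.toL2 uτ = u τ ∧
          Real.exp (-3 * L * τ) * D.form τ uτ uτ +
              2 * ∫ t in Ioo s τ, Real.exp (-3 * L * t) * ∫ x, |D.A t (u t) x| ^ 2 ∂D.meas t ≤
            Real.exp (-3 * L * s) * D.form s us us)) ∧
    -- the adjoint heat equation
    (∀ σ t : ℝ, 0 ≤ σ → σ < t → t ≤ T → ∀ v : ℝ → Lp ℝ 2 m, D.IsAdjointHeatSolution σ t v →
      (∀ᵐ s ∂volume.restrict (Ioo σ t), v s ∈ D.domA s) ∧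
      (t < T → ∀ vt : E.Dom, E.toL2 vt = v t → ∀ s ∈ Ioo σ t,
        ∃ vs : E.Dom, E.toL2 vs = v s ∧
          D.form s vs vs + ∫ x, |v s x| ^ 2 ∂D.meas s ≤
            Real.exp (max (3 * L) (L + L ^ 2 / 2) * (t - s)) *
              (D.form t vt vt + ∫ x, |v t x| ^ 2 ∂D.meas t))) := by
  -- On an empty space the conditions do not force L ≥ 0, but every term vanishes. Otherwise the
  -- density bound at one point gives L ≥ 0.
  rcases isEmpty_or_nonempty X with hX | hX
  · have := HeatFlow.TimeDependentForm.subsingleton_Lp (m := m)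
    have hLp : ∀ w : ℝ → Lp ℝ 2 m, w = fun _ => 0 := fun w => Subsingleton.elim _ _
    refine ⟨fun s τ _ _ _ u _ => ⟨Eventually.of_forall fun t =>
      HeatFlow.TimeDependentForm.mem_domA_of_isEmpty t _, fun us _ => ⟨?_, ?_, ⟨0, MemLp.zero, ?_⟩, ?_, 0,
        Subsingleton.elim _ _, ?_⟩⟩, fun σ t _ _ _ v _ => ⟨Eventually.of_forall fun t =>
      HeatFlow.TimeDependentForm.mem_domA_of_isEmpty t _, fun _ vt _ s _ => ⟨0, Subsingleton.elim _ _, ?_⟩⟩⟩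
    · rw [hLp u]
      exact MemLp.zero
    · rw [hLp fun t => D.A t (u t)]
      exact MemLp.zero
    · exact fun φ _ _ _ => Subsingleton.elim _ _
    · simp only [integral_of_isEmpty, mul_zero]
      exact integrableOn_zero
    · simp only [HeatFlow.TimeDependentForm.form, integral_of_isEmpty, mul_zero, integral_zero, add_zero,
        le_refl]
    · simp only [HeatFlow.TimeDependentForm.form, integral_of_isEmpty, mul_zero, add_zero, le_refl]
  have : Fact ((2 : ENNReal) ≠ ⊤) := ⟨by norm_num⟩
  have : SecondCountableTopology E.Dom := E.secondCountable_dom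
  refine ⟨fun s τ hs hsτ hτ u hu => ?_, fun σ t hσ hσt ht v hv => ?_⟩
  · have hL0 : 0 ≤ L := hL.nonneg (hs.trans (hsτ.trans hτ))
    refine ⟨ae_restrict_of_ae_restrict_of_subset (Ioo_subset_Ioo le_rfl hτ.le)
      (hu.ae_mem_domA hL hΓ₀ hL0 hs.le le_rfl), fun us hus => ?_⟩
    obtain ⟨U, dU, hU, heq⟩ := hu.exists_ae_eq hL hΓ₀ hL0 hs.le le_rfl
    have hm := hU.mono le_rfl hτ.le
    obtain ⟨g, hg, hgw, hgu, hgen⟩ := hL.exists_deriv_forward hΓ₀ hL0 hs hsτ hτ hm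
      (heq s τ le_rfl hsτ hτ.le hs hτ) hus
    obtain ⟨hint, x, hx, hle⟩ := hL.exists_energy_le_forward hΓ₀ hL0 hs hsτ hτ hm hus hg hgu hgen
    -- Uniqueness identifies the chosen A_t u_t with g_t; this is what makes t ↦ A_t u_t measurable.
    have hA : (fun t => D.A t (u t)) =ᵐ[volume.restrict (Ioo s τ)] g := by
      filter_upwards [hgen, hm.ae_eq, ae_restrict_mem measurableSet_Ioo] with t h1 h2 ht
      have htI : t ∈ Ioo 0 T := ⟨hs.trans ht.1, ht.2.trans hτ⟩
      exact (HeatFlow.TimeDependentForm.isGenerator_of_formL hΓ₀ htI h2 h1).A_eq htI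
    have hI : (fun t => Real.exp (-3 * L * t) * ∫ x, |D.A t (u t) x| ^ 2 ∂D.meas t)
        =ᵐ[volume.restrict (Ioo s τ)]
          fun t => Real.exp (-(3 * L * t)) * ∫ x, |g t x| ^ 2 ∂D.meas t := by
      filter_upwards [hA] with t ht
      rw [ht, show -3 * L * t = -(3 * L * t) by ring]
    refine ⟨HeatFlow.memLp_of_continuousOn hm.continuousOn, hg.ae_eq hA.symm, ⟨g, hg, hgw⟩,
      Integrable.congr hint hI.symm, x, hx, ?_⟩
    rw [integral_congr_ae hI, show -3 * L * τ = -(3 * L * τ) by ring,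
      show -3 * L * s = -(3 * L * s) by ring]
    exact hle
  · have hL0 : 0 ≤ L := hL.nonneg ((hσ.trans_lt hσt).trans_le ht)
    refine ⟨hv.ae_mem_domA hL hΓ₀ hL0 hσ ht, fun htT vt hvt s hs => ?_⟩
    obtain ⟨V, dV, hV, heq⟩ := hv.exists_ae_eq hL hΓ₀ hL0 hσ ht
    have hs0 : 0 < s := hσ.trans_lt hs.1
    have hm := hV.mono hs.1.le le_rfl
    obtain ⟨g, hg, hgu, hgen⟩ := hL.exists_deriv_reverse hΓ₀ hL0 hs0 hs.2 htT hm
      (heq s t hs.1.le hs.2 le_rfl hs0 htT) hvt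
    exact hL.exists_energy_le_reverse hΓ₀ hL0 (le_max_left _ _) (le_max_right _ _) hs0 hs.2 htT hm
      hvt hg hgu hgen
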